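/- Let $\{X_i\}_{i\in\mathbb Z}$ be a strictly stationary sequence of real random variables with strong mixing coefficients $\alpha(t)=\sup_{k\in\mathbb Z}\sup\{|P(A\cap B)-P(A)P(B)|: A\in\sigma(X_i,i\le k),\,B\in\sigma(X_i,i\ge k+t)\}$ satisfying $\alpha(t)=O(t^{-\beta})$ as $t\to\infty$ for some $\beta>2$. Suppose that $X_1$ has a bounded density $f$ and that, for every $d\ge 1$, the vectors $(X_0,X_{i_1},\dots,X_{i_d})$, $0<i_1<\dots<i_d$, have joint densities bounded by a constant depending only on $d$. Let $K$ be a non-negative, symmetric, bounded kernel with $\int K(u)\,du=1$, $\mu_2=\int u^2K(u)\,du<\infty$, $\nu_2=\int K(u)^2\,du<\infty$ and $\int |u|^3K(u)\,du<\infty$. Let $x_0\in\mathbb R$ be a point at which $f$ is positive and four times continuously differentiable, and put $\hat f_h(x_0)=(nh)^{-1}\sum_{i=1}^nK((X_i-x_0)/h)$. For $d\ge 3$ define $$\gamma_0(\beta,d)=1-\mathbf 1\{\beta>d-1\}\,\frac{\beta-1}{\beta+d-2}\left\{\frac{(\beta-1)(\beta+d-2)}{\beta^2+(d-3)\beta+(d-2)^2}\right\}^{\frac{\beta-1}{\beta-d+1}},\qquad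 g_0(\beta)=\inf_{d\ge 3}\,d\left(\frac{\beta}{\beta-1}-\gamma_0(\beta,d)\right),$$ and, for $\delta>0$, $$R_\delta(n,h)=n^{-(\beta-1)/(4\beta+2)}h^{-(\beta+1)/(4\beta+2)}+h^{(\beta-2)/\beta}+n^{-1/2+\delta}h^{-(3\beta+3)/(2\beta-2)+g_0(\beta)}.$$ (i) If the bandwidths $h=h_n>0$ satisfy $nh^3\to\infty$ and $h=O(n^{-1/5})$, then for every fixed $y\in\mathbb R$ and every $\delta>0$, as $n\to\infty$, $$\mathbb P\big((nh)^{1/2}\{\hat f_h(x_0)-f(x_0)\}\le y\big)=\Phi\left(\frac{y-n^{1/2}h^{5/2}f''(x_0)\mu_2/2}{\sqrt{f(x_0)\nu_2}}\right)+O\big(R_\delta(n,h)\big),$$ where $\Phi$ is the standard normal distribution function. (ii) The minimum order of the error bound is $n^{-(\beta-1)(\beta-2)/(5\beta^2-5\beta-4)}$: for all bandwidths as in (i) and all $\delta>0$, $n^{-(\beta-1)(\beta-2)/(5\beta^2-5\beta-4)}=O(R_\delta(n,h))$; and if $h>0$ has exact order $n^{-\beta(\beta-1)/(5\beta^2-5\beta-4)}$,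 then $h$ satisfies the conditions in (i), $R_\delta(n,h)$ has exact order $n^{-(\beta-1)(\beta-2)/(5\beta^2-5\beta-4)}$ for all sufficiently small $\delta>0$, and for every fixed $y$ the error of the normal approximation in (i) is $O(n^{-(\beta-1)(\beta-2)/(5\beta^2-5\beta-4)})$. -/

import Mathlib

open MeasureTheory ProbabilityTheory Filter Asymptotics Topology

noncomputable section

/-- Strict stationarity of a doubly infinite sequence: the law of the whole sequence on `ℤ → ℝ`
(with the product σ-algebra) is invariant under every time shift. -/
def StrictlyStationary {Ω : Type*} [MeasurableSpace Ω] (P : Measure Ω) (X : ℤ → Ω → ℝ) : Prop :=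
  ∀ k : ℤ, IdentDistrib (fun ω (i : ℤ) => X i ω) (fun ω (i : ℤ) => X (i + k) ω) P P

/-- The α-mixing coefficient `sup_{A ∈ m₁, B ∈ m₂} |P(A ∩ B) - P(A) P(B)|` between two σ-algebras. -/
def alphaCoeff {Ω : Type*} [MeasurableSpace Ω] (P : Measure Ω) (m₁ m₂ : MeasurableSpace Ω) : ℝ :=
  sSup {r : ℝ | ∃ A B : Set Ω, MeasurableSet[m₁] A ∧ MeasurableSet[m₂] B ∧
    r = |P.real (A ∩ B) - P.real A * P.real B|}

/-- The σ-algebra generated by `X i`, `i ≤ k`. -/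
abbrev pastSigma {Ω : Type*} (X : ℤ → Ω → ℝ) (k : ℤ) : MeasurableSpace Ω :=
  ⨆ (i : ℤ) (_ : i ≤ k), MeasurableSpace.comap (X i) (borel ℝ)

/-- The σ-algebra generated by `X i`, `i ≥ k`. -/
abbrev futureSigma {Ω : Type*} (X : ℤ → Ω → ℝ) (k : ℤ) : MeasurableSpace Ω :=
  ⨆ (i : ℤ) (_ : k ≤ i), MeasurableSpace.comap (X i) (borel ℝ)

/-- The strong mixing coefficient `α(t)` of the sequence `X`. -/
def alphaMixing {Ω : Type*} [MeasurableSpace Ω] (P : Measure Ω) (X : ℤ → Ω → ℝ) (t : ℕ) : ℝ :=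
  ⨆ k : ℤ, alphaCoeff P (pastSigma X k) (futureSigma X (k + t))

/-- `f` is a (nonnegative, measurable) density of the random vector or variable `Y`, with respect
to Lebesgue measure. -/
def IsDensity {Ω : Type*} [MeasurableSpace Ω] (P : Measure Ω) {E : Type*} [MeasureSpace E]
    (Y : Ω → E) (f : E → ℝ) : Prop :=
  Measurable f ∧ (∀ x, 0 ≤ f x) ∧
    P.map Y = (volume : Measure E).withDensity (fun x => ENNReal.ofReal (f x))

/-- For every `d ≥ 1` the vectors `(X_0, X_{i_1}, …, X_{i_d})`, `0 < i_1 < ⋯ < i_d`, have joint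
densities bounded by a constant that depends only on `d`. -/
def BoundedJointDensities {Ω : Type*} [MeasurableSpace Ω] (P : Measure Ω) (X : ℤ → Ω → ℝ) : Prop :=
  ∀ d : ℕ, 1 ≤ d → ∃ C : ℝ, ∀ i : Fin (d + 1) → ℕ, StrictMono i → i 0 = 0 →
    ∃ g : (Fin (d + 1) → ℝ) → ℝ,
      IsDensity P (fun ω (j : Fin (d + 1)) => X (i j : ℤ) ω) g ∧ ∀ x, g x ≤ C

/-- A non-negative, symmetric, bounded kernel with unit mass and finite `∫ |u|³ K(u) du`;
the integrability of `u² K(u)` and of `K(u)²` is part of the definition. -/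
structure IsKernel (K : ℝ → ℝ) : Prop where
  measurable : Measurable K
  nonneg : ∀ u, 0 ≤ K u
  symm : ∀ u, K (-u) = K u
  bounded : ∃ B : ℝ, ∀ u, K u ≤ B
  integrable : Integrable K
  integral_eq_one : ∫ u, K u = 1
  integrable_second : Integrable (fun u => u ^ 2 * K u)
  integrable_sq : Integrable (fun u => K u ^ 2)
  integrable_third : Integrable (fun u => |u| ^ 3 * K u)

/-- `μ₂ = ∫ u² K(u) du`. -/
def kernelMu2 (K : ℝ → ℝ) : ℝ := ∫ u, u ^ 2 * K u

/-- `ν₂ = ∫ K(u)² du`. -/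
def kernelNu2 (K : ℝ → ℝ) : ℝ := ∫ u, K u ^ 2

/-- The kernel density estimator `(n h)⁻¹ ∑_{i=1}^n K((X_i - x₀)/h)`. -/
def kde {Ω : Type*} (X : ℤ → Ω → ℝ) (K : ℝ → ℝ) (x₀ : ℝ) (n : ℕ) (h : ℝ) (ω : Ω) : ℝ :=
  ((n : ℝ) * h)⁻¹ * ∑ i ∈ Finset.Icc 1 n, K ((X (i : ℤ) ω - x₀) / h)

/-- The standard normal distribution function. -/
def stdNormalCDF (x : ℝ) : ℝ := cdf (gaussianReal 0 1) x

/-- `γ₀(β, d)`. -/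
def gamma0 (β : ℝ) (d : ℕ) : ℝ :=
  1 - (if β > (d : ℝ) - 1 then 1 else 0) * ((β - 1) / (β + d - 2)) *
    (((β - 1) * (β + d - 2)) / (β ^ 2 + ((d : ℝ) - 3) * β + ((d : ℝ) - 2) ^ 2)) ^
      ((β - 1) / (β - d + 1))

/-- `g₀(β) = inf {d (β/(β-1) - γ₀(β, d)) : d ≥ 3}`. -/
def g0 (β : ℝ) : ℝ :=
  sInf {r : ℝ | ∃ d : ℕ, 3 ≤ d ∧ r = d * (β / (β - 1) - gamma0 β d)}

/-- The error order
`n^{-(β-1)/(4β+2)} h^{-(β+1)/(4β+2)} + h^{(β-2)/β} + n^{-1/2+δ} h^{-(3β+3)/(2β-2)+g₀(β)}`. -/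
def errorOrder (β δ : ℝ) (n : ℕ) (h : ℝ) : ℝ :=
  (n : ℝ) ^ (-(β - 1) / (4 * β + 2)) * h ^ (-(β + 1) / (4 * β + 2))
    + h ^ ((β - 2) / β)
    + (n : ℝ) ^ (-(1 / 2) + δ) * h ^ (-(3 * β + 3) / (2 * β - 2) + g0 β)

/-- The error of the normal approximation at `y`, i.e. `P((nh)^{1/2}{f̂_h(x₀) - f(x₀)} ≤ y)` minus
`Φ((y - n^{1/2} h^{5/2} f''(x₀) μ₂ / 2) / √(f(x₀) ν₂))`. -/
def normalApproxError {Ω : Type*} [MeasurableSpace Ω] (P : Measure Ω) (X : ℤ → Ω → ℝ)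
    (f K : ℝ → ℝ) (x₀ y : ℝ) (n : ℕ) (h : ℝ) : ℝ :=
  P.real {ω | ((n : ℝ) * h) ^ (1 / 2 : ℝ) * (kde X K x₀ n h ω - f x₀) ≤ y} -
    stdNormalCDF
      ((y - (n : ℝ) ^ (1 / 2 : ℝ) * h ^ (5 / 2 : ℝ) * iteratedDeriv 2 f x₀ * kernelMu2 K / 2) /
        √(f x₀ * kernelNu2 K))

/-- A sequence of positive bandwidths with `n h³ → ∞` and `h = O(n^{-1/5})`. -/
def IsBandwidth (h : ℕ → ℝ) : Prop :=
  (∀ n, 0 < h n) ∧ Tendsto (fun n : ℕ => (n : ℝ) * h n ^ 3) atTop atTop ∧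
    h =O[atTop] (fun n : ℕ => (n : ℝ) ^ (-(1 / 5) : ℝ))

/-- The exponent `(β-1)(β-2)/(5β²-5β-4)` of the best rate. -/
def optRate (β : ℝ) : ℝ := (β - 1) * (β - 2) / (5 * β ^ 2 - 5 * β - 4)

/-- The exponent `β(β-1)/(5β²-5β-4)` of the best bandwidth. -/
def optBandwidth (β : ℝ) : ℝ := β * (β - 1) / (5 * β ^ 2 - 5 * β - 4)

end

/-! The kernel estimator is a normalised sum of the centred variables `Z i = K((X_{i+1} - x₀)/h) - E
K((X_1 - x₀)/h)`. The proof compares it with a normal law by Lindeberg replacement, without blocking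
or characteristic functions, and obtains the error `(nh)^(-1/4) + h^((β-2)/β)`. This is at most the
first two terms of the stated order when `n ≥ 1` and `h ≤ 1`. Of the third term, part (i) needs only
nonnegativity.

Dependence enters through one estimate: a function of the past dominated by `|Z j|` and a function
of the future dominated by `|Z k|` have covariance at most `Q min(h², (k-j)^(-β))`. The first bound
comes from bounded pair densities, the second from strong mixing (`weaklyDependent_centredKernel`).
Splitting at the gap `h^(-2/β)`, where the two bounds agree, gives a sum of order `h · h^((β-2)/β)`.
With an extra weight equal to the gap, the order is `(h^((β-2)/β))²`, and this is where `β > 2`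
matters (`sum_pow_mul_min_le`).

One Lindeberg step replaces `E φ(S_{k+1}) - E φ(S_k)` by half the variance increment times `E
φ''(S_k)`, with an error of `sup |φ'''|` times third moments and weighted covariance sums
(`lindeberg_step`). The test function is `Φ((y - ·)/√w)`, where `w` is `ε²` plus the variance still
to come. By the heat equation (`heat_step`), removing one increment from `w` cancels the main term.
The errors are of order `w^(-3/2)` and sum to `A/(sε)`, where `s` bounds the increments from below.
Removing the smoothing costs `ε/√V`, where `V` is the total variance (`berryEsseen`).

For the kernel variables `s` is of order `h`, `V` of order `nh`, and `A` of order `h +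
h^(2(β-2)/β)`. The choice `ε = √(nh) ((nh)^(-1/4) + h^((β-2)/β))` balances the two costs as soon as
`nh³ ≥ 1` (`exists_partialSum_bound`). A Taylor expansion of `f` at `x₀` supplies the bias, and `nh⁵
= O(1)` makes its remainder `O(h)`.

For part (ii), the first term of the order decreases in `h`, the second increases, and they meet at
the optimal bandwidth. There the third term is negligible because `γ₀ ≤ 1` forces `g₀(β) ≥ 3/(β-1)`.
-/

/-! ### Covariances of bounded variables under strong mixing -/

section Covariance

variable {Ω : Type*} [mΩ : MeasurableSpace Ω]

/-- Measurable and uniformly bounded real functions. -/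
def BddMeas (U : Ω → ℝ) : Prop := Measurable U ∧ ∃ C : ℝ, ∀ ω, |U ω| ≤ C

lemma BddMeas.const (c : ℝ) : BddMeas (fun _ : Ω => c) := ⟨measurable_const, |c|, fun _ => le_rfl⟩

lemma BddMeas.add {U W : Ω → ℝ} (hU : BddMeas U) (hW : BddMeas W) :
    BddMeas (fun ω => U ω + W ω) := by
  obtain ⟨hU, C, hC⟩ := hU
  obtain ⟨hW, D, hD⟩ := hW
  exact ⟨hU.add hW, C + D, fun ω => (abs_add_le _ _).trans (add_le_add (hC ω) (hD ω))⟩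

lemma BddMeas.neg {U : Ω → ℝ} (hU : BddMeas U) : BddMeas (fun ω => -U ω) := by
  obtain ⟨hU, C, hC⟩ := hU
  exact ⟨hU.neg, C, fun ω => by simpa using hC ω⟩

lemma BddMeas.sub {U W : Ω → ℝ} (hU : BddMeas U) (hW : BddMeas W) :
    BddMeas (fun ω => U ω - W ω) := by
  simpa only [sub_eq_add_neg] using hU.add hW.neg

lemma BddMeas.mul {U W : Ω → ℝ} (hU : BddMeas U) (hW : BddMeas W) :
    BddMeas (fun ω => U ω * W ω) := by
  obtain ⟨hU, C, hC⟩ := hU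
  obtain ⟨hW, D, hD⟩ := hW
  refine ⟨hU.mul hW, C * D, fun ω => ?_⟩
  rw [abs_mul]
  exact mul_le_mul (hC ω) (hD ω) (abs_nonneg _) ((abs_nonneg _).trans (hC ω))

lemma BddMeas.abs {U : Ω → ℝ} (hU : BddMeas U) : BddMeas (fun ω => |U ω|) := by
  obtain ⟨hU, C, hC⟩ := hU
  exact ⟨hU.abs, C, fun ω => by simpa using hC ω⟩

lemma BddMeas.sum {ι : Type*} (s : Finset ι) {U : ι → Ω → ℝ} (hU : ∀ i ∈ s, BddMeas (U i)) :
    BddMeas (fun ω => ∑ i ∈ s, U i ω) := by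
  classical
  induction s using Finset.induction_on with
  | empty => simpa using BddMeas.const (Ω := Ω) 0
  | insert a s ha ih =>
    simp only [Finset.sum_insert ha]
    exact (hU a (by simp)).add (ih fun i hi => hU i (by simp [hi]))

lemma BddMeas.integrable {P : Measure Ω} [IsFiniteMeasure P] {U : Ω → ℝ} (hU : BddMeas U) :
    Integrable U P := by
  obtain ⟨hU, C, hC⟩ := hU
  exact Integrable.of_bound hU.aestronglyMeasurable C (ae_of_all _ hC)

/-- `E[U W] - E[U] E[W]`. -/
noncomputable def covInt (P : Measure Ω) (U W : Ω → ℝ) : ℝ :=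
  ∫ ω, U ω * W ω ∂P - (∫ ω, U ω ∂P) * ∫ ω, W ω ∂P

variable {P : Measure Ω}

lemma covInt_comm (U W : Ω → ℝ) : covInt P U W = covInt P W U := by
  simp only [covInt, mul_comm]

lemma covInt_const_mul (c : ℝ) (U W : Ω → ℝ) :
    covInt P (fun ω => c * U ω) W = c * covInt P U W := by
  simp only [covInt, mul_assoc, integral_const_mul]; ring

lemma covInt_add [IsFiniteMeasure P] {U V W : Ω → ℝ} (hU : BddMeas U) (hV : BddMeas V)
    (hW : BddMeas W) :
    covInt P (fun ω => U ω + V ω) W = covInt P U W + covInt P V W := by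
  simp only [covInt, add_mul]
  rw [integral_add (hU.mul hW).integrable (hV.mul hW).integrable,
    integral_add hU.integrable hV.integrable]
  ring

lemma covInt_const [IsProbabilityMeasure P] (c : ℝ) (W : Ω → ℝ) :
    covInt P (fun _ => c) W = 0 := by
  simp [covInt, integral_const_mul]

lemma covInt_sum [IsProbabilityMeasure P] {ι : Type*} (s : Finset ι) {U : ι → Ω → ℝ} {W : Ω → ℝ}
    (hU : ∀ i ∈ s, BddMeas (U i)) (hW : BddMeas W) :
    covInt P (fun ω => ∑ i ∈ s, U i ω) W = ∑ i ∈ s, covInt P (U i) W := by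
  classical
  induction s using Finset.induction_on with
  | empty => simpa using covInt_const (P := P) 0 W
  | insert a s ha ih =>
    simp only [Finset.sum_insert ha]
    rw [covInt_add (hU a (by simp)) (BddMeas.sum s fun i hi => hU i (by simp [hi])) hW,
      ih fun i hi => hU i (by simp [hi])]

/-- Replacing a bounded `m`-measurable factor by a sign `2·1_A - 1` with `A ∈ m`. -/
lemma exists_sign_covInt_le {Ω : Type*} {m mΩ : MeasurableSpace Ω} {P : Measure Ω}
    [IsProbabilityMeasure P] (hm : m ≤ mΩ)
    {U W : Ω → ℝ} {C : ℝ} (hU : Measurable[m] U) (hC : ∀ ω, |U ω| ≤ C) (hW : BddMeas W) :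
    ∃ A : Set Ω, MeasurableSet[m] A ∧
      |covInt P U W| ≤ C * (2 * covInt P (A.indicator fun _ => 1) W) := by
  set c := ∫ ω, W ω ∂P with hc
  set V : Ω → ℝ := fun ω => W ω - c with hV
  have hVb : BddMeas V := hW.sub (BddMeas.const c)
  have hVi : Integrable V P := hVb.integrable
  have hV0 : ∫ ω, V ω ∂P = 0 := by
    simp only [hV]
    rw [integral_sub hW.integrable (integrable_const c)]
    simp [hc]
  have key : ∀ G : Ω → ℝ, BddMeas G → covInt P G W = ∫ ω, G ω * V ω ∂P := by
    intro G hG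
    simp only [covInt, hV, mul_sub]
    rw [integral_sub (hG.mul hW).integrable (hG.integrable.mul_const c), integral_mul_const]
  -- Conditioning turns the covariance into `E[U η]`, which is at most `C E|η|`. This bound is
  -- reached by the sign of `η`, namely `2·1_A - 1` with `A = {η ≥ 0}`. The constant `-1`
  -- contributes nothing since `V` is centred.
  set η := P[V | m] with hη
  have hηm : Measurable[m] η := stronglyMeasurable_condExp.measurable
  have key2 : ∀ G : Ω → ℝ, Measurable[m] G → BddMeas G →
      ∫ ω, G ω * V ω ∂P = ∫ ω, G ω * η ω ∂P := by
    intro G hG hGb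
    rw [← integral_condExp hm]
    refine integral_congr_ae ?_
    exact condExp_mul_of_stronglyMeasurable_left hG.stronglyMeasurable
      (hGb.mul hVb).integrable hVi
  have hUb : BddMeas U := ⟨hU.mono hm le_rfl, C, hC⟩
  let A : Set Ω := {ω | 0 ≤ η ω}
  have hA : MeasurableSet[m] A := measurableSet_le measurable_const hηm
  have hAi : Measurable[m] (A.indicator fun _ => (1 : ℝ)) := measurable_const.indicator hA
  have hAb : BddMeas (A.indicator fun _ => (1 : ℝ)) :=
    ⟨hAi.mono hm le_rfl, 1, fun ω => by by_cases h : ω ∈ A <;> simp [h]⟩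
  refine ⟨A, hA, ?_⟩
  have hηi : Integrable η P := integrable_condExp
  rw [key U hUb, key2 U hU hUb, key _ hAb]
  have hs : 2 * ∫ ω, A.indicator (fun _ => (1 : ℝ)) ω * V ω ∂P = ∫ ω, |η ω| ∂P := by
    have h1 : ∫ ω, (2 * A.indicator (fun _ => (1 : ℝ)) ω - 1) * V ω ∂P = ∫ ω, |η ω| ∂P := by
      rw [key2 (fun ω => 2 * A.indicator (fun _ => (1 : ℝ)) ω - 1)
        ((hAi.const_mul 2).sub_const 1)
        (((BddMeas.const 2).mul hAb).sub (BddMeas.const 1))]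
      congr 1 with ω
      by_cases h : 0 ≤ η ω
      · have : ω ∈ A := h
        simp [this, abs_of_nonneg h]; ring
      · have : ω ∉ A := h
        simp [this, abs_of_neg (not_le.1 h)]
    rw [← h1, ← integral_const_mul]
    simp only [sub_mul, one_mul]
    rw [integral_sub ((BddMeas.const 2).mul hAb |>.mul hVb).integrable hVi, hV0, sub_zero]
    simp only [mul_assoc]
  rw [hs, ← integral_const_mul]
  refine abs_integral_le_integral_abs.trans (integral_mono_of_nonneg ?_ ?_ ?_)
  · exact ae_of_all _ fun ω => abs_nonneg _
  · exact hηi.abs.const_mul C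
  · refine ae_of_all _ fun ω => ?_
    simp only [abs_mul]
    exact mul_le_mul_of_nonneg_right (hC ω) (abs_nonneg _)

lemma covInt_indicator [IsProbabilityMeasure P] {A B : Set Ω} (hA : MeasurableSet A)
    (hB : MeasurableSet B) :
    covInt P (A.indicator fun _ => 1) (B.indicator fun _ => 1)
      = P.real (A ∩ B) - P.real A * P.real B := by
  have h1 : ∀ S : Set Ω, MeasurableSet S → ∫ ω, S.indicator (fun _ => (1 : ℝ)) ω ∂P = P.real S :=
    fun S hS => by
      rw [integral_indicator_const _ hS]; simp
  have h2 : (fun ω => A.indicator (fun _ => (1 : ℝ)) ω * B.indicator (fun _ => (1 : ℝ)) ω)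
      = (A ∩ B).indicator fun _ => 1 := by
    ext ω
    by_cases ha : ω ∈ A <;> by_cases hb : ω ∈ B <;> simp [ha, hb]
  simp only [covInt]
  rw [h1 A hA, h1 B hB, h2, h1 _ (hA.inter hB)]

/-- Boundedness is what makes the real `sSup` in `alphaCoeff` a genuine supremum: for an unbounded
set it would default to `0`. -/
lemma bddAbove_alphaCoeff {Ω : Type*} (m₁ m₂ : MeasurableSpace Ω) {mΩ : MeasurableSpace Ω}
    {P : Measure Ω} [IsProbabilityMeasure P] :
    (1 : ℝ) ∈ upperBounds {r : ℝ | ∃ A B : Set Ω, MeasurableSet[m₁] A ∧ MeasurableSet[m₂] B ∧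
      r = |P.real (A ∩ B) - P.real A * P.real B|} := by
  rintro r ⟨A, B, -, -, rfl⟩
  have h1 : P.real (A ∩ B) ≤ 1 := measureReal_le_one
  have h2 : P.real A * P.real B ≤ 1 :=
    mul_le_one₀ measureReal_le_one measureReal_nonneg measureReal_le_one
  have h3 : 0 ≤ P.real (A ∩ B) := measureReal_nonneg
  have h4 : 0 ≤ P.real A * P.real B := mul_nonneg measureReal_nonneg measureReal_nonneg
  rw [abs_le]; constructor <;> linarith

lemma le_alphaCoeff {Ω : Type*} {m₁ m₂ mΩ : MeasurableSpace Ω} {P : Measure Ω}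
    [IsProbabilityMeasure P] {A B : Set Ω}
    (hA : MeasurableSet[m₁] A) (hB : MeasurableSet[m₂] B) :
    |P.real (A ∩ B) - P.real A * P.real B| ≤ alphaCoeff P m₁ m₂ :=
  le_csSup ⟨1, bddAbove_alphaCoeff m₁ m₂⟩ ⟨A, B, hA, hB, rfl⟩

lemma alphaCoeff_le_one {Ω : Type*} (m₁ m₂ : MeasurableSpace Ω) {mΩ : MeasurableSpace Ω}
    {P : Measure Ω} [IsProbabilityMeasure P] :
    alphaCoeff P m₁ m₂ ≤ 1 :=
  csSup_le ⟨_, ∅, ∅, @MeasurableSet.empty _ m₁, @MeasurableSet.empty _ m₂, rfl⟩ (bddAbove_alphaCoeff m₁ m₂)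

/-- The covariance inequality for bounded variables under strong mixing. -/
theorem abs_covInt_le_alphaCoeff {Ω : Type*} {m₁ m₂ mΩ : MeasurableSpace Ω} {P : Measure Ω}
    [IsProbabilityMeasure P]
    (hm₁ : m₁ ≤ mΩ) (hm₂ : m₂ ≤ mΩ) {U W : Ω → ℝ} {C D : ℝ}
    (hU : Measurable[m₁] U) (hC : ∀ ω, |U ω| ≤ C) (hW : Measurable[m₂] W) (hD : ∀ ω, |W ω| ≤ D) :
    |covInt P U W| ≤ 4 * C * D * alphaCoeff P m₁ m₂ := by
  obtain ⟨ω₀⟩ : Nonempty Ω := nonempty_of_isProbabilityMeasure P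
  have hC0 : 0 ≤ C := (abs_nonneg _).trans (hC ω₀)
  have hD0 : 0 ≤ D := (abs_nonneg _).trans (hD ω₀)
  obtain ⟨A, hA, h1⟩ := exists_sign_covInt_le (P := P) hm₁ hU hC ⟨hW.mono hm₂ le_rfl, D, hD⟩
  have hAb : BddMeas (A.indicator fun _ => (1 : ℝ)) :=
    ⟨measurable_const.indicator (hm₁ _ hA), 1, fun ω => by by_cases h : ω ∈ A <;> simp [h]⟩
  -- Second use of the sign trick, now on `W` with the indicator of `A` in the other slot. Each use
  -- costs a factor `2`, whence the constant `4`.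
  obtain ⟨B, hB, h2⟩ := exists_sign_covInt_le (P := P) hm₂ hW hD hAb
  rw [covInt_comm W, covInt_comm (B.indicator _), covInt_indicator (hm₁ _ hA) (hm₂ _ hB)] at h2
  have h3 := le_abs_self (covInt P (A.indicator fun _ => 1) W)
  have h4 := (le_abs_self _).trans (le_alphaCoeff (P := P) hA hB)
  calc |covInt P U W| ≤ C * (2 * (D * (2 * alphaCoeff P m₁ m₂))) := by
        refine h1.trans ?_
        gcongr
        refine (h3.trans h2).trans ?_
        gcongr
    _ = _ := by ring

end Covariance

/-! ### One Lindeberg step for weakly dependent summands -/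

section OneStep

/-- Centred bounded variables `Z i`, adapted to a past filtration `F` and a future filtration `G`,
such that any past function dominated by `|Z j|` and any future function dominated by `|Z k|`
have covariance at most `a (k - j)`. -/
structure WeaklyDependent {Ω : Type*} [mΩ : MeasurableSpace Ω] (P : Measure Ω) (Z : ℕ → Ω → ℝ)
    (F G : ℕ → MeasurableSpace Ω) (B e : ℝ) (a : ℕ → ℝ) : Prop where
  past_le : ∀ i, F i ≤ mΩ
  past_mono : Monotone F
  future_le : ∀ i, G i ≤ mΩ
  future_anti : Antitone G
  meas_past : ∀ i, Measurable[F i] (Z i)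
  meas_future : ∀ i, Measurable[G i] (Z i)
  bound : ∀ i ω, |Z i ω| ≤ B
  mean : ∀ i, ∫ ω, Z i ω ∂P = 0
  first : ∀ i, ∫ ω, |Z i ω| ∂P ≤ e
  nonneg : ∀ m, 0 ≤ a m
  cov : ∀ j k, j < k → ∀ U W : Ω → ℝ, Measurable[F j] U → Measurable[G k] W →
    (∀ ω, |U ω| ≤ |Z j ω|) → (∀ ω, |W ω| ≤ |Z k ω|) → |covInt P U W| ≤ a (k - j)

/-- A bounded function `φ` with bounded first and second derivatives `φ₁`, `φ₂` and the Taylor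
bounds that follow from `|φ'''| ≤ M`. -/
structure TaylorBound (φ φ₁ φ₂ : ℝ → ℝ) (M : ℝ) : Prop where
  meas : Measurable φ
  meas_one : Measurable φ₁
  meas_two : Measurable φ₂
  bdd : ∃ C, ∀ x, |φ x| ≤ C
  bdd_one : ∃ C, ∀ x, |φ₁ x| ≤ C
  bdd_two : ∃ C, ∀ x, |φ₂ x| ≤ C
  nonneg : 0 ≤ M
  third : ∀ x z, |φ (x + z) - φ x - φ₁ x * z - φ₂ x * z ^ 2 / 2| ≤ M * |z| ^ 3
  second : ∀ x z, |φ₁ (x + z) - φ₁ x - φ₂ x * z| ≤ M * z ^ 2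
  first : ∀ x z, |φ₂ (x + z) - φ₂ x| ≤ M * |z|

/-- `Z 0 + ⋯ + Z (k - 1)`. -/
def partialSum {Ω : Type*} (Z : ℕ → Ω → ℝ) (k : ℕ) (ω : Ω) : ℝ := ∑ i ∈ Finset.range k, Z i ω

lemma partialSum_succ {Ω : Type*} (Z : ℕ → Ω → ℝ) (k : ℕ) (ω : Ω) :
    partialSum Z (k + 1) ω = partialSum Z k ω + Z k ω := Finset.sum_range_succ _ _

/-- `E Z_k² + 2 ∑_{i<k} E Z_i Z_k`, the increment of the variance of the partial sums. -/
noncomputable def varIncr {Ω : Type*} [MeasurableSpace Ω] (P : Measure Ω) (Z : ℕ → Ω → ℝ)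
    (k : ℕ) : ℝ :=
  ∫ ω, Z k ω ^ 2 ∂P + 2 * ∑ i ∈ Finset.range k, ∫ ω, Z i ω * Z k ω ∂P

/-- `∑_{m ≤ k} m a(m)`. -/
def weightedSum (a : ℕ → ℝ) (k : ℕ) : ℝ := ∑ m ∈ Finset.range (k + 1), (m : ℝ) * a m

lemma sum_reflect_mul (a : ℕ → ℝ) (k : ℕ) :
    ∑ i ∈ Finset.range k, ((k - i : ℕ) : ℝ) * a (k - i) = weightedSum a k := by
  rw [weightedSum, Finset.sum_range_succ', ← Finset.sum_range_reflect]
  simp only [CharP.cast_eq_zero, zero_mul, add_zero]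
  refine Finset.sum_congr rfl fun i hi => ?_
  have : k - (k - 1 - i) = i + 1 := by have := Finset.mem_range.1 hi; omega
  rw [this]

lemma sum_reflect_le {a : ℕ → ℝ} (ha : ∀ m, 0 ≤ a m) (k : ℕ) :
    ∑ i ∈ Finset.range k, a (k - i) ≤ weightedSum a k := by
  rw [← sum_reflect_mul]
  refine Finset.sum_le_sum fun i hi => ?_
  have h1 : (1 : ℝ) ≤ ((k - i : ℕ) : ℝ) := by
    have := Finset.mem_range.1 hi
    exact_mod_cast (by omega : 1 ≤ k - i)
  nlinarith [ha (k - i)]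

/-- Exchange the sums: a gap `m = i - j` occurs only when `k - i < m`, hence for at most `m` values
of `i`. -/
lemma sum_double_le {a : ℕ → ℝ} (ha : ∀ m, 0 ≤ a m) (k : ℕ) :
    ∑ i ∈ Finset.range k, ∑ j ∈ Finset.range (i - (k - i)), a (i - j) ≤ weightedSum a k := by
  have h1 : ∀ i ∈ Finset.range k, ∑ j ∈ Finset.range (i - (k - i)), a (i - j) ≤
      ∑ m ∈ Finset.range (k + 1), if k - i < m then a m else 0 := by
    intro i hi
    have hik := Finset.mem_range.1 hi
    rw [← Finset.sum_filter]
    have h2 : ∑ j ∈ Finset.range (i - (k - i)), a (i - j)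
        = ∑ m ∈ (Finset.range (i - (k - i))).image (fun j => i - j), a m := by
      rw [Finset.sum_image]
      intro x hx y hy hxy
      simp only [Finset.coe_range, Set.mem_Iio] at hx hy
      simp only at hxy
      omega
    rw [h2]
    refine Finset.sum_le_sum_of_subset_of_nonneg ?_ fun m _ _ => ha m
    intro m hm
    simp only [Finset.mem_image, Finset.mem_range, Finset.mem_filter] at hm ⊢
    obtain ⟨j, hj, rfl⟩ := hm
    omega
  refine (Finset.sum_le_sum h1).trans ?_
  rw [Finset.sum_comm]
  refine Finset.sum_le_sum fun m _ => ?_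
  rw [← Finset.sum_filter, Finset.sum_const, nsmul_eq_mul]
  refine mul_le_mul_of_nonneg_right ?_ (ha m)
  have h3 : (Finset.range k).filter (fun i => k - i < m) ⊆ Finset.Ico (k - m) k := by
    intro i hi
    simp only [Finset.mem_filter, Finset.mem_range, Finset.mem_Ico] at hi ⊢
    omega
  have h4 := Finset.card_le_card h3
  rw [Nat.card_Ico] at h4
  exact_mod_cast h4.trans (by omega)

namespace WeaklyDependent

variable {Ω : Type*} [mΩ : MeasurableSpace Ω] {P : Measure Ω} {Z : ℕ → Ω → ℝ}
  {F G : ℕ → MeasurableSpace Ω} {B e M : ℝ} {a : ℕ → ℝ} {φ φ₁ φ₂ : ℝ → ℝ}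

lemma bddMeas (hZ : WeaklyDependent P Z F G B e a) (i : ℕ) : BddMeas (Z i) :=
  ⟨(hZ.meas_past i).mono (hZ.past_le i) le_rfl, B, hZ.bound i⟩

lemma measurable_partialSum_past (hZ : WeaklyDependent P Z F G B e a) {k j : ℕ} (h : k ≤ j + 1) :
    Measurable[F j] (partialSum Z k) := by
  refine @Finset.measurable_fun_sum ℝ ℕ Ω _ _ _ (F j) _ (Finset.range k) fun i hi => ?_
  have := Finset.mem_range.1 hi
  exact (hZ.meas_past i).mono (hZ.past_mono (by omega)) le_rfl

lemma measurable_partialSum (hZ : WeaklyDependent P Z F G B e a) (k : ℕ) :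
    Measurable (partialSum Z k) :=
  (hZ.measurable_partialSum_past (Nat.le_succ k)).mono (hZ.past_le k) le_rfl

lemma bddMeas_comp (hZ : WeaklyDependent P Z F G B e a) {ψ : ℝ → ℝ} (hψ : Measurable ψ)
    (hb : ∃ C, ∀ x, |ψ x| ≤ C) (k : ℕ) : BddMeas (fun ω => ψ (partialSum Z k ω)) := by
  obtain ⟨C, hC⟩ := hb
  exact ⟨hψ.comp (hZ.measurable_partialSum k), C, fun ω => hC _⟩

lemma nonneg_bound [IsProbabilityMeasure P] (hZ : WeaklyDependent P Z F G B e a) : 0 ≤ B := by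
  obtain ⟨ω⟩ : Nonempty Ω := nonempty_of_isProbabilityMeasure P
  exact (abs_nonneg _).trans (hZ.bound 0 ω)

lemma nonneg_first (hZ : WeaklyDependent P Z F G B e a) : 0 ≤ e :=
  (integral_nonneg fun _ => abs_nonneg _).trans (hZ.first 0)

lemma cov_le [IsProbabilityMeasure P] (hZ : WeaklyDependent P Z F G B e a) {j k : ℕ} (hjk : j < k)
    {U W : Ω → ℝ} {c d : ℝ} (hc : 0 ≤ c) (hd : 0 ≤ d) (hU : Measurable[F j] U)
    (hW : Measurable[G k] W) (hUc : ∀ ω, |U ω| ≤ c * |Z j ω|) (hWd : ∀ ω, |W ω| ≤ d * |Z k ω|) :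
    |covInt P U W| ≤ c * d * a (k - j) := by
  have key : ∀ {V : Ω → ℝ} {c : ℝ} {T : Ω → ℝ}, 0 ≤ c → (∀ ω, |V ω| ≤ c * |T ω|) →
      V = (fun ω => c * (c⁻¹ * V ω)) ∧ ∀ ω, |c⁻¹ * V ω| ≤ |T ω| := by
    intro V c T hc hV
    -- Rescaling by `c⁻¹` reduces to domination by `|T|`. For `c = 0` the function vanishes, so the
    -- convention `0⁻¹ = 0` is harmless.
    rcases hc.eq_or_lt with rfl | hc'
    · refine ⟨?_, by simp⟩
      ext ω; simpa using hV ω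
    · refine ⟨by ext ω; field_simp, fun ω => ?_⟩
      rw [abs_mul, abs_of_pos (inv_pos.2 hc'), inv_mul_le_iff₀ hc']
      exact hV ω
  obtain ⟨hU1, hU2⟩ := key hc hUc
  obtain ⟨hW1, hW2⟩ := key hd hWd
  have h := hZ.cov j k hjk _ _ (hU.const_mul c⁻¹) (hW.const_mul d⁻¹) hU2 hW2
  rw [hU1, covInt_const_mul, covInt_comm, hW1, covInt_const_mul, covInt_comm, abs_mul, abs_mul,
    abs_of_nonneg hc, abs_of_nonneg hd, mul_assoc]
  gcongr

/-- Telescope `φ₂(S_l)` from `S_0 = 0`. Its `j`-th increment is `F j`-measurable and dominated by `M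
|Z j|`, so it is admissible in the covariance bound. -/
lemma cov_comp_le [IsProbabilityMeasure P] (hZ : WeaklyDependent P Z F G B e a)
    (hφ : TaylorBound φ φ₁ φ₂ M) {k l : ℕ} (hlk : l ≤ k) {W : Ω → ℝ} {d : ℝ} (hd : 0 ≤ d)
    (hW : Measurable[G k] W) (hWd : ∀ ω, |W ω| ≤ d * |Z k ω|) :
    |covInt P (fun ω => φ₂ (partialSum Z l ω)) W| ≤
      M * d * ∑ j ∈ Finset.range l, a (k - j) := by
  have hWb : BddMeas W := by
    refine ⟨hW.mono (hZ.future_le k) le_rfl, d * B, fun ω => (hWd ω).trans ?_⟩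
    exact mul_le_mul_of_nonneg_left (hZ.bound k ω) hd
  have h2 := fun k => hZ.bddMeas_comp hφ.meas_two hφ.bdd_two k
  have hdec : (fun ω => φ₂ (partialSum Z l ω)) = fun ω => φ₂ 0 + ∑ j ∈ Finset.range l,
      (φ₂ (partialSum Z (j + 1) ω) - φ₂ (partialSum Z j ω)) := by
    ext ω
    rw [Finset.sum_range_sub (fun j => φ₂ (partialSum Z j ω))]
    simp [partialSum]
  have hb : ∀ j ∈ Finset.range l,
      BddMeas (fun ω => φ₂ (partialSum Z (j + 1) ω) - φ₂ (partialSum Z j ω)) :=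
    fun j _ => (h2 (j + 1)).sub (h2 j)
  rw [hdec, covInt_add (BddMeas.const _) (BddMeas.sum _ hb) hWb, covInt_const, zero_add,
    covInt_sum _ hb hWb, Finset.mul_sum]
  refine (Finset.abs_sum_le_sum_abs _ _).trans (Finset.sum_le_sum fun j hj => ?_)
  have hjl := Finset.mem_range.1 hj
  refine hZ.cov_le (by omega) hφ.nonneg hd ?_ hW ?_ hWd
  · exact (hφ.meas_two.comp (hZ.measurable_partialSum_past le_rfl)).sub
      (hφ.meas_two.comp (hZ.measurable_partialSum_past (Nat.le_succ j)))
  · intro ω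
    rw [partialSum_succ]
    exact hφ.first _ _

/-- The Taylor remainder of `φ₁` is dominated by `M Z_i² ≤ M B |Z i|`. It is therefore an admissible
past function, and its covariance with `Z k` carries the decay `a (k - i)`. -/
lemma linear_term [IsProbabilityMeasure P] (hZ : WeaklyDependent P Z F G B e a)
    (hφ : TaylorBound φ φ₁ φ₂ M) {i k : ℕ} (hik : i < k) :
    |∫ ω, (φ₁ (partialSum Z (i + 1) ω) - φ₁ (partialSum Z i ω)) * Z k ω ∂P
      - ∫ ω, φ₂ (partialSum Z i ω) * (Z i ω * Z k ω) ∂P| ≤ M * B * a (k - i) := by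
  have h1 := fun k => hZ.bddMeas_comp hφ.meas_one hφ.bdd_one k
  have h2 := fun k => hZ.bddMeas_comp hφ.meas_two hφ.bdd_two k
  set U : Ω → ℝ := fun ω => φ₁ (partialSum Z (i + 1) ω) - φ₁ (partialSum Z i ω)
    - φ₂ (partialSum Z i ω) * Z i ω with hUdef
  have hcov : |covInt P U (Z k)| ≤ M * B * 1 * a (k - i) := by
    refine hZ.cov_le hik (mul_nonneg hφ.nonneg hZ.nonneg_bound) zero_le_one ?_
      (hZ.meas_future k) ?_ (by simp)
    · have hs := hZ.measurable_partialSum_past (Nat.le_succ i)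
      exact ((hφ.meas_one.comp (hZ.measurable_partialSum_past le_rfl)).sub
        (hφ.meas_one.comp hs)).sub ((hφ.meas_two.comp hs).mul (hZ.meas_past i))
    · intro ω
      have := hφ.second (partialSum Z i ω) (Z i ω)
      simp only [hUdef, partialSum_succ]
      refine this.trans ?_
      rw [← sq_abs, sq, mul_assoc]
      exact mul_le_mul_of_nonneg_left
        (mul_le_mul_of_nonneg_right (hZ.bound i ω) (abs_nonneg _)) hφ.nonneg
  rw [mul_one] at hcov
  convert hcov using 2
  rw [covInt, hZ.mean k, mul_zero, sub_zero, ← integral_sub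
    (((h1 _).sub (h1 _)).mul (hZ.bddMeas k)).integrable
    ((h2 _).mul ((hZ.bddMeas i).mul (hZ.bddMeas k))).integrable]
  congr 1 with ω
  simp only [hUdef]; ring

/-- Before `φ₂` can be decoupled from `Z_i Z_k`, its argument must lie at a distance from `i`.
Stepping back by the gap `k - i` changes at most `k - i` increments, each costing `M B a(k-i)`. This
is the source of the weight in `weightedSum`. -/
lemma shift_term [IsProbabilityMeasure P] (hZ : WeaklyDependent P Z F G B e a)
    (hφ : TaylorBound φ φ₁ φ₂ M) {i k : ℕ} (hik : i < k) :
    |∫ ω, φ₂ (partialSum Z i ω) * (Z i ω * Z k ω) ∂P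
      - ∫ ω, φ₂ (partialSum Z (i - (k - i)) ω) * (Z i ω * Z k ω) ∂P| ≤
      M * B * (((k - i : ℕ) : ℝ) * a (k - i)) := by
  have h2 := fun k => hZ.bddMeas_comp hφ.meas_two hφ.bdd_two k
  -- The subtraction is truncated: if `i < k - i`, then `l = 0` and the whole past of `i` is
  -- removed.
  set l := i - (k - i) with hl
  have hb : ∀ j ∈ Finset.Ico l i, BddMeas (fun ω =>
      (φ₂ (partialSum Z (j + 1) ω) - φ₂ (partialSum Z j ω)) * Z i ω) :=
    fun j _ => ((h2 (j + 1)).sub (h2 j)).mul (hZ.bddMeas i)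
  have heq : ∫ ω, φ₂ (partialSum Z i ω) * (Z i ω * Z k ω) ∂P
      - ∫ ω, φ₂ (partialSum Z l ω) * (Z i ω * Z k ω) ∂P
      = ∑ j ∈ Finset.Ico l i, covInt P (fun ω =>
        (φ₂ (partialSum Z (j + 1) ω) - φ₂ (partialSum Z j ω)) * Z i ω) (Z k) := by
    rw [← covInt_sum _ hb (hZ.bddMeas k), covInt, hZ.mean k, mul_zero, sub_zero, ← integral_sub
      ((h2 _).mul ((hZ.bddMeas i).mul (hZ.bddMeas k))).integrable
      ((h2 _).mul ((hZ.bddMeas i).mul (hZ.bddMeas k))).integrable]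
    congr 1 with ω
    rw [← Finset.sum_mul, Finset.sum_Ico_sub (fun j => φ₂ (partialSum Z j ω)) (by omega)]
    ring
  have hMB := mul_nonneg hφ.nonneg hZ.nonneg_bound
  rw [heq]
  refine (Finset.abs_sum_le_sum_abs _ _).trans
    ((Finset.sum_le_card_nsmul _ _ (M * B * a (k - i)) fun j hj => ?_).trans ?_)
  · have hj' := Finset.mem_Ico.1 hj
    have := hZ.cov_le (U := fun ω =>
        (φ₂ (partialSum Z (j + 1) ω) - φ₂ (partialSum Z j ω)) * Z i ω) hik hMB zero_le_one ?_
      (hZ.meas_future k) ?_ (by simp)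
    · simpa using this
    · exact ((hφ.meas_two.comp (hZ.measurable_partialSum_past (by omega))).sub
        (hφ.meas_two.comp (hZ.measurable_partialSum_past (by omega)))).mul (hZ.meas_past i)
    · intro ω
      rw [abs_mul, partialSum_succ]
      refine mul_le_mul_of_nonneg_right ((hφ.first _ _).trans ?_) (abs_nonneg _)
      exact mul_le_mul_of_nonneg_left (hZ.bound j ω) hφ.nonneg
  · rw [Nat.card_Ico, nsmul_eq_mul]
    have : ((i - l : ℕ) : ℝ) ≤ ((k - i : ℕ) : ℝ) := by exact_mod_cast (by omega)
    nlinarith [mul_le_mul_of_nonneg_right this (mul_nonneg hMB (hZ.nonneg (k - i)))]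

lemma comp_diff [IsProbabilityMeasure P] (hZ : WeaklyDependent P Z F G B e a)
    (hφ : TaylorBound φ φ₁ φ₂ M) {l k : ℕ} (hlk : l ≤ k) :
    |∫ ω, φ₂ (partialSum Z l ω) ∂P - ∫ ω, φ₂ (partialSum Z k ω) ∂P| ≤
      M * (((k - l : ℕ) : ℝ) * e) := by
  have h2 := fun k => hZ.bddMeas_comp hφ.meas_two hφ.bdd_two k
  induction k, hlk using Nat.le_induction with
  | base => simp
  | succ k hk ih =>
    have h3 : |∫ ω, φ₂ (partialSum Z k ω) ∂P - ∫ ω, φ₂ (partialSum Z (k + 1) ω) ∂P| ≤ M * e := by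
      rw [← integral_sub (h2 _).integrable (h2 _).integrable]
      refine abs_integral_le_integral_abs.trans
        (le_trans ?_ (mul_le_mul_of_nonneg_left (hZ.first k) hφ.nonneg))
      rw [← integral_const_mul]
      refine integral_mono ((h2 _).sub (h2 _)).abs.integrable
        ((hZ.bddMeas k).abs.integrable.const_mul M) fun ω => ?_
      simp only [partialSum_succ]
      rw [abs_sub_comm]
      exact hφ.first _ _
    have h4 : ((k + 1 - l : ℕ) : ℝ) = ((k - l : ℕ) : ℝ) + 1 := by
      rw [← Nat.cast_succ]; congr 1; omega
    rw [h4]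
    have := abs_sub_le (∫ ω, φ₂ (partialSum Z l ω) ∂P) (∫ ω, φ₂ (partialSum Z k ω) ∂P)
      (∫ ω, φ₂ (partialSum Z (k + 1) ω) ∂P)
    linarith

lemma abs_covariance_le [IsProbabilityMeasure P] (hZ : WeaklyDependent P Z F G B e a)
    {i k : ℕ} (hik : i < k) : |∫ ω, Z i ω * Z k ω ∂P| ≤ a (k - i) := by
  have := hZ.cov i k hik (Z i) (Z k) (hZ.meas_past i) (hZ.meas_future k) (by simp) (by simp)
  simpa [covInt, hZ.mean] using this

/-- Telescoping `φ₁(S_k)` leaves terms indexed by `i < k`. Four replacements treat each of them: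
linearise (`linear_term`), step back by the gap (`shift_term`), decouple `φ₂(S_l)` from `Z_i Z_k`
(`cov_comp_le`), and restore the argument `S_k` (`comp_diff`). -/
lemma first_order [IsProbabilityMeasure P] (hZ : WeaklyDependent P Z F G B e a)
    (hφ : TaylorBound φ φ₁ φ₂ M) (k : ℕ) :
    |∫ ω, φ₁ (partialSum Z k ω) * Z k ω ∂P
      - (∑ i ∈ Finset.range k, ∫ ω, Z i ω * Z k ω ∂P) * ∫ ω, φ₂ (partialSum Z k ω) ∂P| ≤
      M * ((3 * B + 2 * e) * weightedSum a k) := by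
  have h1 := fun k => hZ.bddMeas_comp hφ.meas_one hφ.bdd_one k
  have hMB := mul_nonneg hφ.nonneg hZ.nonneg_bound
  have hMe := mul_nonneg hφ.nonneg hZ.nonneg_first
  have hdec : ∫ ω, φ₁ (partialSum Z k ω) * Z k ω ∂P = ∑ i ∈ Finset.range k,
      ∫ ω, (φ₁ (partialSum Z (i + 1) ω) - φ₁ (partialSum Z i ω)) * Z k ω ∂P := by
    rw [← integral_finsetSum _ fun i _ =>
      (((h1 (i + 1)).sub (h1 i)).mul (hZ.bddMeas k)).integrable]
    have : ∫ ω, φ₁ (partialSum Z k ω) * Z k ω ∂P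
        = ∫ ω, (φ₁ (partialSum Z k ω) * Z k ω - φ₁ 0 * Z k ω) ∂P := by
      rw [integral_sub ((h1 k).mul (hZ.bddMeas k)).integrable
        ((BddMeas.const _).mul (hZ.bddMeas k)).integrable, integral_const_mul, hZ.mean k]
      simp
    rw [this]
    congr 1 with ω
    rw [← Finset.sum_mul, Finset.sum_range_sub (fun j => φ₁ (partialSum Z j ω))]
    simp [partialSum, sub_mul]
  rw [hdec, Finset.sum_mul, ← Finset.sum_sub_distrib]
  have hterm : ∀ i ∈ Finset.range k,
      |∫ ω, (φ₁ (partialSum Z (i + 1) ω) - φ₁ (partialSum Z i ω)) * Z k ω ∂P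
        - (∫ ω, Z i ω * Z k ω ∂P) * ∫ ω, φ₂ (partialSum Z k ω) ∂P| ≤
      M * B * a (k - i) + (M * B + 2 * (M * e)) * (((k - i : ℕ) : ℝ) * a (k - i))
        + M * B * ∑ j ∈ Finset.range (i - (k - i)), a (i - j) := by
    intro i hi
    have hik := Finset.mem_range.1 hi
    have t1 := hZ.linear_term hφ hik
    have t2 := hZ.shift_term hφ hik
    set l := i - (k - i) with hl
    -- The product `Z_i Z_k` is a function of the future from `i` on, dominated by `B |Z i|`. The
    -- surviving gaps `i - j` all exceed `k - i`, which `sum_double_le` exploits.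
    have t3 := hZ.cov_comp_le hφ (k := i) (l := l) (by omega) (W := fun ω => Z i ω * Z k ω)
      hZ.nonneg_bound ((hZ.meas_future i).mul
        ((hZ.meas_future k).mono (hZ.future_anti hik.le) le_rfl)) (fun ω => by
          rw [abs_mul, mul_comm]
          exact mul_le_mul_of_nonneg_right (hZ.bound k ω) (abs_nonneg _))
    have t4 := hZ.comp_diff hφ (l := l) (k := k) (by omega)
    have t5 := hZ.abs_covariance_le hik
    rw [covInt] at t3
    have t6 : |(∫ ω, φ₂ (partialSum Z l ω) ∂P - ∫ ω, φ₂ (partialSum Z k ω) ∂P) *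
        ∫ ω, Z i ω * Z k ω ∂P| ≤ 2 * (M * e) * (((k - i : ℕ) : ℝ) * a (k - i)) := by
      rw [abs_mul]
      have hkl : ((k - l : ℕ) : ℝ) ≤ 2 * ((k - i : ℕ) : ℝ) := by
        exact_mod_cast (by omega : k - l ≤ 2 * (k - i))
      calc _ ≤ M * (((k - l : ℕ) : ℝ) * e) * a (k - i) :=
            mul_le_mul t4 t5 (abs_nonneg _) ((abs_nonneg _).trans t4)
        _ = (M * e * a (k - i)) * ((k - l : ℕ) : ℝ) := by ring
        _ ≤ (M * e * a (k - i)) * (2 * ((k - i : ℕ) : ℝ)) :=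
            mul_le_mul_of_nonneg_left hkl (mul_nonneg hMe (hZ.nonneg _))
        _ = _ := by ring
    rw [abs_le] at *
    constructor <;> nlinarith
  refine (Finset.abs_sum_le_sum_abs _ _).trans ((Finset.sum_le_sum hterm).trans ?_)
  rw [Finset.sum_add_distrib, Finset.sum_add_distrib, ← Finset.mul_sum, ← Finset.mul_sum,
    ← Finset.mul_sum, sum_reflect_mul]
  have s1 := mul_le_mul_of_nonneg_left (sum_reflect_le hZ.nonneg k) hMB
  have s2 := mul_le_mul_of_nonneg_left (sum_double_le hZ.nonneg k) hMB
  linarith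

/-- The Lindeberg step: `E φ(S_{k+1}) - E φ(S_k) ≈ (σ_k² / 2) E φ''(S_k)`. -/
theorem lindeberg_step [IsProbabilityMeasure P] (hZ : WeaklyDependent P Z F G B e a)
    (hφ : TaylorBound φ φ₁ φ₂ M) (k : ℕ) :
    |∫ ω, φ (partialSum Z (k + 1) ω) ∂P - ∫ ω, φ (partialSum Z k ω) ∂P
      - varIncr P Z k / 2 * ∫ ω, φ₂ (partialSum Z k ω) ∂P| ≤
      M * (B ^ 2 * e + (4 * B + 2 * e) * weightedSum a k) := by
  have h0 := fun k => hZ.bddMeas_comp hφ.meas hφ.bdd k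
  have h1 := fun k => hZ.bddMeas_comp hφ.meas_one hφ.bdd_one k
  have h2 := fun k => hZ.bddMeas_comp hφ.meas_two hφ.bdd_two k
  have hB := hZ.nonneg_bound
  have hMB := mul_nonneg hφ.nonneg hB
  have hsq : BddMeas (fun ω => Z k ω ^ 2) := by
    simpa only [sq] using (hZ.bddMeas k).mul (hZ.bddMeas k)
  have t1 := hZ.first_order hφ k
  -- This decouples the quadratic term: `Z_k²` is dominated by `B |Z k|`. It accounts for the fourth
  -- `B` in the final constant, the other three coming from `first_order`.
  have t2 := hZ.cov_comp_le hφ (k := k) (l := k) le_rfl (W := fun ω => Z k ω ^ 2) hB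
    ((hZ.meas_future k).pow_const 2) (fun ω => by
      rw [← sq_abs, sq, abs_mul, abs_abs]
      exact mul_le_mul_of_nonneg_right (hZ.bound k ω) (abs_nonneg _))
  have t3 := mul_le_mul_of_nonneg_left (sum_reflect_le hZ.nonneg k) hMB
  rw [covInt] at t2
  have t4 : |∫ ω, (φ (partialSum Z (k + 1) ω) - φ (partialSum Z k ω)
      - φ₁ (partialSum Z k ω) * Z k ω - φ₂ (partialSum Z k ω) * Z k ω ^ 2 * (1 / 2)) ∂P| ≤
      M * (B ^ 2 * e) := by
    refine abs_integral_le_integral_abs.trans (le_trans ?_ (mul_le_mul_of_nonneg_left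
      (mul_le_mul_of_nonneg_left (hZ.first k) (sq_nonneg B)) hφ.nonneg))
    rw [← integral_const_mul, ← integral_const_mul]
    refine integral_mono (((((h0 _).sub (h0 _)).sub ((h1 _).mul (hZ.bddMeas k))).sub
      (((h2 _).mul hsq).mul (BddMeas.const _))).abs.integrable)
      (((hZ.bddMeas k).abs.integrable.const_mul _).const_mul M) fun ω => ?_
    have := hφ.third (partialSum Z k ω) (Z k ω)
    simp only [partialSum_succ]
    rw [mul_one_div]
    refine this.trans (mul_le_mul_of_nonneg_left ?_ hφ.nonneg)
    have h5 : |Z k ω| ^ 2 ≤ B ^ 2 := pow_le_pow_left₀ (abs_nonneg _) (hZ.bound k ω) 2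
    calc |Z k ω| ^ 3 = |Z k ω| ^ 2 * |Z k ω| := by ring
      _ ≤ _ := mul_le_mul_of_nonneg_right h5 (abs_nonneg _)
  rw [integral_sub ((((h0 _).sub (h0 _)).sub ((h1 _).mul (hZ.bddMeas k))).integrable)
      (((h2 _).mul hsq).mul (BddMeas.const _)).integrable,
    integral_sub (((h0 _).sub (h0 _)).integrable) ((h1 _).mul (hZ.bddMeas k)).integrable,
    integral_sub (h0 _).integrable (h0 _).integrable, integral_mul_const] at t4
  rw [varIncr]
  have hw : 0 ≤ weightedSum a k :=
    Finset.sum_nonneg fun m _ => mul_nonneg (Nat.cast_nonneg m) (hZ.nonneg m)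
  have hw2 := mul_nonneg hMB hw
  rw [abs_le] at *
  constructor <;> nlinarith

end WeaklyDependent

end OneStep

/-! ### Gaussian test functions and the heat equation -/

section Gaussian

/-- The standard normal density. -/
noncomputable def stdNormalPDF (z : ℝ) : ℝ := (√(2 * Real.pi))⁻¹ * Real.exp (-(z ^ 2 / 2))

lemma gaussianPDFReal_eq_stdNormalPDF : gaussianPDFReal 0 1 = stdNormalPDF := by
  ext z
  simp [gaussianPDFReal, stdNormalPDF, neg_div]

lemma inv_sqrt_two_pi_le : (√(2 * Real.pi))⁻¹ ≤ 1 / 2 := by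
  rw [one_div]
  refine inv_anti₀ two_pos ?_
  rw [Real.le_sqrt' two_pos]
  nlinarith [Real.pi_gt_three]

lemma stdNormalPDF_pos (z : ℝ) : 0 < stdNormalPDF z := by
  unfold stdNormalPDF; positivity

/-- From `exp(x) ≥ 1 + x + x²/2` at `x = z²/2`. It reduces bounds for polynomials of degree at most
four times the density to polynomial inequalities. -/
lemma stdNormalPDF_mul_le (z : ℝ) : stdNormalPDF z * (1 + z ^ 2 / 2 + z ^ 4 / 8) ≤ 1 / 2 := by
  have h1 := Real.quadratic_le_exp_of_nonneg (x := z ^ 2 / 2) (by positivity)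
  have h2 : Real.exp (-(z ^ 2 / 2)) * Real.exp (z ^ 2 / 2) = 1 := by
    rw [← Real.exp_add]; simp
  have h3 : Real.exp (-(z ^ 2 / 2)) * (1 + z ^ 2 / 2 + z ^ 4 / 8) ≤ 1 := by
    refine (mul_le_mul_of_nonneg_left (le_trans (le_of_eq ?_) h1) (Real.exp_pos _).le).trans h2.le
    ring
  have h4 : 0 ≤ (√(2 * Real.pi))⁻¹ := by positivity
  rw [stdNormalPDF, mul_assoc]
  calc _ ≤ (√(2 * Real.pi))⁻¹ * 1 := mul_le_mul_of_nonneg_left h3 h4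
    _ ≤ 1 / 2 := by rw [mul_one]; exact inv_sqrt_two_pi_le

lemma mul_stdNormalPDF_le {z q C : ℝ} (hq : q ≤ 2 * C * (1 + z ^ 2 / 2 + z ^ 4 / 8)) (hC : 0 ≤ C) :
    q * stdNormalPDF z ≤ C := by
  have h1 := mul_le_mul_of_nonneg_right hq (stdNormalPDF_pos z).le
  have h2 := mul_le_mul_of_nonneg_left (stdNormalPDF_mul_le z) hC
  linarith

lemma stdNormalPDF_le (z : ℝ) : stdNormalPDF z ≤ 1 := by
  have := mul_stdNormalPDF_le (z := z) (q := 1) (C := 1) (by nlinarith [sq_nonneg (z ^ 2)])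
    zero_le_one
  linarith

lemma abs_mul_stdNormalPDF_le (z : ℝ) : |z * stdNormalPDF z| ≤ 1 := by
  rw [abs_mul, abs_of_pos (stdNormalPDF_pos z)]
  refine mul_stdNormalPDF_le ?_ zero_le_one
  nlinarith [sq_nonneg (z ^ 2), sq_abs z, sq_nonneg (|z| - 1)]

lemma abs_one_sub_sq_mul_stdNormalPDF_le (z : ℝ) : |(1 - z ^ 2) * stdNormalPDF z| ≤ 1 := by
  rw [abs_mul, abs_of_pos (stdNormalPDF_pos z)]
  refine mul_stdNormalPDF_le ?_ zero_le_one
  rw [abs_le]; constructor <;> nlinarith [sq_nonneg (z ^ 2), sq_nonneg z]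

/-- This cubic is the one in the second derivative of `w ↦ Φ(c/√w)`. -/
lemma abs_cubic_mul_stdNormalPDF_le (z : ℝ) :
    |(3 / 4 * z - 1 / 4 * z ^ 3) * stdNormalPDF z| ≤ 2 := by
  rw [abs_mul, abs_of_pos (stdNormalPDF_pos z)]
  refine mul_stdNormalPDF_le ?_ zero_le_two
  have h1 : |3 / 4 * z - 1 / 4 * z ^ 3| ≤ 3 / 4 * |z| + 1 / 4 * |z| ^ 3 := by
    refine (abs_sub _ _).trans (le_of_eq ?_)
    rw [abs_mul, abs_mul, abs_pow]; norm_num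
  have h2 : |z| ^ 4 = z ^ 4 := by rw [← abs_pow]; exact abs_of_nonneg (by positivity)
  have h3 := abs_nonneg z
  nlinarith [sq_nonneg (|z| ^ 2 - |z|), sq_abs z, sq_nonneg (|z| - 1)]

lemma hasDerivAt_stdNormalPDF (z : ℝ) : HasDerivAt stdNormalPDF (-(z * stdNormalPDF z)) z := by
  have h : HasDerivAt (fun z : ℝ => -(z ^ 2 / 2)) (-z) z :=
    ((hasDerivAt_pow 2 z).div_const 2).neg.congr_deriv (by simp)
  refine ((h.exp).const_mul (√(2 * Real.pi))⁻¹).congr_deriv ?_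
  rw [stdNormalPDF]; ring

lemma continuous_stdNormalPDF : Continuous stdNormalPDF :=
  continuous_iff_continuousAt.2 fun z => (hasDerivAt_stdNormalPDF z).continuousAt

lemma stdNormalCDF_eq_real (x : ℝ) : stdNormalCDF x = (gaussianReal 0 1).real (Set.Iic x) := by
  rw [stdNormalCDF, cdf_eq_real]

lemma stdNormalCDF_nonneg (x : ℝ) : 0 ≤ stdNormalCDF x := cdf_nonneg _ _

lemma stdNormalCDF_le_one (x : ℝ) : stdNormalCDF x ≤ 1 := cdf_le_one _ _

lemma integrable_stdNormalPDF : Integrable stdNormalPDF := by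
  rw [← gaussianPDFReal_eq_stdNormalPDF]; exact integrable_gaussianPDFReal 0 1

lemma stdNormalCDF_eq_integral (x : ℝ) : stdNormalCDF x = ∫ z in Set.Iic x, stdNormalPDF z := by
  rw [stdNormalCDF_eq_real, measureReal_def, gaussianReal_apply_eq_integral 0 one_ne_zero,
    gaussianPDFReal_eq_stdNormalPDF, ENNReal.toReal_ofReal]
  exact integral_nonneg fun z => (stdNormalPDF_pos z).le

lemma hasDerivAt_stdNormalCDF (x : ℝ) : HasDerivAt stdNormalCDF (stdNormalPDF x) x := by
  have h1 : stdNormalCDF = fun y => stdNormalCDF 0 + ∫ z in (0 : ℝ)..y, stdNormalPDF z := by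
    ext y
    rw [stdNormalCDF_eq_integral, stdNormalCDF_eq_integral,
      ← intervalIntegral.integral_Iic_sub_Iic integrable_stdNormalPDF.integrableOn
        integrable_stdNormalPDF.integrableOn]
    ring
  rw [h1]
  exact (intervalIntegral.integral_hasDerivAt_right
    (continuous_stdNormalPDF.intervalIntegrable _ _)
    (continuous_stdNormalPDF.stronglyMeasurableAtFilter _ _)
    continuous_stdNormalPDF.continuousAt).const_add _

/-- The mean value inequality on a segment. -/
lemma abs_sub_le_of_hasDerivAt {ψ ψ' : ℝ → ℝ} {x y C : ℝ}
    (h : ∀ t ∈ Set.uIcc x y, HasDerivAt ψ (ψ' t) t) (hC : ∀ t ∈ Set.uIcc x y, |ψ' t| ≤ C) :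
    |ψ y - ψ x| ≤ C * |y - x| :=
  (convex_uIcc x y).norm_image_sub_le_of_norm_hasDerivWithin_le
    (fun t ht => (h t ht).hasDerivWithinAt) hC Set.left_mem_uIcc Set.right_mem_uIcc

lemma abs_stdNormalCDF_sub_le (x y : ℝ) : |stdNormalCDF y - stdNormalCDF x| ≤ |y - x| := by
  simpa using abs_sub_le_of_hasDerivAt (C := 1) (fun t _ => hasDerivAt_stdNormalCDF t)
    fun t _ => by rw [abs_of_pos (stdNormalPDF_pos t)]; exact stdNormalPDF_le t

lemma abs_le_of_mem_uIcc_zero {t z : ℝ} (h : t ∈ Set.uIcc 0 z) : |t| ≤ |z| := by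
  have := Set.abs_sub_left_of_mem_uIcc h
  simpa using this

/-- Three successive uses of the mean value inequality, starting from the bound on `φ₃`. The
factorial denominators are dropped. -/
lemma TaylorBound.of_hasDerivAt {φ φ₁ φ₂ φ₃ : ℝ → ℝ} {M : ℝ}
    (h0 : ∀ x, HasDerivAt φ (φ₁ x) x) (h1 : ∀ x, HasDerivAt φ₁ (φ₂ x) x)
    (h2 : ∀ x, HasDerivAt φ₂ (φ₃ x) x) (h3 : ∀ x, |φ₃ x| ≤ M)
    (b0 : ∃ C, ∀ x, |φ x| ≤ C) (b1 : ∃ C, ∀ x, |φ₁ x| ≤ C) (b2 : ∃ C, ∀ x, |φ₂ x| ≤ C) :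
    TaylorBound φ φ₁ φ₂ M := by
  have hM : 0 ≤ M := (abs_nonneg _).trans (h3 0)
  have d1 : ∀ x z, |φ₂ (x + z) - φ₂ x| ≤ M * |z| := fun x z => by
    simpa using abs_sub_le_of_hasDerivAt (x := x) (y := x + z) (fun t _ => h2 t) fun t _ => h3 t
  have d2 : ∀ x z, |φ₁ (x + z) - φ₁ x - φ₂ x * z| ≤ M * z ^ 2 := fun x z => by
    have := abs_sub_le_of_hasDerivAt (ψ := fun z => φ₁ (x + z) - φ₁ x - φ₂ x * z)
      (ψ' := fun z => φ₂ (x + z) - φ₂ x) (x := 0) (y := z) (C := M * |z|)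
      (fun t _ => by
        exact ((((h1 (x + t)).comp_const_add x t).sub_const (φ₁ x)).sub
          ((hasDerivAt_id t).const_mul (φ₂ x))).congr_deriv (by simp))
      (fun t ht => (d1 x t).trans (mul_le_mul_of_nonneg_left (abs_le_of_mem_uIcc_zero ht) hM))
    simp only [add_zero, sub_self, mul_zero, sub_zero, mul_assoc, abs_mul_abs_self] at this
    rwa [sq]
  refine ⟨(continuous_iff_continuousAt.2 fun z => (h0 z).continuousAt).measurable,
    (continuous_iff_continuousAt.2 fun z => (h1 z).continuousAt).measurable,
    (continuous_iff_continuousAt.2 fun z => (h2 z).continuousAt).measurable,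
    b0, b1, b2, hM, fun x z => ?_, d2, d1⟩
  have := abs_sub_le_of_hasDerivAt (ψ := fun z => φ (x + z) - φ x - φ₁ x * z - φ₂ x * z ^ 2 / 2)
      (ψ' := fun z => φ₁ (x + z) - φ₁ x - φ₂ x * z) (x := 0) (y := z) (C := M * |z| ^ 2)
      (fun t _ => by
        refine (((((h0 (x + t)).comp_const_add x t).sub_const (φ x)).sub
          ((hasDerivAt_id t).const_mul (φ₁ x))).sub
          (((hasDerivAt_pow 2 t).const_mul (φ₂ x)).div_const 2)).congr_deriv ?_
        simp only [mul_one, Nat.cast_ofNat, Nat.add_one_sub_one, pow_one]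
        ring)
      (fun t ht => (d2 x t).trans (mul_le_mul_of_nonneg_left (by
        rw [← sq_abs]
        exact pow_le_pow_left₀ (abs_nonneg _) (abs_le_of_mem_uIcc_zero ht) 2) hM))
  simp only [add_zero, sub_self, mul_zero, sub_zero, ne_eq, OfNat.ofNat_ne_zero,
    not_false_eq_true, zero_pow, zero_div] at this
  calc _ ≤ M * |z| ^ 2 * |z| := this
    _ = _ := by ring

/-- The constant scales as `s⁻³`. With `s²` the smoothing plus remaining variance, this decay makes
the Lindeberg errors summable. -/
lemma taylorBound_stdNormalCDF (y : ℝ) {s : ℝ} (hs : 0 < s) :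
    TaylorBound (fun x => stdNormalCDF ((y - x) / s)) (fun x => -s⁻¹ * stdNormalPDF ((y - x) / s))
      (fun x => -(s⁻¹ ^ 2 * ((y - x) / s * stdNormalPDF ((y - x) / s)))) (s⁻¹ ^ 3) := by
  have hs' : 0 ≤ s⁻¹ := (inv_pos.2 hs).le
  have hl : ∀ x, HasDerivAt (fun x => (y - x) / s) (-s⁻¹) x := fun x => by
    have := ((hasDerivAt_id x).const_sub y).div_const s
    simpa [neg_div] using this
  refine TaylorBound.of_hasDerivAt
    (φ₃ := fun x => s⁻¹ ^ 3 * ((1 - ((y - x) / s) ^ 2) * stdNormalPDF ((y - x) / s)))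
    (fun x => ?_) (fun x => ?_) (fun x => ?_) (fun x => ?_) ⟨1, fun x => ?_⟩ ⟨s⁻¹, fun x => ?_⟩
    ⟨s⁻¹ ^ 2, fun x => ?_⟩
  · refine ((hasDerivAt_stdNormalCDF _).comp x (hl x)).congr_deriv ?_
    ring
  · refine (((hasDerivAt_stdNormalPDF _).comp x (hl x)).const_mul (-s⁻¹)).congr_deriv ?_
    ring
  · refine (((hl x).mul ((hasDerivAt_stdNormalPDF _).comp x
      (hl x))).const_mul (s⁻¹ ^ 2)).neg.congr_deriv ?_
    simp only [Function.comp]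
    ring
  · rw [abs_mul, abs_of_nonneg (by positivity)]
    exact mul_le_of_le_one_right (by positivity) (abs_one_sub_sq_mul_stdNormalPDF_le _)
  · rw [abs_of_nonneg (stdNormalCDF_nonneg _)]; exact stdNormalCDF_le_one _
  · rw [abs_mul, abs_neg, abs_of_nonneg hs', abs_of_pos (stdNormalPDF_pos _)]
    exact mul_le_of_le_one_right hs' (stdNormalPDF_le _)
  · rw [abs_neg, abs_mul, abs_of_nonneg (by positivity)]
    exact mul_le_of_le_one_right (by positivity) (abs_mul_stdNormalPDF_le _)

lemma hasDerivAt_div_sqrt (c : ℝ) {w : ℝ} (hw : 0 < w) :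
    HasDerivAt (fun w => c / √w) (-(c / √w / (2 * w))) w := by
  have h := ((Real.hasDerivAt_sqrt hw.ne').inv (Real.sqrt_pos.2 hw).ne').const_mul c
  have h2 := Real.sq_sqrt hw.le
  have h3 := (Real.sqrt_pos.2 hw).ne'
  refine (h.congr_deriv (f := fun w => c / √w) ?_)
  field_simp
  rw [h2]

lemma hasDerivAt_stdNormalCDF_div_sqrt (c : ℝ) {w : ℝ} (hw : 0 < w) :
    HasDerivAt (fun w => stdNormalCDF (c / √w)) (-(1 / 2) * w⁻¹ *
      (c / √w * stdNormalPDF (c / √w))) w := by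
  refine ((hasDerivAt_stdNormalCDF _).comp w (hasDerivAt_div_sqrt c hw)).congr_deriv ?_
  field_simp

/-- Changing the variance of a normal law. -/
lemma abs_stdNormalCDF_div_sqrt_sub_le (c : ℝ) {v t : ℝ} (hv : 0 < v) (ht : 0 ≤ t) :
    |stdNormalCDF (c / √(v + t)) - stdNormalCDF (c / √v)| ≤ t / v := by
  have hpos : ∀ w ∈ Set.uIcc v (v + t), v ≤ w := fun w hw => by
    rw [Set.uIcc_of_le (by linarith)] at hw; exact hw.1
  have := abs_sub_le_of_hasDerivAt (x := v) (y := v + t) (C := v⁻¹)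
    (fun w hw => hasDerivAt_stdNormalCDF_div_sqrt c (hv.trans_le (hpos w hw))) (fun w hw => by
      have hw0 := hv.trans_le (hpos w hw)
      rw [abs_mul]
      refine (mul_le_of_le_one_right (abs_nonneg _) (abs_mul_stdNormalPDF_le _)).trans ?_
      rw [abs_mul, abs_of_pos (inv_pos.2 hw0), abs_neg, abs_of_pos (by norm_num)]
      have := inv_anti₀ hv (hpos w hw)
      have := (inv_pos.2 hw0)
      linarith)
  rwa [add_sub_cancel_left, abs_of_nonneg ht, mul_comm, ← div_eq_mul_inv] at this

/-- The heat equation for `Φ(c / √v)` to second order in the variance. -/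
lemma heat_step (c : ℝ) {v t : ℝ} (hv : 0 < v) (ht : 0 ≤ t) :
    |stdNormalCDF (c / √(v + t)) - stdNormalCDF (c / √v)
      - t / 2 * -((√v)⁻¹ ^ 2 * (c / √v * stdNormalPDF (c / √v)))| ≤ 2 * t ^ 2 / v ^ 2 := by
  set H : ℝ → ℝ := fun w => -(1 / 2) * w⁻¹ * (c / √w * stdNormalPDF (c / √w)) with hH
  have hpos : ∀ r ∈ Set.Icc (0 : ℝ) t, ∀ w ∈ Set.uIcc v (v + r), v ≤ w := fun r hr w hw => by
    rw [Set.uIcc_of_le (by linarith [hr.1])] at hw; exact hw.1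
  have hHd : ∀ w, 0 < w → HasDerivAt H
      (w⁻¹ ^ 2 * ((3 / 4 * (c / √w) - 1 / 4 * (c / √w) ^ 3) * stdNormalPDF (c / √w))) w := by
    intro w hw
    have hd := hasDerivAt_div_sqrt c hw
    refine (((hasDerivAt_inv hw.ne').const_mul (-(1 / 2))).mul
      (hd.mul ((hasDerivAt_stdNormalPDF _).comp w hd))).congr_deriv ?_
    simp only [Pi.mul_apply, Function.comp]
    generalize c / √w = q
    field_simp
    ring
  have hHl : ∀ r ∈ Set.Icc (0 : ℝ) t, |H (v + r) - H v| ≤ 2 / v ^ 2 * t := by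
    intro r hr
    have := abs_sub_le_of_hasDerivAt (x := v) (y := v + r) (C := 2 / v ^ 2)
      (fun w hw => hHd w (hv.trans_le (hpos r hr w hw))) (fun w hw => by
        have hw0 := hv.trans_le (hpos r hr w hw)
        rw [abs_mul, abs_of_pos (by positivity)]
        have h1 : w⁻¹ ^ 2 ≤ v⁻¹ ^ 2 :=
          pow_le_pow_left₀ (inv_pos.2 hw0).le (inv_anti₀ hv (hpos r hr w hw)) 2
        calc _ ≤ v⁻¹ ^ 2 * 2 := mul_le_mul h1 (abs_cubic_mul_stdNormalPDF_le _) (abs_nonneg _)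
              (by positivity)
          _ = _ := by rw [inv_pow]; ring)
    rw [add_sub_cancel_left, abs_of_nonneg hr.1] at this
    exact this.trans (mul_le_mul_of_nonneg_left hr.2 (by positivity))
  -- Subtracting the tangent `r * H v` leaves a function with derivative `H (v + r) - H v`, which is
  -- `O(t / v²)` on `[0, t]`. Integrating over length `t` gives the quadratic error.
  have := abs_sub_le_of_hasDerivAt (ψ := fun r => stdNormalCDF (c / √(v + r)) - r * H v)
    (ψ' := fun r => H (v + r) - H v) (x := 0) (y := t) (C := 2 / v ^ 2 * t)
    (fun r hr => by
      rw [Set.uIcc_of_le ht] at hr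
      exact (((hasDerivAt_stdNormalCDF_div_sqrt c
        (by linarith [hr.1] : 0 < v + r)).comp_const_add v r).sub
        ((hasDerivAt_id r).mul_const (H v))).congr_deriv (by simp [hH]))
    (fun r hr => hHl r (by rwa [Set.uIcc_of_le ht] at hr))
  simp only [add_zero, zero_mul, sub_zero, abs_of_nonneg ht] at this
  have e1 : (√v)⁻¹ ^ 2 = v⁻¹ := by rw [inv_pow, Real.sq_sqrt hv.le]
  have e2 : stdNormalCDF (c / √(v + t)) - stdNormalCDF (c / √v)
      - t / 2 * -((√v)⁻¹ ^ 2 * (c / √v * stdNormalPDF (c / √v)))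
      = stdNormalCDF (c / √(v + t)) - t * H v - stdNormalCDF (c / √v) := by
    rw [e1, hH]; ring
  rw [e2]
  refine this.trans (le_of_eq ?_)
  ring

end Gaussian

/-! ### Removal of Gaussian smoothing -/

section Smoothing

lemma integrable_sq_gaussianReal : Integrable (fun z : ℝ => z ^ 2) (gaussianReal 0 1) :=
  (memLp_id_gaussianReal 2).integrable_sq

lemma integral_sq_gaussianReal : ∫ z, z ^ 2 ∂gaussianReal 0 1 = 1 := by
  have h := variance_id_gaussianReal (μ := 0) (v := 1)
  rw [variance_eq_integral (by fun_prop)] at h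
  simpa using h

/-- Removal of Gaussian smoothing from the comparison of two distribution functions. -/
lemma abs_sub_le_of_gaussian_smoothing {F G : ℝ → ℝ} {L D ε : ℝ} (hF : Monotone F)
    (hF0 : ∀ y, 0 ≤ F y) (hF1 : ∀ y, F y ≤ 1) (hG0 : ∀ y, 0 ≤ G y) (hG1 : ∀ y, G y ≤ 1)
    (hL : 0 ≤ L) (hG : ∀ x y, |G y - G x| ≤ L * |y - x|) (hε : 0 ≤ ε)
    (hD : ∀ y, |∫ z, F (y - ε * z) ∂gaussianReal 0 1 - G y| ≤ D) (y : ℝ) :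
    |F y - G y| ≤ 2 * (D + 6 * (L * ε)) := by
  set N := gaussianReal 0 1
  have hbdd : BddAbove (Set.range fun y => |F y - G y|) := by
    refine ⟨1, ?_⟩
    rintro _ ⟨y, rfl⟩
    simp only
    rw [abs_le]; constructor <;> linarith [hF0 y, hF1 y, hG0 y, hG1 y]
  -- The estimate is self-bounding: at each point the discrepancy is controlled by a small multiple
  -- of its supremum `Δ` plus the smoothed error.
  set Δ := ⨆ y, |F y - G y| with hΔ
  have hle : ∀ y, |F y - G y| ≤ Δ := fun y => le_ciSup hbdd y
  have hLε := mul_nonneg hL hε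
  have hFi : ∀ y, Integrable (fun z => F (y - ε * z)) N := fun y => by
    refine Integrable.of_bound
      (hF.measurable.comp (by fun_prop : Measurable fun z => y - ε * z)).aestronglyMeasurable 1
      (ae_of_all _ fun z => ?_)
    rw [Real.norm_of_nonneg (hF0 _)]; exact hF1 _
  have hq : ∀ c₀ c₁ : ℝ, Integrable (fun z : ℝ => c₀ + c₁ * z ^ 2) N ∧
      ∫ z, (c₀ + c₁ * z ^ 2) ∂N = c₀ + c₁ := fun c₀ c₁ => by
    refine ⟨(integrable_const _).add (integrable_sq_gaussianReal.const_mul _), ?_⟩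
    rw [integral_add (integrable_const _) (integrable_sq_gaussianReal.const_mul _),
      integral_const_mul, integral_sq_gaussianReal]
    simp
  have habs : ∀ z : ℝ, |2 - z| ≤ 3 + z ^ 2 ∧ |2 + z| ≤ 3 + z ^ 2 := fun z => by
    constructor <;> rw [abs_le] <;> constructor <;>
      nlinarith [sq_nonneg (z - 1), sq_nonneg (z + 1)]
  have upper : ∀ y₀, 3 / 4 * (F y₀ - G y₀) ≤ 1 / 4 * Δ + (D + 6 * (L * ε)) := by
    intro y₀
    set H := F y₀ - G y₀ with hH
    have hHΔ : 0 ≤ H + Δ := by linarith [neg_abs_le H, hle y₀]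
    -- After a shift by `2ε`, monotonicity of `F` serves for `z ≤ 2` and the bound `Δ` for `z > 2`.
    -- The indicator of `z > 2` is replaced by `z² / 4`, of Gaussian mean `1/4`.
    have hpt : ∀ z, (G y₀ + H - 3 * (L * ε)) + (-((H + Δ) / 4) - L * ε) * z ^ 2
        ≤ F (y₀ + 2 * ε - ε * z) := by
      intro z
      have hz2 := sq_nonneg z
      rcases le_or_gt z 2 with hz | hz
      · have h1 : F y₀ ≤ F (y₀ + 2 * ε - ε * z) := hF (by nlinarith)
        nlinarith [mul_nonneg hHΔ hz2, mul_nonneg hLε hz2]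
      · have h1 := hle (y₀ + 2 * ε - ε * z)
        have h2 := hG y₀ (y₀ + 2 * ε - ε * z)
        have h3 : |y₀ + 2 * ε - ε * z - y₀| = ε * |2 - z| := by
          rw [show y₀ + 2 * ε - ε * z - y₀ = ε * (2 - z) by ring, abs_mul, abs_of_nonneg hε]
        rw [h3] at h2
        have h4 := mul_le_mul_of_nonneg_left (habs z).1 hLε
        have h5 := (abs_le.1 h1).1
        have h6 := (abs_le.1 h2).1
        nlinarith [mul_nonneg hHΔ (by nlinarith : (0 : ℝ) ≤ z ^ 2 / 4 - 1)]
    have hint := integral_mono (hq _ _).1 (hFi (y₀ + 2 * ε)) hpt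
    rw [(hq _ _).2] at hint
    have h7 := (abs_le.1 (hD (y₀ + 2 * ε))).2
    have h8 := hG y₀ (y₀ + 2 * ε)
    rw [add_sub_cancel_left, abs_of_nonneg (by linarith : 0 ≤ 2 * ε)] at h8
    have h9 := (abs_le.1 h8).2
    linarith
  have lower : ∀ y₀, 3 / 4 * (G y₀ - F y₀) ≤ 1 / 4 * Δ + (D + 6 * (L * ε)) := by
    intro y₀
    set H := G y₀ - F y₀ with hH
    have hHΔ : 0 ≤ H + Δ := by linarith [le_abs_self (F y₀ - G y₀), hle y₀]
    have hpt : ∀ z, F (y₀ - 2 * ε - ε * z) ≤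
        (G y₀ - H + 3 * (L * ε)) + ((H + Δ) / 4 + L * ε) * z ^ 2 := by
      intro z
      have hz2 := sq_nonneg z
      rcases le_or_gt (-2) z with hz | hz
      · have h1 : F (y₀ - 2 * ε - ε * z) ≤ F y₀ := hF (by nlinarith)
        nlinarith [mul_nonneg hHΔ hz2, mul_nonneg hLε hz2]
      · have h1 := hle (y₀ - 2 * ε - ε * z)
        have h2 := hG y₀ (y₀ - 2 * ε - ε * z)
        have h3 : |y₀ - 2 * ε - ε * z - y₀| = ε * |2 + z| := by
          rw [show y₀ - 2 * ε - ε * z - y₀ = -(ε * (2 + z)) by ring, abs_neg, abs_mul,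
            abs_of_nonneg hε]
        rw [h3] at h2
        have h4 := mul_le_mul_of_nonneg_left (habs z).2 hLε
        have h5 := (abs_le.1 h1).2
        have h6 := (abs_le.1 h2).2
        nlinarith [mul_nonneg hHΔ (by nlinarith : (0 : ℝ) ≤ z ^ 2 / 4 - 1)]
    have hint := integral_mono (hFi (y₀ - 2 * ε)) (hq _ _).1 hpt
    rw [(hq _ _).2] at hint
    have h7 := (abs_le.1 (hD (y₀ - 2 * ε))).1
    have h8 := hG y₀ (y₀ - 2 * ε)
    rw [show y₀ - 2 * ε - y₀ = -(2 * ε) by ring, abs_neg,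
      abs_of_nonneg (by linarith : 0 ≤ 2 * ε)] at h8
    have h9 := (abs_le.1 h8).1
    linarith
  have hboth : ∀ y, |F y - G y| ≤ 4 / 3 * (1 / 4 * Δ + (D + 6 * (L * ε))) := fun y => by
    rw [abs_le]; constructor <;> linarith [upper y, lower y]
  -- Only a third of `Δ` returns on the right, so it can be absorbed. This is where the factor `2`
  -- comes from.
  have hsup : Δ ≤ 4 / 3 * (1 / 4 * Δ + (D + 6 * (L * ε))) := ciSup_le hboth
  linarith [hle y]

/-- By Fubini, both sides are the probability that `S + ε N ≤ y` with `N` standard normal and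
independent of `S`. -/
lemma integral_stdNormalCDF_eq {Ω : Type*} [MeasurableSpace Ω] {P : Measure Ω}
    [IsProbabilityMeasure P] {S : Ω → ℝ} (hS : Measurable S) {ε : ℝ} (hε : 0 < ε) (y : ℝ) :
    ∫ ω, stdNormalCDF ((y - S ω) / ε) ∂P
      = ∫ z, P.real {ω | S ω ≤ y - ε * z} ∂gaussianReal 0 1 := by
  have hmeas : MeasurableSet {p : Ω × ℝ | S p.1 + ε * p.2 ≤ y} :=
    measurableSet_le ((hS.comp measurable_fst).add (measurable_snd.const_mul ε)) measurable_const
  have hint : Integrable (Function.uncurry fun (ω : Ω) (z : ℝ) =>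
      {p : Ω × ℝ | S p.1 + ε * p.2 ≤ y}.indicator (fun _ => (1 : ℝ)) (ω, z))
      (P.prod (gaussianReal 0 1)) :=
    (integrable_const (1 : ℝ)).indicator hmeas
  have h := integral_integral_swap hint
  have e1 : ∀ ω, ∫ z, {p : Ω × ℝ | S p.1 + ε * p.2 ≤ y}.indicator (fun _ => (1 : ℝ)) (ω, z)
      ∂gaussianReal 0 1 = stdNormalCDF ((y - S ω) / ε) := fun ω => by
    rw [stdNormalCDF_eq_real, ← integral_indicator_one measurableSet_Iic]
    congr 1 with z
    have : S ω + ε * z ≤ y ↔ z ≤ (y - S ω) / ε := by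
      rw [le_div_iff₀ hε]; constructor <;> intro h <;> linarith
    simp [Set.indicator, this]
  have e2 : ∀ z, ∫ ω, {p : Ω × ℝ | S p.1 + ε * p.2 ≤ y}.indicator (fun _ => (1 : ℝ)) (ω, z) ∂P
      = P.real {ω | S ω ≤ y - ε * z} := fun z => by
    rw [← integral_indicator_one (measurableSet_le hS measurable_const)]
    congr 1 with ω
    simp [Set.indicator, le_sub_iff_add_le]
  simpa only [e1, e2] using h

lemma abs_measure_sub_stdNormalCDF_le {Ω : Type*} [MeasurableSpace Ω] {P : Measure Ω}
    [IsProbabilityMeasure P] {S : Ω → ℝ} (hS : Measurable S) {ε s D : ℝ} (hε : 0 < ε) (hs : 0 < s)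
    (hD : ∀ y, |∫ ω, stdNormalCDF ((y - S ω) / ε) ∂P - stdNormalCDF (y / s)| ≤ D) (y : ℝ) :
    |P.real {ω | S ω ≤ y} - stdNormalCDF (y / s)| ≤ 2 * (D + 6 * (ε / s)) := by
  have := abs_sub_le_of_gaussian_smoothing (F := fun y => P.real {ω | S ω ≤ y})
    (G := fun y => stdNormalCDF (y / s)) (L := s⁻¹) (D := D) (ε := ε)
    (fun a b hab => measureReal_mono fun ω (hω : S ω ≤ a) => hω.trans hab)
    (fun y => measureReal_nonneg) (fun y => measureReal_le_one)
    (fun y => stdNormalCDF_nonneg _) (fun y => stdNormalCDF_le_one _) (inv_pos.2 hs).le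
    (fun x y => (abs_stdNormalCDF_sub_le _ _).trans (le_of_eq (by
      rw [← sub_div, abs_div, abs_of_pos hs]; ring))) hε.le
    (fun y => by rw [← integral_stdNormalCDF_eq hS hε]; exact hD y) y
  rwa [inv_mul_eq_div] at this

end Smoothing

/-! ### A Berry–Esseen bound by summing the Lindeberg steps -/

section BerryEsseen

/-- A discrete form of `∫ (ε² + s x)^(-3/2) dx = 2/(s ε)`: each term is compared with a telescoping
difference of `1 / b m`. Since `s ≤ 1 ≤ ε`, consecutive `b m` differ by at most a factor `2`. -/
lemma sum_inv_sqrt_cube_le {s ε : ℝ} (hs : 0 < s) (hs1 : s ≤ 1) (hε : 1 ≤ ε) (n : ℕ) :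
    ∑ m ∈ Finset.range n, (√(ε ^ 2 + m * s))⁻¹ ^ 3 ≤ 6 / (s * ε) := by
  set b : ℕ → ℝ := fun m => √(ε ^ 2 + m * s) with hb
  have hpos : ∀ m : ℕ, 1 ≤ ε ^ 2 + m * s := fun m => by
    have : (0 : ℝ) ≤ m * s := by positivity
    nlinarith
  have hb1 : ∀ m, 1 ≤ b m := fun m => by
    simp only [hb]; rw [Real.one_le_sqrt]; exact hpos m
  have hbsq : ∀ m, b m ^ 2 = ε ^ 2 + m * s := fun m => Real.sq_sqrt (by linarith [hpos m])
  have hstep : ∀ m, (b m)⁻¹ ^ 3 ≤ 6 / s * ((b m)⁻¹ - (b (m + 1))⁻¹) := by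
    intro m
    have h1 := hbsq m
    have h2 := hbsq (m + 1)
    push_cast at h2
    have h3 := hb1 m
    have h4 := hb1 (m + 1)
    have h5 : b (m + 1) ≤ 2 * b m := by nlinarith
    have h6 : b m ≤ b (m + 1) := by nlinarith
    have h7 : s = (b (m + 1) - b m) * (b (m + 1) + b m) := by nlinarith
    have hx : 0 < b m := by linarith
    have hy : 0 < b (m + 1) := by linarith
    have e1 : 6 / s * ((b m)⁻¹ - (b (m + 1))⁻¹)
        = 6 * (b (m + 1) - b m) / (s * (b m * b (m + 1))) := by
      field_simp
    rw [e1, inv_pow, ← one_div, div_le_div_iff₀ (by positivity) (by positivity), one_mul]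
    have h8 : b (m + 1) * (b (m + 1) + b m) ≤ 6 * b m ^ 2 := by nlinarith
    have h9 : 0 ≤ (b (m + 1) - b m) * b m := by
      have := sub_nonneg.2 h6; positivity
    calc s * (b m * b (m + 1))
        = ((b (m + 1) - b m) * b m) * (b (m + 1) * (b (m + 1) + b m)) := by
          conv_lhs => rw [h7]
          ring
      _ ≤ ((b (m + 1) - b m) * b m) * (6 * b m ^ 2) := mul_le_mul_of_nonneg_left h8 h9
      _ = _ := by ring
  refine (Finset.sum_le_sum fun m _ => hstep m).trans ?_
  rw [← Finset.mul_sum, Finset.sum_range_sub' (fun m => (b m)⁻¹)]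
  have h0 : b 0 = ε := by simp [hb, Real.sqrt_sq (by linarith : 0 ≤ ε)]
  have hn : 0 < (b n)⁻¹ := inv_pos.2 (by linarith [hb1 n])
  rw [h0, ← div_div, div_eq_mul_inv (6 / s)]
  exact mul_le_mul_of_nonneg_left (by linarith) (by positivity)

variable {Ω : Type*} [mΩ : MeasurableSpace Ω] {P : Measure Ω} {Z : ℕ → Ω → ℝ}
  {F G : ℕ → MeasurableSpace Ω} {B e : ℝ} {a : ℕ → ℝ}

namespace WeaklyDependent

/-- Lindeberg's method with Gaussian smoothing of variance `ε²`. -/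
lemma abs_integral_smoothed_sub_le [IsProbabilityMeasure P] (hZ : WeaklyDependent P Z F G B e a)
    {n : ℕ} (hn : 0 < n) {s ε A : ℝ} (hs : 0 < s) (hε : 1 ≤ ε)
    (hlow : ∀ k < n, s ≤ varIncr P Z k) (hone : ∀ k < n, varIncr P Z k ≤ 1)
    (hup : ∀ k < n, varIncr P Z k ≤ A)
    (hA : ∀ k < n, B ^ 2 * e + (4 * B + 2 * e) * weightedSum a k ≤ A) (y : ℝ) :
    |∫ ω, stdNormalCDF ((y - partialSum Z n ω) / ε) ∂P
      - stdNormalCDF (y / √(∑ k ∈ Finset.range n, varIncr P Z k + ε ^ 2))| ≤ 18 * A / (s * ε) := by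
  -- `v k` is the smoothing plus the variance yet to be added. Thus `Ψ` runs from the normal value
  -- at `k = 0` to the smoothed distribution function of the sum at `k = n`.
  set v : ℕ → ℝ := fun k => ε ^ 2 + ∑ j ∈ Finset.Ico k n, varIncr P Z j with hv
  have hvlow : ∀ k, k ≤ n → ε ^ 2 + ((n - k : ℕ) : ℝ) * s ≤ v k := by
    intro k hk
    simp only [hv]
    have : ((n - k : ℕ) : ℝ) * s = ∑ _j ∈ Finset.Ico k n, s := by simp
    rw [this]
    gcongr with j hj
    exact hlow j (Finset.mem_Ico.1 hj).2
  have hv1 : ∀ k, k ≤ n → 1 ≤ v k := fun k hk => by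
    have h1 := hvlow k hk
    have : 0 ≤ ((n - k : ℕ) : ℝ) * s := by positivity
    nlinarith
  set Ψ : ℕ → ℝ := fun k => ∫ ω, stdNormalCDF ((y - partialSum Z k ω) / √(v k)) ∂P with hΨ
  have hstep : ∀ k < n, |Ψ (k + 1) - Ψ k| ≤ 3 * A * (√(v (k + 1)))⁻¹ ^ 3 := by
    intro k hk
    have hw1 := hv1 (k + 1) hk
    set w := v (k + 1) with hw
    have hw0 : 0 < w := by linarith
    have hsw : 1 ≤ √w := Real.one_le_sqrt.2 hw1
    set t := varIncr P Z k with ht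
    have ht0 : 0 ≤ t := hs.le.trans (hlow k hk)
    have hvk : v k = w + t := by
      simp only [hv, hw, ht]
      rw [Finset.sum_eq_sum_Ico_succ_bot hk]; ring
    have hφ := taylorBound_stdNormalCDF y (s := √w) (by linarith)
    have hL := hZ.lindeberg_step hφ k
    have b0 := hZ.bddMeas_comp hφ.meas hφ.bdd k
    have b2 := hZ.bddMeas_comp hφ.meas_two hφ.bdd_two k
    have b3 : BddMeas (fun ω => stdNormalCDF ((y - partialSum Z k ω) / √(w + t))) :=
      hZ.bddMeas_comp (taylorBound_stdNormalCDF y (Real.sqrt_pos.2 (by linarith))).meas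
        (taylorBound_stdNormalCDF y (Real.sqrt_pos.2 (by linarith))).bdd k
    have hH : |∫ ω, stdNormalCDF ((y - partialSum Z k ω) / √(w + t)) ∂P
        - ∫ ω, stdNormalCDF ((y - partialSum Z k ω) / √w) ∂P
        - t / 2 * ∫ ω, -((√w)⁻¹ ^ 2 * ((y - partialSum Z k ω) / √w *
          stdNormalPDF ((y - partialSum Z k ω) / √w))) ∂P| ≤ 2 * t ^ 2 / w ^ 2 := by
      rw [← integral_sub b3.integrable b0.integrable, ← integral_const_mul,
        ← integral_sub (b3.sub b0).integrable (b2.integrable.const_mul _)]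
      refine abs_integral_le_integral_abs.trans ?_
      have : ∫ _ω : Ω, 2 * t ^ 2 / w ^ 2 ∂P = 2 * t ^ 2 / w ^ 2 := by simp
      rw [← this]
      exact integral_mono (((b3.sub b0).sub ((BddMeas.const _).mul b2)).abs.integrable)
        (integrable_const _) fun ω => heat_step _ hw0 ht0
    have hw2 : 2 * t ^ 2 / w ^ 2 ≤ 2 * A * (√w)⁻¹ ^ 3 := by
      have e1 : w ^ 2 = √w ^ 4 := by
        rw [show (4 : ℕ) = 2 * 2 from rfl, pow_mul, Real.sq_sqrt hw0.le]
      -- Here `t ≤ 1` and `t ≤ A`. Together with `w ≥ 1`, this brings the heat error `t²/w²` down to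
      -- the Lindeberg order `A w^(-3/2)`.
      have htA : t ^ 2 ≤ A := by nlinarith [hone k hk, hup k hk]
      have hA0 : 0 ≤ A := (sq_nonneg t).trans htA
      have h3 : (√w)⁻¹ ^ 4 ≤ (√w)⁻¹ ^ 3 :=
        pow_le_pow_of_le_one (by positivity) (inv_le_one_of_one_le₀ hsw) (by norm_num)
      rw [e1, div_eq_mul_inv, ← inv_pow]
      exact mul_le_mul (by linarith) h3 (by positivity) (by linarith)
    have hMA := mul_le_mul_of_nonneg_left (hA k hk) hφ.nonneg
    simp only [hΨ, hvk, ← hw]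
    rw [abs_le] at *
    constructor <;> linarith
  have htel : |Ψ n - Ψ 0| ≤ 18 * A / (s * ε) := by
    rw [← Finset.sum_range_sub Ψ n]
    refine (Finset.abs_sum_le_sum_abs _ _).trans ((Finset.sum_le_sum
      (g := fun k => 3 * A * (√(ε ^ 2 + ((n - 1 - k : ℕ) : ℝ) * s))⁻¹ ^ 3) fun k hk => ?_).trans ?_)
    · have hkn := Finset.mem_range.1 hk
      refine (hstep k hkn).trans ?_
      have h1 := hvlow (k + 1) hkn
      have hA0 : 0 ≤ A := (hs.le.trans (hlow k hkn)).trans (hup k hkn)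
      have h2 : n - (k + 1) = n - 1 - k := by omega
      rw [h2] at h1
      have h3 : 0 < ε ^ 2 + ((n - 1 - k : ℕ) : ℝ) * s := by positivity
      gcongr
    · rw [← Finset.mul_sum,
        Finset.sum_range_reflect (fun m : ℕ => (√(ε ^ 2 + (m : ℝ) * s))⁻¹ ^ 3)]
      have hs1 : s ≤ 1 := (hlow 0 hn).trans (hone 0 hn)
      have hA0 : 0 ≤ A := (hs.le.trans (hlow 0 hn)).trans (hup 0 hn)
      calc _ ≤ 3 * A * (6 / (s * ε)) :=
              mul_le_mul_of_nonneg_left (sum_inv_sqrt_cube_le hs hs1 hε n) (by linarith)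
          _ = _ := by ring
  have en : Ψ n = ∫ ω, stdNormalCDF ((y - partialSum Z n ω) / ε) ∂P := by
    simp [hΨ, hv, Real.sqrt_sq (by linarith : 0 ≤ ε)]
  have e0 : Ψ 0 = stdNormalCDF (y / √(∑ k ∈ Finset.range n, varIncr P Z k + ε ^ 2)) := by
    simp [hΨ, hv, partialSum, add_comm]
  rwa [en, e0] at htel

/-- A Berry–Esseen type bound for partial sums of weakly dependent variables. -/
theorem berryEsseen [IsProbabilityMeasure P] (hZ : WeaklyDependent P Z F G B e a)
    {n : ℕ} (hn : 0 < n) {s ε A : ℝ} (hs : 0 < s) (hε : 1 ≤ ε)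
    (hlow : ∀ k < n, s ≤ varIncr P Z k) (hone : ∀ k < n, varIncr P Z k ≤ 1)
    (hup : ∀ k < n, varIncr P Z k ≤ A)
    (hA : ∀ k < n, B ^ 2 * e + (4 * B + 2 * e) * weightedSum a k ≤ A) (y : ℝ) :
    |P.real {ω | partialSum Z n ω ≤ y}
      - stdNormalCDF (y / √(∑ k ∈ Finset.range n, varIncr P Z k))| ≤
      36 * (A / (s * ε)) + 14 * (ε / √(∑ k ∈ Finset.range n, varIncr P Z k)) := by
  set V := ∑ k ∈ Finset.range n, varIncr P Z k with hV
  have hV0 : 0 < V := by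
    refine Finset.sum_pos (fun k hk => hs.trans_le (hlow k (Finset.mem_range.1 hk))) ?_
    simpa using hn.ne'
  have hε0 : 0 < ε := by linarith
  have hsV := Real.sqrt_pos.2 hV0
  have hA0 : 0 ≤ A := (hs.le.trans (hlow 0 hn)).trans (hup 0 hn)
  have hr0 : 0 ≤ A / (s * ε) := by positivity
  -- If `ε > √V`, the claimed bound exceeds `1` and is trivial. Otherwise the extra variance `ε²`
  -- costs `ε²/V ≤ ε/√V`.
  rcases le_or_gt ε (√V) with hεV | hεV
  · have hq : ε / √V ≤ 1 := (div_le_one hsV).2 hεV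
    have hD : ∀ y, |∫ ω, stdNormalCDF ((y - partialSum Z n ω) / ε) ∂P
        - stdNormalCDF (y / √V)| ≤ 18 * A / (s * ε) + ε / √V := by
      intro y
      have h1 := hZ.abs_integral_smoothed_sub_le hn hs hε hlow hone hup hA y
      have h2 := abs_stdNormalCDF_div_sqrt_sub_le y hV0 (sq_nonneg ε)
      have h3 : ε ^ 2 / V ≤ ε / √V := by
        have : ε ^ 2 / V = (ε / √V) ^ 2 := by rw [div_pow, Real.sq_sqrt hV0.le]
        rw [this, sq]
        exact mul_le_of_le_one_left (by positivity) hq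
      exact (abs_sub_le _ _ _).trans (add_le_add h1 (h2.trans h3))
    have := abs_measure_sub_stdNormalCDF_le (hZ.measurable_partialSum n) hε0 hsV hD y
    refine this.trans (le_of_eq ?_)
    rw [mul_div_assoc]; ring
  · have h1 : 1 ≤ ε / √V := by rw [le_div_iff₀ hsV]; linarith
    have h2 : P.real {ω | partialSum Z n ω ≤ y} ≤ 1 := measureReal_le_one
    have h3 : 0 ≤ P.real {ω | partialSum Z n ω ≤ y} := measureReal_nonneg
    have h4 := stdNormalCDF_nonneg (y / √V)
    have h5 := stdNormalCDF_le_one (y / √V)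
    have h6 : |P.real {ω | partialSum Z n ω ≤ y} - stdNormalCDF (y / √V)| ≤ 1 := by
      rw [abs_le]; constructor <;> linarith
    linarith

end WeaklyDependent

end BerryEsseen

/-! ### Sums of the covariance bounds -/

section Sums

lemma sum_rpow_tail_le {s : ℝ} (hs : 1 < s) {L N : ℕ} (hL : 1 ≤ L) (hLN : L ≤ N) :
    ∑ i ∈ Finset.Ico L N, ((i + 1 : ℕ) : ℝ) ^ (-s) ≤ (L : ℝ) ^ (1 - s) / (s - 1) := by
  have hL0 : (0 : ℝ) < L := by exact_mod_cast hL
  have hLN' : (L : ℝ) ≤ N := by exact_mod_cast hLN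
  have hanti : AntitoneOn (fun x : ℝ => x ^ (-s)) (Set.Icc (L : ℝ) N) := fun x hx y _ hxy =>
    Real.rpow_le_rpow_of_nonpos (hL0.trans_le hx.1) hxy (by linarith)
  refine (hanti.sum_le_integral_Ico hLN).trans ?_
  rw [integral_rpow (Or.inr ⟨by linarith, fun h => by
    rw [Set.uIcc_of_le hLN'] at h; linarith [h.1]⟩)]
  have e1 : -s + 1 = 1 - s := by ring
  have e2 : ((N : ℝ) ^ (1 - s) - (L : ℝ) ^ (1 - s)) / (1 - s)
      = ((L : ℝ) ^ (1 - s) - (N : ℝ) ^ (1 - s)) / (s - 1) := by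
    rw [← neg_div_neg_eq]; ring_nf
  rw [e1, e2]
  have hN : 0 ≤ (N : ℝ) ^ (1 - s) := Real.rpow_nonneg (Nat.cast_nonneg _) _
  exact div_le_div_of_nonneg_right (by linarith) (by linarith)

/-- Split at `m = h^(-2/β)`, where `m^(-β) = h²`. Both sides of the split contribute the same power
of `h`. The case `q = 0` serves the variance, and `q = 1` the Lindeberg remainder. -/
lemma sum_pow_mul_min_le (q : ℕ) {β : ℝ} (hβ : (q : ℝ) + 1 < β) {h : ℝ} (h0 : 0 < h) (h1 : h ≤ 1)
    (k : ℕ) :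
    ∑ m ∈ Finset.range (k + 1), (m : ℝ) ^ q * min (h ^ 2) ((m : ℝ) ^ (-β)) ≤
      (2 ^ (q + 1) + 1 / (β - q - 1)) * h ^ (2 - 2 * (q + 1) / β) := by
  have hq0 : (0 : ℝ) ≤ q := Nat.cast_nonneg q
  have hβ0 : 0 < β := by linarith
  set x : ℝ := h ^ (-(2 / β)) with hx
  have hx1 : 1 ≤ x := by
    rw [hx, Real.rpow_neg h0.le]
    exact (one_le_inv₀ (Real.rpow_pos_of_pos h0 _)).2 (Real.rpow_le_one h0.le h1 (by positivity))
  set L := ⌈x⌉₊ with hL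
  have hxL : x ≤ L := Nat.le_ceil x
  have hLx : (L : ℝ) ≤ 2 * x := by linarith [(Nat.ceil_lt_add_one (by linarith : 0 ≤ x))]
  have hL1 : 1 ≤ L := by exact_mod_cast hx1.trans hxL
  rw [Finset.sum_range_succ']
  -- The term `m = 0` vanishes even for `q = 0`, because the real power `0 ^ (-β)` is `0`.
  have hz : ((0 : ℕ) : ℝ) ^ q * min (h ^ 2) (((0 : ℕ) : ℝ) ^ (-β)) = 0 := by
    rw [Nat.cast_zero, Real.zero_rpow (by linarith), min_eq_right (sq_nonneg h), mul_zero]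
  rw [hz, add_zero]
  have hnn : ∀ i : ℕ, 0 ≤ ((i + 1 : ℕ) : ℝ) ^ q * min (h ^ 2) (((i + 1 : ℕ) : ℝ) ^ (-β)) :=
    fun i => by positivity
  have hsub : ∑ i ∈ Finset.range k, ((i + 1 : ℕ) : ℝ) ^ q *
      min (h ^ 2) (((i + 1 : ℕ) : ℝ) ^ (-β)) ≤
      ∑ i ∈ Finset.range (max L k), ((i + 1 : ℕ) : ℝ) ^ q *
      min (h ^ 2) (((i + 1 : ℕ) : ℝ) ^ (-β)) :=
    Finset.sum_le_sum_of_subset_of_nonneg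
      (Finset.range_subset_range.2 (le_max_right _ _)) fun i _ _ => hnn i
  rw [← Finset.sum_range_add_sum_Ico _ (le_max_left L k)] at hsub
  have hA : ∑ i ∈ Finset.range L, ((i + 1 : ℕ) : ℝ) ^ q *
      min (h ^ 2) (((i + 1 : ℕ) : ℝ) ^ (-β)) ≤ (L : ℝ) ^ (q + 1) * h ^ 2 := by
    have : (L : ℝ) ^ (q + 1) * h ^ 2 = ∑ _i ∈ Finset.range L, (L : ℝ) ^ q * h ^ 2 := by
      rw [Finset.sum_const, Finset.card_range, nsmul_eq_mul]; ring
    rw [this]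
    refine Finset.sum_le_sum fun i hi => ?_
    have hi' : ((i + 1 : ℕ) : ℝ) ≤ L := by exact_mod_cast Finset.mem_range.1 hi
    have := min_le_left (h ^ 2) (((i + 1 : ℕ) : ℝ) ^ (-β))
    gcongr
  have hB : ∑ i ∈ Finset.Ico L (max L k), ((i + 1 : ℕ) : ℝ) ^ q *
      min (h ^ 2) (((i + 1 : ℕ) : ℝ) ^ (-β)) ≤ (L : ℝ) ^ (1 - (β - q)) / (β - q - 1) := by
    refine le_trans (Finset.sum_le_sum fun i _ => ?_)
      (sum_rpow_tail_le (s := β - q) (by linarith) hL1 (le_max_left L k))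
    have hp : (0 : ℝ) < ((i + 1 : ℕ) : ℝ) := by positivity
    calc ((i + 1 : ℕ) : ℝ) ^ q * min (h ^ 2) (((i + 1 : ℕ) : ℝ) ^ (-β))
        ≤ ((i + 1 : ℕ) : ℝ) ^ q * ((i + 1 : ℕ) : ℝ) ^ (-β) :=
          mul_le_mul_of_nonneg_left (min_le_right _ _) (by positivity)
      _ = _ := by rw [← Real.rpow_natCast, ← Real.rpow_add hp]; congr 1; ring
  have e1 : x ^ (q + 1) * h ^ 2 = h ^ (2 - 2 * ((q : ℝ) + 1) / β) := by
    rw [hx, ← Real.rpow_natCast, ← Real.rpow_mul h0.le, ← Real.rpow_natCast h 2,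
      ← Real.rpow_add h0]
    congr 1; push_cast; field_simp; ring
  have e2 : x ^ (1 - (β - q)) = h ^ (2 - 2 * ((q : ℝ) + 1) / β) := by
    rw [hx, ← Real.rpow_mul h0.le]
    congr 1; field_simp; ring
  have hA' : (L : ℝ) ^ (q + 1) * h ^ 2 ≤ 2 ^ (q + 1) * h ^ (2 - 2 * ((q : ℝ) + 1) / β) := by
    rw [← e1, ← mul_assoc, ← mul_pow]
    gcongr
  have hB' : (L : ℝ) ^ (1 - (β - q)) / (β - q - 1) ≤
      1 / (β - q - 1) * h ^ (2 - 2 * ((q : ℝ) + 1) / β) := by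
    rw [← e2, one_div, inv_mul_eq_div]
    refine div_le_div_of_nonneg_right ?_ (by linarith)
    exact Real.rpow_le_rpow_of_nonpos (by linarith) hxL (by linarith)
  rw [add_mul]
  exact hsub.trans (add_le_add (hA.trans hA') (hB.trans hB'))

end Sums

/-! ### Global Taylor bounds for the density -/

section Taylor

/-- A bounded function which is smooth at a point satisfies global Taylor bounds there. -/
lemma exists_taylor_bound {f : ℝ → ℝ} {x₀ : ℝ} {C₀ : ℝ} (hb : ∀ x, |f x| ≤ C₀)
    (hf : ContDiffAt ℝ 4 f x₀) :
    ∃ C, 0 ≤ C ∧ ∃ d, (∀ v, |f (x₀ + v) - f x₀| ≤ C * |v|) ∧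
      ∀ v, |f (x₀ + v) - f x₀ - d * v - iteratedDeriv 2 f x₀ * v ^ 2 / 2| ≤ C * |v| ^ 3 := by
  have hC0 : 0 ≤ C₀ := (abs_nonneg _).trans (hb 0)
  obtain ⟨u, hu, hfu⟩ := hf.contDiffOn (m := ((3 : ℕ) : WithTop ℕ∞)) (by norm_num) (by simp)
  obtain ⟨r, hr, hru⟩ := Metric.mem_nhds_iff.1 hu
  have hx₀ : x₀ ∈ Metric.ball x₀ r := Metric.mem_ball_self hr
  have ho := taylor_isLittleO (convex_ball x₀ r) hx₀ (hfu.mono hru)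
  rw [Metric.isOpen_ball.nhdsWithin_eq hx₀] at ho
  have hT : ∀ x, taylorWithinEval f 3 (Metric.ball x₀ r) x₀ x = f x₀
      + (x - x₀) * iteratedDeriv 1 f x₀ + (x - x₀) ^ 2 * iteratedDeriv 2 f x₀ / 2
      + (x - x₀) ^ 3 * iteratedDeriv 3 f x₀ / 6 := fun x => by
    simp only [taylor_within_apply, Finset.sum_range_succ, Finset.sum_range_zero,
      iteratedDerivWithin_of_isOpen Metric.isOpen_ball hx₀, smul_eq_mul, Nat.factorial]
    rw [iteratedDeriv_zero]
    norm_num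
    ring
  set d1 := iteratedDeriv 1 f x₀
  set d2 := iteratedDeriv 2 f x₀
  set d3 := iteratedDeriv 3 f x₀
  obtain ⟨ρ, hρ, hρb⟩ := Metric.eventually_nhds_iff.1 (ho.bound one_pos)
  set ε := min ρ 1 with hε
  have hε0 : 0 < ε := lt_min hρ one_pos
  have hloc : ∀ v, |v| < ε → |f (x₀ + v) - f x₀ - d1 * v - d2 * v ^ 2 / 2| ≤ (1 + |d3|) * |v| ^ 3 := by
    intro v hv
    have h1 := hρb (y := x₀ + v) (by
      rw [Real.dist_eq, add_sub_cancel_left]; exact hv.trans_le (min_le_left _ _))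
    rw [hT, add_sub_cancel_left, one_mul, Real.norm_eq_abs, Real.norm_eq_abs, abs_pow] at h1
    have h2 : |v ^ 3 * d3 / 6| ≤ |d3| * |v| ^ 3 := by
      rw [abs_div, abs_mul, abs_pow, abs_of_pos (by norm_num : (0 : ℝ) < 6)]
      have : 0 ≤ |v| ^ 3 * |d3| := by positivity
      linarith
    rw [abs_le] at *
    constructor <;> linarith
  -- Away from `x₀` boundedness of `f` suffices: powers of `|v| / ε ≥ 1` raise every term to the
  -- required order. They explain the denominators in `A` and `A'`.
  have hfar : ∀ v, ε ≤ |v| → 1 ≤ |v| / ε := fun v hv => (one_le_div hε0).2 hv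
  have hdiff : ∀ v, |f (x₀ + v) - f x₀| ≤ 2 * C₀ := fun v => by
    have := hb (x₀ + v)
    have := hb x₀
    rw [abs_le] at *; constructor <;> linarith
  set A := 2 * C₀ / ε ^ 3 + |d1| / ε ^ 2 + |d2| / ε + 1 + |d3| with hA
  set A' := 2 * C₀ / ε + |d1| + |d2| + 1 + |d3| with hA'
  have hA0 : 0 ≤ A := by positivity
  have hA0' : 0 ≤ A' := by positivity
  refine ⟨A + A', by positivity, d1, fun v => ?_, fun v => ?_⟩
  · have hv0 := abs_nonneg v
    have key : |f (x₀ + v) - f x₀| ≤ A' * |v| := by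
      rcases lt_or_ge |v| ε with hv | hv
      · have h1 := hloc v hv
        have hv1 : |v| ≤ 1 := hv.le.trans (min_le_right _ _)
        have h2 : |d1 * v + d2 * v ^ 2 / 2| ≤ |d1| * |v| + |d2| * |v| := by
          refine (abs_add_le _ _).trans (add_le_add (abs_mul _ _).le ?_)
          rw [abs_div, abs_mul, abs_pow, abs_of_pos (by norm_num : (0 : ℝ) < 2)]
          have h3 : |v| ^ 2 ≤ |v| := by nlinarith
          nlinarith [abs_nonneg d2, mul_nonneg (abs_nonneg d2) (sq_nonneg |v|),
            mul_le_mul_of_nonneg_left h3 (abs_nonneg d2)]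
        have h4 : |v| ^ 3 ≤ |v| := by
          have := pow_le_pow_of_le_one hv0 hv1 (show 1 ≤ 3 by norm_num)
          simpa using this
        have h5 := mul_le_mul_of_nonneg_left h4 (by positivity : 0 ≤ 1 + |d3|)
        have h6 : 0 ≤ 2 * C₀ / ε * |v| := by positivity
        have h7 : f (x₀ + v) - f x₀ = (f (x₀ + v) - f x₀ - d1 * v - d2 * v ^ 2 / 2)
            + (d1 * v + d2 * v ^ 2 / 2) := by ring
        rw [h7]
        refine (abs_add_le _ _).trans ((add_le_add h1 h2).trans ?_)
        rw [hA']; nlinarith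
      · refine (hdiff v).trans ?_
        have h1 : 2 * C₀ ≤ 2 * C₀ * (|v| / ε) :=
          le_mul_of_one_le_right (by positivity) (hfar v hv)
        have h2 : 0 ≤ (|d1| + |d2| + 1 + |d3|) * |v| := by positivity
        have h3 : 2 * C₀ * (|v| / ε) = 2 * C₀ / ε * |v| := by ring
        rw [hA']; nlinarith
    nlinarith [mul_nonneg hA0 hv0]
  · have hv0 := abs_nonneg v
    have key : |f (x₀ + v) - f x₀ - d1 * v - d2 * v ^ 2 / 2| ≤ A * |v| ^ 3 := by
      rcases lt_or_ge |v| ε with hv | hv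
      · refine (hloc v hv).trans ?_
        have : 0 ≤ (2 * C₀ / ε ^ 3 + |d1| / ε ^ 2 + |d2| / ε) * |v| ^ 3 := by positivity
        rw [hA]; nlinarith
      · have hr1 := hfar v hv
        have hr0 : 0 ≤ |v| / ε := by positivity
        have h1 : 2 * C₀ ≤ 2 * C₀ * (|v| / ε) ^ 3 :=
          le_mul_of_one_le_right (by positivity) (one_le_pow₀ hr1)
        have h2 : |d1| * |v| ≤ |d1| * |v| * (|v| / ε) ^ 2 :=
          le_mul_of_one_le_right (by positivity) (one_le_pow₀ hr1)
        have h3 : |d2| * |v| ^ 2 / 2 ≤ |d2| * |v| ^ 2 * (|v| / ε) := by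
          have := le_mul_of_one_le_right (by positivity : 0 ≤ |d2| * |v| ^ 2) hr1
          have : 0 ≤ |d2| * |v| ^ 2 := by positivity
          linarith
        have h4 : |f (x₀ + v) - f x₀ - d1 * v - d2 * v ^ 2 / 2| ≤
            2 * C₀ + |d1| * |v| + |d2| * |v| ^ 2 / 2 := by
          refine (abs_sub _ _).trans (add_le_add ((abs_sub _ _).trans
            (add_le_add (hdiff v) (abs_mul _ _).le)) (le_of_eq ?_))
          rw [abs_div, abs_mul, abs_pow, abs_of_pos (by norm_num : (0 : ℝ) < 2)]
        have h5 : 0 ≤ (1 + |d3|) * |v| ^ 3 := by positivity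
        have h6 : 2 * C₀ * (|v| / ε) ^ 3 + |d1| * |v| * (|v| / ε) ^ 2
            + |d2| * |v| ^ 2 * (|v| / ε)
            = (2 * C₀ / ε ^ 3 + |d1| / ε ^ 2 + |d2| / ε) * |v| ^ 3 := by
          field_simp
        rw [hA]; nlinarith
    have : 0 ≤ A' * |v| ^ 3 := by positivity
    nlinarith

end Taylor

/-! ### Stationarity, marginal densities and pair densities -/

section Stationary

variable {Ω : Type*} [mΩ : MeasurableSpace Ω] {P : Measure Ω} {X : ℤ → Ω → ℝ}

lemma StrictlyStationary.integral_comp (hstat : StrictlyStationary P X) {ψ : ℝ → ℝ}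
    (hψ : Measurable ψ) (i : ℤ) : ∫ ω, ψ (X i ω) ∂P = ∫ ω, ψ (X 1 ω) ∂P := by
  have h := ((hstat (i - 1)).comp (hψ.comp (measurable_pi_apply (1 : ℤ)))).integral_eq
  simp only [Function.comp_def, add_sub_cancel] at h
  exact h.symm

lemma StrictlyStationary.integral_comp_pair (hstat : StrictlyStationary P X) {ψ : ℝ → ℝ}
    (hψ : Measurable ψ) (j r : ℤ) :
    ∫ ω, ψ (X j ω) * ψ (X (r + j) ω) ∂P = ∫ ω, ψ (X 0 ω) * ψ (X r ω) ∂P := by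
  have hm : Measurable fun x : ℤ → ℝ => ψ (x 0) * ψ (x r) :=
    (hψ.comp (measurable_pi_apply 0)).mul (hψ.comp (measurable_pi_apply r))
  have h := ((hstat j).comp hm).integral_eq
  simp only [Function.comp_def, zero_add] at h
  exact h.symm

lemma IsDensity.integral_comp_affine {Y : Ω → ℝ} (hY : Measurable Y) {f : ℝ → ℝ}
    (hf : IsDensity P Y f) {ψ : ℝ → ℝ} (hψ : Measurable ψ) (x₀ : ℝ) {h : ℝ} (hh : 0 < h) :
    ∫ ω, ψ ((Y ω - x₀) / h) ∂P = h * ∫ u, ψ u * f (x₀ + h * u) := by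
  obtain ⟨hfm, hf0, hmap⟩ := hf
  have hm : Measurable fun x : ℝ => ψ ((x - x₀) / h) := by fun_prop
  have e1 := integral_map (μ := P) hY.aemeasurable (f := fun x : ℝ => ψ ((x - x₀) / h))
    hm.aestronglyMeasurable
  rw [← e1, hmap, integral_withDensity_eq_integral_toReal_smul hfm.ennreal_ofReal
    (ae_of_all _ fun _ => ENNReal.ofReal_lt_top)]
  simp only [ENNReal.toReal_ofReal (hf0 _), smul_eq_mul]
  have e2 := Measure.integral_comp_mul_left (fun v => ψ (v / h) * f (x₀ + v)) h
  rw [abs_of_pos (inv_pos.2 hh), smul_eq_mul] at e2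
  have e3 : ∀ u, ψ (h * u / h) = ψ u := fun u => by rw [mul_div_cancel_left₀ _ hh.ne']
  simp only [e3] at e2
  rw [e2, mul_inv_cancel_left₀ hh.ne']
  rw [← integral_add_left_eq_self (fun x => f x * ψ ((x - x₀) / h)) x₀]
  congr 1 with v
  rw [add_sub_cancel_left, mul_comm]

/-- The constant is uniform in the lag `r`. For `ψ = K((· - x₀)/h)` the integral is `h`, so this is
the `O(h²)` half of the covariance bound. -/
lemma BoundedJointDensities.exists_pair_bound (hX : ∀ i, Measurable (X i))
    (hjoint : BoundedJointDensities P X) :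
    ∃ C : ℝ, 0 ≤ C ∧ ∀ r : ℕ, 1 ≤ r → ∀ ψ : ℝ → ℝ, Measurable ψ → (∀ x, 0 ≤ ψ x) →
      Integrable ψ → ∫ ω, ψ (X 0 ω) * ψ (X r ω) ∂P ≤ C * (∫ x, ψ x) ^ 2 := by
  obtain ⟨C, hC⟩ := hjoint 1 le_rfl
  refine ⟨max C 0, le_max_right _ _, fun r hr ψ hψ hψ0 hψi => ?_⟩
  obtain ⟨g, ⟨hgm, hg0, hmap⟩, hgC⟩ := hC ![0, r] (by
    rw [Fin.strictMono_iff_lt_succ]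
    intro i
    fin_cases i
    simpa using Nat.lt_of_succ_le hr) (by simp)
  have hYm : Measurable fun ω (j : Fin (1 + 1)) => X ((![0, r] j : ℕ) : ℤ) ω :=
    measurable_pi_lambda _ fun j => hX _
  have hm : Measurable fun x : Fin (1 + 1) → ℝ => ∏ j, ψ (x j) :=
    Finset.measurable_fun_prod _ fun j _ => hψ.comp (measurable_pi_apply j)
  have e1 := integral_map (μ := P) hYm.aemeasurable
    (f := fun x : Fin (1 + 1) → ℝ => ∏ j, ψ (x j)) hm.aestronglyMeasurable
  have e2 : ∫ ω, ψ (X 0 ω) * ψ (X r ω) ∂P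
      = ∫ ω, ∏ j : Fin (1 + 1), ψ (X ((![0, r] j : ℕ) : ℤ) ω) ∂P := by
    congr 1 with ω
    simp [Fin.prod_univ_succ]
  have hint : Integrable (fun x : Fin (1 + 1) → ℝ => ∏ j, ψ (x j)) :=
    Integrable.fintype_prod (f := fun _ : Fin (1 + 1) => ψ) fun _ => hψi
  have e3 : ∫ x : Fin (1 + 1) → ℝ, ∏ j, ψ (x j) = (∫ x, ψ x) ^ 2 := by
    rw [integral_fintype_prod_volume_eq_prod (fun _ : Fin (1 + 1) => ψ)]
    simp
  rw [e2, ← e1, hmap, integral_withDensity_eq_integral_toReal_smul hgm.ennreal_ofReal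
    (ae_of_all _ fun _ => ENNReal.ofReal_lt_top), ← e3, ← integral_const_mul]
  simp only [ENNReal.toReal_ofReal (hg0 _), smul_eq_mul]
  have hp : ∀ x : Fin (1 + 1) → ℝ, 0 ≤ ∏ j, ψ (x j) :=
    fun x => Finset.prod_nonneg fun j _ => hψ0 _
  exact integral_mono_of_nonneg (ae_of_all _ fun x => mul_nonneg (hg0 x) (hp x))
    (hint.const_mul _) (ae_of_all _ fun x =>
      mul_le_mul_of_nonneg_right ((hgC x).trans (le_max_left _ _)) (hp x))

end Stationary

/-! ### Weak dependence of the centred kernels -/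

section Mixing

lemma pastSigma_le {Ω : Type*} {mΩ : MeasurableSpace Ω} {X : ℤ → Ω → ℝ}
    (hX : ∀ i, Measurable (X i)) (k : ℤ) : pastSigma X k ≤ mΩ :=
  iSup₂_le fun i _ => (hX i).comap_le

lemma futureSigma_le {Ω : Type*} {mΩ : MeasurableSpace Ω} {X : ℤ → Ω → ℝ}
    (hX : ∀ i, Measurable (X i)) (k : ℤ) : futureSigma X k ≤ mΩ :=
  iSup₂_le fun i _ => (hX i).comap_le

lemma measurable_pastSigma {Ω : Type*} (X : ℤ → Ω → ℝ) (k : ℤ) :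
    Measurable[pastSigma X k] (X k) :=
  measurable_iff_comap_le.2 (le_iSup₂_of_le k le_rfl le_rfl)

lemma measurable_futureSigma {Ω : Type*} (X : ℤ → Ω → ℝ) (k : ℤ) :
    Measurable[futureSigma X k] (X k) :=
  measurable_iff_comap_le.2 (le_iSup₂_of_le k le_rfl le_rfl)

lemma pastSigma_mono {Ω : Type*} (X : ℤ → Ω → ℝ) : Monotone (pastSigma X) :=
  fun _ _ hkl => iSup₂_le fun i hi => le_iSup₂_of_le i (hi.trans hkl) le_rfl

lemma futureSigma_anti {Ω : Type*} (X : ℤ → Ω → ℝ) : Antitone (futureSigma X) :=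
  fun _ _ hkl => iSup₂_le fun i hi => le_iSup₂_of_le i (hkl.trans hi) le_rfl

lemma alphaCoeff_le_alphaMixing {Ω : Type*} [mΩ : MeasurableSpace Ω] {P : Measure Ω}
    [IsProbabilityMeasure P] (X : ℤ → Ω → ℝ) (k : ℤ) (t : ℕ) :
    alphaCoeff P (pastSigma X k) (futureSigma X (k + t)) ≤ alphaMixing P X t :=
  le_ciSup (f := fun k : ℤ => alphaCoeff P (pastSigma X k) (futureSigma X (k + t)))
    ⟨1, by rintro _ ⟨k, rfl⟩; exact alphaCoeff_le_one _ _⟩ k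

variable {Ω : Type*} [mΩ : MeasurableSpace Ω] {P : Measure Ω} {X : ℤ → Ω → ℝ}

/-- `K((X_{i+1} - x₀)/h) - E K((X_1 - x₀)/h)`. -/
noncomputable def centredKernel (P : Measure Ω) (X : ℤ → Ω → ℝ) (K : ℝ → ℝ) (x₀ h : ℝ) (i : ℕ)
    (ω : Ω) : ℝ :=
  K ((X (i + 1 : ℕ) ω - x₀) / h) - ∫ ω, K ((X 1 ω - x₀) / h) ∂P

lemma IsKernel.exists_bound {K : ℝ → ℝ} (hK : IsKernel K) : ∃ B, 0 < B ∧ ∀ u, |K u| ≤ B := by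
  obtain ⟨B, hB⟩ := hK.bounded
  refine ⟨|B| + 1, by positivity, fun u => ?_⟩
  rw [abs_of_nonneg (hK.nonneg u)]
  linarith [hB u, le_abs_self B]

/-- Two bounds for the same covariance: bounded pair densities give `O(h²)` at every lag, and the
mixing inequality gives `O(r^(-β))`. The constant `Q` does not depend on `h`. -/
lemma weaklyDependent_centredKernel [IsProbabilityMeasure P] (hX : ∀ i, Measurable (X i))
    (hstat : StrictlyStationary P X) {β : ℝ}
    (hmix : (fun t : ℕ => alphaMixing P X t) =O[atTop] (fun t : ℕ => (t : ℝ) ^ (-β)))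
    {f : ℝ → ℝ} (hf : IsDensity P (X 1) f) {Cf : ℝ} (hCf : ∀ x, |f x| ≤ Cf)
    (hjoint : BoundedJointDensities P X) (x₀ : ℝ) {K : ℝ → ℝ} (hK : IsKernel K) {B : ℝ}
    (hB : ∀ u, |K u| ≤ B) :
    ∃ Q : ℝ, 0 ≤ Q ∧ ∀ h : ℝ, 0 < h → WeaklyDependent P (centredKernel P X K x₀ h)
      (fun i => pastSigma X (i + 1 : ℕ)) (fun i => futureSigma X (i + 1 : ℕ)) B (2 * Cf * h)
      (fun r => Q * min (h ^ 2) ((r : ℝ) ^ (-β))) := by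
  obtain ⟨C₂, hC₂, hpair⟩ := hjoint.exists_pair_bound hX
  -- On `ℕ` the bound holds at every lag with `t^(-β) ≠ 0`, not just eventually. All lags `k - j ≥
  -- 1` are therefore covered.
  obtain ⟨Cα, hCα, hα⟩ := bound_of_isBigO_nat_atTop hmix
  have hB0 : 0 ≤ B := (abs_nonneg _).trans (hB 0)
  have hCf0 : 0 ≤ Cf := (abs_nonneg _).trans (hCf 0)
  -- In `7 Cf²`, three come from the mean terms when `(W + m)(W' + m)` is expanded, and four from
  -- the product of the first absolute moments.
  set Q := max (C₂ + 7 * Cf ^ 2) (4 * B * B * Cα) with hQ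
  have hQ0 : 0 ≤ Q := le_max_of_le_left (by positivity)
  refine ⟨Q, hQ0, fun h hh => ?_⟩
  set W : ℤ → Ω → ℝ := fun i ω => K ((X i ω - x₀) / h) with hW
  set m := ∫ ω, K ((X 1 ω - x₀) / h) ∂P with hm
  have hψ : Measurable fun x : ℝ => K ((x - x₀) / h) := by
    have := hK.measurable; fun_prop
  have hWb : ∀ i, BddMeas (W i) := fun i => ⟨hψ.comp (hX i), B, fun ω => hB _⟩
  have hW0 : ∀ i ω, 0 ≤ W i ω := fun i ω => hK.nonneg _
  have hWm : ∀ i, ∫ ω, W i ω ∂P = m := fun i => hstat.integral_comp hψ i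
  have hm0 : 0 ≤ m := integral_nonneg fun ω => hK.nonneg _
  have hmh : m ≤ Cf * h := by
    rw [hm, hf.integral_comp_affine (hX 1) hK.measurable x₀ hh, mul_comm Cf]
    refine mul_le_mul_of_nonneg_left ?_ hh.le
    have : ∫ u, K u * Cf = Cf := by rw [integral_mul_const, hK.integral_eq_one, one_mul]
    rw [← this]
    exact integral_mono_of_nonneg (ae_of_all _ fun u => mul_nonneg (hK.nonneg u) (hf.2.1 _))
      (hK.integrable.mul_const _) (ae_of_all _ fun u =>
        mul_le_mul_of_nonneg_left ((le_abs_self _).trans (hCf _)) (hK.nonneg u))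
  have hZW : ∀ i : ℕ, centredKernel P X K x₀ h i = fun ω => W (i + 1 : ℕ) ω - m := fun i => rfl
  have hmeasP : ∀ i : ℕ, Measurable[pastSigma X (i + 1 : ℕ)] (centredKernel P X K x₀ h i) :=
    fun i => (hψ.comp (measurable_pastSigma X _)).sub_const m
  have hmeasF : ∀ i : ℕ, Measurable[futureSigma X (i + 1 : ℕ)] (centredKernel P X K x₀ h i) :=
    fun i => (hψ.comp (measurable_futureSigma X _)).sub_const m
  have hZb : ∀ (i : ℕ) ω, |centredKernel P X K x₀ h i ω| ≤ B := by
    intro i ω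
    have h1 : W (i + 1 : ℕ) ω ≤ B := (le_abs_self _).trans (hB _)
    have h2 := hW0 (i + 1 : ℕ) ω
    have h3 : m ≤ B := by
      have : ∫ _ω : Ω, B ∂P = B := by simp
      rw [← this]
      exact integral_mono (hWb 1).integrable (integrable_const B)
        fun ω => (le_abs_self _).trans (hB _)
    rw [hZW]
    simp only
    rw [abs_le]; constructor <;> linarith
  have hZle : ∀ (i : ℕ) ω, |centredKernel P X K x₀ h i ω| ≤ W (i + 1 : ℕ) ω + m := by
    intro i ω
    have h2 := hW0 (i + 1 : ℕ) ω
    rw [hZW]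
    simp only
    rw [abs_le]; constructor <;> linarith
  have hZB : ∀ i : ℕ, BddMeas (centredKernel P X K x₀ h i) := fun i => by
    rw [hZW]; exact (hWb _).sub (BddMeas.const m)
  have hfirst : ∀ i : ℕ, ∫ ω, |centredKernel P X K x₀ h i ω| ∂P ≤ 2 * Cf * h := by
    intro i
    have h1 := integral_mono (μ := P) (hZB i).abs.integrable
      ((hWb (i + 1 : ℕ)).add (BddMeas.const m)).integrable (hZle i)
    rw [integral_add (hWb _).integrable (integrable_const m), hWm] at h1
    simp only [integral_const, probReal_univ, one_smul] at h1
    linarith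
  refine ⟨fun i => pastSigma_le hX _, fun i j hij => pastSigma_mono X (by exact_mod_cast by omega),
    fun i => futureSigma_le hX _, fun i j hij => futureSigma_anti X (by exact_mod_cast by omega),
    hmeasP, hmeasF, hZb, fun i => ?_, hfirst, fun r => by positivity, ?_⟩
  · rw [hZW]
    simp only
    rw [integral_sub (hWb _).integrable (integrable_const m), hWm]
    simp
  · intro j k hjk U V hU hV hUZ hVZ
    have hUb : BddMeas U := ⟨hU.mono (pastSigma_le hX _) le_rfl, B, fun ω => (hUZ ω).trans (hZb j ω)⟩
    have hVb : BddMeas V :=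
      ⟨hV.mono (futureSigma_le hX _) le_rfl, B, fun ω => (hVZ ω).trans (hZb k ω)⟩
    have hr : 1 ≤ k - j := by omega
    rw [mul_min_of_nonneg _ _ hQ0]
    refine le_min ?_ ?_
    · have h1 : ∫ ω, W (j + 1 : ℕ) ω * W (k + 1 : ℕ) ω ∂P ≤ C₂ * h ^ 2 := by
        have e1 := hstat.integral_comp_pair hψ (j + 1 : ℕ) (k - j : ℕ)
        have e2 : ((k - j : ℕ) : ℤ) + ((j + 1 : ℕ) : ℤ) = ((k + 1 : ℕ) : ℤ) := by
          exact_mod_cast by omega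
        rw [e2] at e1
        have hψi : Integrable fun x : ℝ => K ((x - x₀) / h) :=
          (hK.integrable.comp_div hh.ne').comp_sub_right x₀
        have e3 : ∫ x, K ((x - x₀) / h) = h := by
          rw [integral_sub_right_eq_self (fun x => K (x / h)) x₀, Measure.integral_comp_div,
            hK.integral_eq_one, abs_of_pos hh, smul_eq_mul, mul_one]
        have e4 := hpair (k - j) hr _ hψ (fun x => hK.nonneg _) hψi
        rw [e3] at e4
        exact e1.le.trans e4
      have h2 : ∫ ω, |U ω * V ω| ∂P ≤ C₂ * h ^ 2 + 3 * m ^ 2 := by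
        have h3 := integral_mono (μ := P) (hUb.mul hVb).abs.integrable
          (((((hWb (j + 1 : ℕ)).mul (hWb (k + 1 : ℕ))).add
            ((BddMeas.const m).mul (hWb (j + 1 : ℕ)))).add
            ((BddMeas.const m).mul (hWb (k + 1 : ℕ)))).add (BddMeas.const (m ^ 2))).integrable
          (fun ω => by
            have := mul_le_mul ((hUZ ω).trans (hZle j ω)) ((hVZ ω).trans (hZle k ω))
              (abs_nonneg _) (add_nonneg (hW0 _ _) hm0)
            rw [← abs_mul] at this
            refine this.trans (le_of_eq ?_)
            ring)
        rw [integral_add ((((hWb (j + 1 : ℕ)).mul (hWb (k + 1 : ℕ))).add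
            ((BddMeas.const m).mul (hWb (j + 1 : ℕ)))).add
            ((BddMeas.const m).mul (hWb (k + 1 : ℕ)))).integrable (integrable_const _),
          integral_add (((hWb (j + 1 : ℕ)).mul (hWb (k + 1 : ℕ))).add
            ((BddMeas.const m).mul (hWb (j + 1 : ℕ)))).integrable
            ((BddMeas.const m).mul (hWb (k + 1 : ℕ))).integrable,
          integral_add ((hWb (j + 1 : ℕ)).mul (hWb (k + 1 : ℕ))).integrable
            ((BddMeas.const m).mul (hWb (j + 1 : ℕ))).integrable,
          integral_const_mul, integral_const_mul, hWm, hWm] at h3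
        simp only [integral_const, probReal_univ, one_smul] at h3
        linarith
      have h4 : ∀ (T : Ω → ℝ) (i : ℕ), BddMeas T → (∀ ω, |T ω| ≤ |centredKernel P X K x₀ h i ω|) →
          |∫ ω, T ω ∂P| ≤ 2 * (Cf * h) := fun T i hT hTi => by
        refine abs_integral_le_integral_abs.trans
          ((integral_mono (μ := P) hT.abs.integrable (hZB i).abs.integrable hTi).trans ?_)
        linarith [hfirst i]
      have h5 : |covInt P U V| ≤ (C₂ * h ^ 2 + 3 * m ^ 2) + (2 * (Cf * h)) * (2 * (Cf * h)) := by
        rw [covInt]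
        refine (abs_sub _ _).trans (add_le_add (abs_integral_le_integral_abs.trans h2) ?_)
        rw [abs_mul]
        exact mul_le_mul (h4 U j hUb hUZ) (h4 V k hVb hVZ) (abs_nonneg _) (by positivity)
      have h6 : m ^ 2 ≤ (Cf * h) ^ 2 := pow_le_pow_left₀ hm0 hmh 2
      calc |covInt P U V| ≤ (C₂ + 7 * Cf ^ 2) * h ^ 2 := by nlinarith
        _ ≤ Q * h ^ 2 := mul_le_mul_of_nonneg_right (le_max_left _ _) (sq_nonneg h)
    · have h1 := abs_covInt_le_alphaCoeff (P := P) (pastSigma_le hX _) (futureSigma_le hX _) hU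
        (fun ω => (hUZ ω).trans (hZb j ω)) hV (fun ω => (hVZ ω).trans (hZb k ω))
      have e2 : ((k + 1 : ℕ) : ℤ) = ((j + 1 : ℕ) : ℤ) + ((k - j : ℕ) : ℤ) := by
        exact_mod_cast by omega
      have h2 := alphaCoeff_le_alphaMixing (P := P) X ((j + 1 : ℕ) : ℤ) (k - j)
      rw [← e2] at h2
      have hr0 : (0 : ℝ) < ((k - j : ℕ) : ℝ) := by exact_mod_cast hr
      have h3 := hα (x := k - j) (Real.rpow_pos_of_pos hr0 _).ne'
      rw [Real.norm_eq_abs, Real.norm_of_nonneg (Real.rpow_nonneg hr0.le _)] at h3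
      have h4 := (h2.trans (le_abs_self _)).trans h3
      calc |covInt P U V| ≤ 4 * B * B * (Cα * ((k - j : ℕ) : ℝ) ^ (-β)) :=
            h1.trans (mul_le_mul_of_nonneg_left h4 (by positivity))
        _ = (4 * B * B * Cα) * ((k - j : ℕ) : ℝ) ^ (-β) := by ring
        _ ≤ _ := mul_le_mul_of_nonneg_right (le_max_right _ _) (Real.rpow_nonneg hr0.le _)

end Mixing

/-! ### Moments of the kernel and expansion of the mean -/

section KernelMoments

variable {K f : ℝ → ℝ} {x₀ Cf : ℝ}

lemma IsKernel.integrable_abs_mul (hK : IsKernel K) : Integrable fun u => |u| * K u := by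
  refine (hK.integrable.add hK.integrable_second).mono'
    (continuous_abs.measurable.mul hK.measurable).aestronglyMeasurable (ae_of_all _ fun u => ?_)
  have h0 := hK.nonneg u
  rw [Real.norm_of_nonneg (mul_nonneg (abs_nonneg u) h0)]
  simp only [Pi.add_apply]
  have : |u| ≤ 1 + u ^ 2 := by nlinarith [sq_abs u, sq_nonneg (|u| - 1)]
  nlinarith

lemma IsKernel.integrable_mul (hK : IsKernel K) : Integrable fun u => u * K u := by
  refine hK.integrable_abs_mul.mono' (measurable_id.mul hK.measurable).aestronglyMeasurable
    (ae_of_all _ fun u => ?_)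
  simp only [norm_mul, Real.norm_eq_abs, abs_of_nonneg (hK.nonneg u)]
  exact le_rfl

lemma IsKernel.integral_mul_eq_zero (hK : IsKernel K) : ∫ u, u * K u = 0 := by
  have h := integral_neg_eq_self (fun u => u * K u) (volume : Measure ℝ)
  simp only [hK.symm, neg_mul, integral_neg] at h
  linarith

lemma IsKernel.integrable_abs_mul_sq (hK : IsKernel K) : Integrable fun u => |u| * K u ^ 2 := by
  obtain ⟨B, -, hB⟩ := hK.exists_bound
  refine (hK.integrable_abs_mul.const_mul B).mono'
    (continuous_abs.measurable.mul (hK.measurable.pow_const 2)).aestronglyMeasurable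
    (ae_of_all _ fun u => ?_)
  have h0 := hK.nonneg u
  have h1 : K u ≤ B := (le_abs_self _).trans (hB u)
  rw [Real.norm_of_nonneg (by positivity)]
  have := mul_nonneg (abs_nonneg u) h0
  nlinarith

lemma IsKernel.kernelNu2_pos (hK : IsKernel K) : 0 < kernelNu2 K := by
  have h0 : 0 ≤ᵐ[volume] fun u => K u ^ 2 := ae_of_all _ fun u => sq_nonneg _
  refine (integral_nonneg_of_ae h0).lt_of_ne fun h => ?_
  have h1 := (integral_eq_zero_iff_of_nonneg_ae h0 hK.integrable_sq).1 h.symm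
  have h2 : ∫ u, K u = 0 := integral_eq_zero_of_ae (h1.mono fun u hu => by simpa using hu)
  rw [hK.integral_eq_one] at h2
  exact one_ne_zero h2

lemma integrable_mul_comp_affine {G : ℝ → ℝ} (hG : Integrable G) (hf : Measurable f)
    (hCf : ∀ x, |f x| ≤ Cf) (x₀ h : ℝ) : Integrable fun u => G u * f (x₀ + h * u) :=
  hG.mul_bdd (hf.comp (by fun_prop : Measurable fun u => x₀ + h * u)).aestronglyMeasurable
    (ae_of_all _ fun u => hCf _)

/-- Integrate the Taylor bound at `h u` against `K`. Symmetry removes the linear term, and the third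
absolute moment of `K` controls the remainder. -/
lemma kernel_mean_expansion (hK : IsKernel K) (hf : Measurable f) (hCf : ∀ x, |f x| ≤ Cf)
    {C d d₂ : ℝ} (hT : ∀ v, |f (x₀ + v) - f x₀ - d * v - d₂ * v ^ 2 / 2| ≤ C * |v| ^ 3)
    {h : ℝ} (hh : 0 < h) :
    |(∫ u, K u * f (x₀ + h * u)) - f x₀ - h ^ 2 * d₂ * kernelMu2 K / 2| ≤
      C * (∫ u, |u| ^ 3 * K u) * h ^ 3 := by
  have hi := integrable_mul_comp_affine hK.integrable hf hCf x₀ h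
  have i1 := hK.integrable.const_mul (f x₀)
  have i2 := hK.integrable_mul.const_mul (d * h)
  have i3 := hK.integrable_second.const_mul (h ^ 2 * d₂ / 2)
  have e1 : (∫ u, K u * f (x₀ + h * u)) - f x₀ - h ^ 2 * d₂ * kernelMu2 K / 2
      = ∫ u, K u * (f (x₀ + h * u) - f x₀ - d * (h * u) - d₂ * (h * u) ^ 2 / 2) := by
    have : ∀ u, K u * (f (x₀ + h * u) - f x₀ - d * (h * u) - d₂ * (h * u) ^ 2 / 2)
        = K u * f (x₀ + h * u) - f x₀ * K u - d * h * (u * K u)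
          - h ^ 2 * d₂ / 2 * (u ^ 2 * K u) := fun u => by ring
    simp only [this]
    have i4 : Integrable fun u => K u * f (x₀ + h * u) - f x₀ * K u := hi.sub i1
    have i5 : Integrable fun u => K u * f (x₀ + h * u) - f x₀ * K u - d * h * (u * K u) :=
      i4.sub i2
    rw [integral_sub i5 i3, integral_sub i4 i2, integral_sub hi i1,
      integral_const_mul, integral_const_mul, integral_const_mul, hK.integral_eq_one,
      hK.integral_mul_eq_zero, kernelMu2]
    ring
  rw [e1]
  have e2 : C * (∫ u, |u| ^ 3 * K u) * h ^ 3 = ∫ u, C * h ^ 3 * (|u| ^ 3 * K u) := by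
    rw [integral_const_mul]; ring
  rw [e2]
  refine abs_integral_le_integral_abs.trans (integral_mono_of_nonneg
    (ae_of_all _ fun u => abs_nonneg _) (hK.integrable_third.const_mul _)
    (ae_of_all _ fun u => ?_))
  have := mul_le_mul_of_nonneg_left (hT (h * u)) (hK.nonneg u)
  rw [abs_mul h, abs_of_pos hh] at this
  simp only
  rw [abs_mul, abs_of_nonneg (hK.nonneg u)]
  refine this.trans (le_of_eq ?_)
  ring

lemma kernel_sq_expansion (hK : IsKernel K) (hf : Measurable f) (hCf : ∀ x, |f x| ≤ Cf)
    {C : ℝ} (hT : ∀ v, |f (x₀ + v) - f x₀| ≤ C * |v|) {h : ℝ} (hh : 0 < h) :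
    |(∫ u, K u ^ 2 * f (x₀ + h * u)) - f x₀ * kernelNu2 K| ≤ C * (∫ u, |u| * K u ^ 2) * h := by
  have hi := integrable_mul_comp_affine hK.integrable_sq hf hCf x₀ h
  have e1 : (∫ u, K u ^ 2 * f (x₀ + h * u)) - f x₀ * kernelNu2 K
      = ∫ u, K u ^ 2 * (f (x₀ + h * u) - f x₀) := by
    simp only [mul_sub]
    rw [integral_sub hi (hK.integrable_sq.mul_const _), integral_mul_const, kernelNu2, mul_comm]
  have e2 : C * (∫ u, |u| * K u ^ 2) * h = ∫ u, C * h * (|u| * K u ^ 2) := by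
    rw [integral_const_mul]; ring
  rw [e1, e2]
  refine abs_integral_le_integral_abs.trans (integral_mono_of_nonneg
    (ae_of_all _ fun u => abs_nonneg _) (hK.integrable_abs_mul_sq.const_mul _)
    (ae_of_all _ fun u => ?_))
  have := mul_le_mul_of_nonneg_left (hT (h * u)) (sq_nonneg (K u))
  rw [abs_mul h, abs_of_pos hh] at this
  simp only
  rw [abs_mul, abs_of_nonneg (sq_nonneg (K u))]
  refine this.trans (le_of_eq ?_)
  ring

end KernelMoments

/-! ### Variance increments -/

section Variance

lemma sum_reflect_le_range {a : ℕ → ℝ} (ha : ∀ m, 0 ≤ a m) (k : ℕ) :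
    ∑ i ∈ Finset.range k, a (k - i) ≤ ∑ m ∈ Finset.range (k + 1), a m := by
  rw [Finset.sum_range_succ', ← Finset.sum_range_reflect (fun m => a (m + 1))]
  have : ∑ i ∈ Finset.range k, a (k - i) = ∑ i ∈ Finset.range k, a (k - 1 - i + 1) := by
    refine Finset.sum_congr rfl fun i hi => ?_
    have := Finset.mem_range.1 hi
    congr 1; omega
  rw [this]
  linarith [ha 0]

variable {Ω : Type*} [mΩ : MeasurableSpace Ω] {P : Measure Ω}

lemma WeaklyDependent.abs_varIncr_sub_le [IsProbabilityMeasure P] {Z : ℕ → Ω → ℝ}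
    {F G : ℕ → MeasurableSpace Ω} {B e : ℝ} {a : ℕ → ℝ} (hZ : WeaklyDependent P Z F G B e a)
    (k : ℕ) :
    |varIncr P Z k - ∫ ω, Z k ω ^ 2 ∂P| ≤ 2 * ∑ m ∈ Finset.range (k + 1), a m := by
  rw [varIncr, add_sub_cancel_left, abs_mul, abs_of_pos two_pos]
  refine mul_le_mul_of_nonneg_left ?_ two_pos.le
  refine ((Finset.abs_sum_le_sum_abs _ _).trans (Finset.sum_le_sum fun i hi => ?_)).trans
    (sum_reflect_le_range hZ.nonneg k)
  exact hZ.abs_covariance_le (Finset.mem_range.1 hi)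

lemma integral_centredKernel_sq [IsProbabilityMeasure P] {X : ℤ → Ω → ℝ}
    (hX : ∀ i, Measurable (X i)) (hstat : StrictlyStationary P X) {K : ℝ → ℝ} (hK : IsKernel K)
    (x₀ h : ℝ) (k : ℕ) :
    ∫ ω, centredKernel P X K x₀ h k ω ^ 2 ∂P
      = ∫ ω, K ((X 1 ω - x₀) / h) ^ 2 ∂P - (∫ ω, K ((X 1 ω - x₀) / h) ∂P) ^ 2 := by
  obtain ⟨B, -, hB⟩ := hK.exists_bound
  have hψ : Measurable fun x : ℝ => K ((x - x₀) / h) := by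
    have := hK.measurable; fun_prop
  have hWb : BddMeas fun ω => K ((X (k + 1 : ℕ) ω - x₀) / h) :=
    ⟨hψ.comp (hX _), B, fun ω => hB _⟩
  set m := ∫ ω, K ((X 1 ω - x₀) / h) ∂P with hm
  have h1 : ∫ ω, K ((X (k + 1 : ℕ) ω - x₀) / h) ∂P = m := hstat.integral_comp hψ _
  have h2 : ∫ ω, K ((X (k + 1 : ℕ) ω - x₀) / h) ^ 2 ∂P = ∫ ω, K ((X 1 ω - x₀) / h) ^ 2 ∂P :=
    hstat.integral_comp (hψ.pow_const 2) _
  have h3 : BddMeas fun ω => K ((X (k + 1 : ℕ) ω - x₀) / h) ^ 2 := by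
    simpa only [sq] using hWb.mul hWb
  have e : ∀ ω, centredKernel P X K x₀ h k ω ^ 2 = K ((X (k + 1 : ℕ) ω - x₀) / h) ^ 2
      - 2 * m * K ((X (k + 1 : ℕ) ω - x₀) / h) + m ^ 2 := fun ω => by
    simp only [centredKernel]; ring
  simp only [e]
  have h4 := (BddMeas.const (2 * m)).mul hWb
  rw [integral_add (h3.sub h4).integrable (integrable_const _),
    integral_sub h3.integrable h4.integrable, integral_const_mul, h1, h2]
  simp only [integral_const, probReal_univ, one_smul]
  ring

end Variance

/-! ### Normal approximation of the kernel estimator -/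

section NormalApproximation

variable {Ω : Type*} [mΩ : MeasurableSpace Ω] {P : Measure Ω} {X : ℤ → Ω → ℝ}

lemma abs_stdNormalCDF_div_sqrt_sub_le_of_le (c : ℝ) {v w s : ℝ} (hs : 0 < s) (hv : s ≤ v)
    (hw : s ≤ w) : |stdNormalCDF (c / √v) - stdNormalCDF (c / √w)| ≤ |v - w| / s := by
  wlog hvw : v ≤ w generalizing v w
  · rw [abs_sub_comm, abs_sub_comm v]
    exact this hw hv (le_of_not_ge hvw)
  have h := abs_stdNormalCDF_div_sqrt_sub_le c (hs.trans_le hv) (sub_nonneg.2 hvw)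
  rw [add_sub_cancel] at h
  rw [abs_sub_comm, abs_sub_comm v, abs_of_nonneg (sub_nonneg.2 hvw)]
  exact h.trans (div_le_div_of_nonneg_left (sub_nonneg.2 hvw) hs hv)

lemma sum_kernel_eq (P : Measure Ω) (X : ℤ → Ω → ℝ) (K : ℝ → ℝ) (x₀ h : ℝ) (n : ℕ) (ω : Ω) :
    ∑ i ∈ Finset.Icc 1 n, K ((X (i : ℤ) ω - x₀) / h)
      = partialSum (centredKernel P X K x₀ h) n ω + n * ∫ ω, K ((X 1 ω - x₀) / h) ∂P := by
  rw [show Finset.Icc 1 n = Finset.Ico 1 (n + 1) from rfl, Finset.sum_Ico_eq_sum_range]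
  simp only [partialSum, centredKernel, Finset.sum_sub_distrib, Finset.sum_const,
    Finset.card_range, nsmul_eq_mul, Nat.add_sub_cancel, sub_add_cancel]
  refine Finset.sum_congr rfl fun i _ => ?_
  rw [add_comm]

/-- Uniform estimates for the variance increments of the centred kernels. -/
lemma exists_varIncr_bound [IsProbabilityMeasure P] (hX : ∀ i, Measurable (X i))
    (hstat : StrictlyStationary P X) {β : ℝ} (hβ : 2 < β)
    {f : ℝ → ℝ} (hf : IsDensity P (X 1) f) {Cf : ℝ} (hCf : ∀ x, |f x| ≤ Cf)
    {x₀ : ℝ} {K : ℝ → ℝ} (hK : IsKernel K) {B Q : ℝ} (hQ : 0 ≤ Q)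
    {F G : ℕ → MeasurableSpace Ω}
    (hZ : ∀ h : ℝ, 0 < h → WeaklyDependent P (centredKernel P X K x₀ h) F G B (2 * Cf * h)
      (fun r => Q * min (h ^ 2) ((r : ℝ) ^ (-β))))
    {C : ℝ} (hC : 0 ≤ C) (hT : ∀ v, |f (x₀ + v) - f x₀| ≤ C * |v|) :
    ∃ D : ℝ, 0 ≤ D ∧ ∀ h : ℝ, 0 < h → h ≤ 1 → ∀ k,
      |varIncr P (centredKernel P X K x₀ h) k - h * (f x₀ * kernelNu2 K)| ≤
        D * (h * h ^ ((β - 2) / β)) := by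
  have hCf0 : 0 ≤ Cf := (abs_nonneg _).trans (hCf 0)
  set I := ∫ u, |u| * K u ^ 2 with hI
  have hI0 : 0 ≤ I := integral_nonneg fun u => by positivity
  set c₀ := (2 : ℝ) ^ (0 + 1) + 1 / (β - (0 : ℕ) - 1) with hc₀
  have hc0 : 0 ≤ c₀ := by
    have : (0 : ℝ) ≤ 1 / (β - (0 : ℕ) - 1) := by
      rw [Nat.cast_zero]; exact one_div_nonneg.2 (by linarith)
    positivity
  refine ⟨C * I + Cf ^ 2 + 2 * (Q * c₀), by positivity, fun h hh h1 k => ?_⟩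
  set ρ := h ^ ((β - 2) / β) with hρ
  have hρh : h ≤ ρ := by
    have := Real.rpow_le_rpow_of_exponent_ge hh h1
      (show (β - 2) / β ≤ 1 by rw [div_le_one (by linarith)]; linarith)
    rwa [Real.rpow_one] at this
  have e1 := (hZ h hh).abs_varIncr_sub_le k
  rw [integral_centredKernel_sq hX hstat hK, hf.integral_comp_affine (hX 1) hK.measurable x₀ hh,
    hf.integral_comp_affine (hX 1) (hK.measurable.pow_const 2) x₀ hh, ← Finset.mul_sum] at e1
  have e2 := sum_pow_mul_min_le 0 (β := β) (by norm_num; linarith) hh h1 k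
  -- The exponent `2 - 2/β` is `1 + (β-2)/β`, so relative to the leading order `h` the covariances
  -- are `O(h^((β-2)/β))`.
  have e3 : h ^ (2 - 2 * (((0 : ℕ) : ℝ) + 1) / β) = h * ρ := by
    rw [hρ, ← Real.rpow_one_add' hh.le]
    · congr 1; field_simp; push_cast; ring
    · have : 0 < (β - 2) / β := div_pos (by linarith) (by linarith)
      linarith
  simp only [pow_zero, one_mul] at e2
  rw [e3, ← hc₀] at e2
  have e2' := mul_le_mul_of_nonneg_left e2 hQ
  have e4 := kernel_sq_expansion hK hf.1 hCf hT hh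
  set J := ∫ u, K u * f (x₀ + h * u) with hJ
  set J₂ := ∫ u, K u ^ 2 * f (x₀ + h * u) with hJ₂
  have hJCf : |J| ≤ Cf := by
    have : ∫ u, K u * Cf = Cf := by rw [integral_mul_const, hK.integral_eq_one, one_mul]
    rw [← this]
    refine abs_integral_le_integral_abs.trans (integral_mono_of_nonneg
      (ae_of_all _ fun u => abs_nonneg _) (hK.integrable.mul_const _) (ae_of_all _ fun u => ?_))
    simp only [abs_mul, abs_of_nonneg (hK.nonneg u)]
    exact mul_le_mul_of_nonneg_left (hCf _) (hK.nonneg u)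
  have hJ2 : J ^ 2 ≤ Cf ^ 2 := sq_le_sq' (abs_le.1 hJCf).1 (abs_le.1 hJCf).2
  have e5 : |h * J₂ - h * (f x₀ * kernelNu2 K)| ≤ h * (C * I * h) := by
    rw [← mul_sub, abs_mul, abs_of_pos hh]
    exact mul_le_mul_of_nonneg_left e4 hh.le
  have e6 : h * (C * I * h) ≤ C * I * (h * ρ) := by
    have := mul_le_mul_of_nonneg_left hρh (by positivity : 0 ≤ C * I * h)
    linarith
  have e7 : (h * J) ^ 2 ≤ Cf ^ 2 * (h * ρ) := by
    rw [mul_pow]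
    have h2 : h ^ 2 ≤ h * ρ := by rw [sq]; exact mul_le_mul_of_nonneg_left hρh hh.le
    calc h ^ 2 * J ^ 2 ≤ (h * ρ) * Cf ^ 2 := mul_le_mul h2 hJ2 (sq_nonneg _) (by positivity)
      _ = _ := mul_comm _ _
  have e8 := sq_nonneg (h * J)
  rw [abs_le] at *
  constructor <;> linarith

set_option maxHeartbeats 1000000 in
/-- The uniform normal approximation for the partial sums of the centred kernels. -/
lemma exists_partialSum_bound [IsProbabilityMeasure P]
    {β : ℝ} (hβ : 2 < β) {x₀ Cf : ℝ} (hCf : 0 ≤ Cf) {K : ℝ → ℝ} {B Q : ℝ} (hB : 0 ≤ B)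
    (hQ : 0 ≤ Q) {F G : ℕ → MeasurableSpace Ω}
    (hZ : ∀ h : ℝ, 0 < h → WeaklyDependent P (centredKernel P X K x₀ h) F G B (2 * Cf * h)
      (fun r => Q * min (h ^ 2) ((r : ℝ) ^ (-β)))) {w₀ D : ℝ} (hw₀ : 0 < w₀) (hD : 0 ≤ D)
    (hvar : ∀ h : ℝ, 0 < h → h ≤ 1 → ∀ k,
      |varIncr P (centredKernel P X K x₀ h) k - h * w₀| ≤ D * (h * h ^ ((β - 2) / β))) :
    ∃ C : ℝ, 0 ≤ C ∧ ∃ h₀ : ℝ, 0 < h₀ ∧ h₀ ≤ 1 ∧ ∀ (n : ℕ) (h : ℝ), 0 < h → h ≤ h₀ →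
      1 ≤ n * h ^ 3 → ∀ y,
        |P.real {ω | partialSum (centredKernel P X K x₀ h) n ω ≤ √(n * h) * y}
          - stdNormalCDF (y / √w₀)| ≤ C * ((n * h) ^ (-(1 / 4) : ℝ) + h ^ ((β - 2) / β)) := by
  set p := (β - 2) / β with hp
  have hp0 : 0 < p := div_pos (by linarith) (by linarith)
  set c₁ := (2 : ℝ) ^ (1 + 1) + 1 / (β - (1 : ℕ) - 1) with hc₁
  have hc1 : 0 ≤ c₁ := by
    have : (0 : ℝ) ≤ 1 / (β - (1 : ℕ) - 1) := by
      rw [Nat.cast_one]; exact one_div_nonneg.2 (by linarith)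
    positivity
  -- The summands absorb, in turn, the third moment, the weighted covariances, and the upper bound
  -- `2 h w₀` for the variance increments.
  set CA := 2 * B ^ 2 * Cf + (4 * B + 4 * Cf) * (Q * c₁) + 2 * w₀ with hCA
  have hCA0 : 0 ≤ CA := by positivity
  have hsw : 0 < √(w₀ / 2) := Real.sqrt_pos.2 (by linarith)
  set q := w₀ / (2 * D + 1) with hq
  have hq0 : 0 < q := by positivity
  -- In the witness for `h₀`, `1/(2 w₀)` keeps the variance increments at most `1`, and `q^(1/p)`
  -- forces `D ρ ≤ w₀/2`, so that they stay above half of `h w₀`.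
  refine ⟨36 * (2 * CA / w₀) + 14 / √(w₀ / 2) + 2 * D / w₀, by positivity,
    min (min 1 (1 / (2 * w₀))) (q ^ (1 / p)), by positivity,
    (min_le_left _ _).trans (min_le_left _ _), fun n h hh hh₀ hn y => ?_⟩
  have h1 : h ≤ 1 := hh₀.trans ((min_le_left _ _).trans (min_le_left _ _))
  have h2 : h * w₀ ≤ 1 / 2 := by
    have : h ≤ 1 / (2 * w₀) := hh₀.trans ((min_le_left _ _).trans (min_le_right _ _))
    rw [le_div_iff₀ (by positivity)] at this
    linarith
  set ρ := h ^ p with hρ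
  have hρ0 : 0 < ρ := Real.rpow_pos_of_pos hh _
  have hρq : ρ ≤ q := by
    have h3 : h ≤ q ^ (1 / p) := hh₀.trans (min_le_right _ _)
    have := Real.rpow_le_rpow hh.le h3 hp0.le
    rwa [← Real.rpow_mul hq0.le, one_div_mul_cancel hp0.ne', Real.rpow_one] at this
  have hDρ : D * ρ ≤ w₀ / 2 := by
    rw [hq, le_div_iff₀ (by positivity)] at hρq
    nlinarith
  have hρ2 : ρ ^ 2 = h ^ (2 - 2 * (((1 : ℕ) : ℝ) + 1) / β) := by
    rw [hρ, ← Real.rpow_natCast, ← Real.rpow_mul hh.le]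
    congr 1; rw [hp]; push_cast; field_simp; ring
  have hn0 : 0 < n := by
    rcases Nat.eq_zero_or_pos n with rfl | h3
    · norm_num at hn
    · exact h3
  have hnR : (0 : ℝ) < n := by exact_mod_cast hn0
  set N := (n : ℝ) * h with hN
  have hN0 : 0 < N := mul_pos hnR hh
  have hN1 : 1 ≤ N := by
    refine hn.trans ?_
    rw [hN]
    have : h ^ 3 ≤ h := by
      have := pow_le_pow_of_le_one hh.le h1 (show 1 ≤ 3 by norm_num)
      simpa using this
    exact mul_le_mul_of_nonneg_left this hnR.le
  set T := √N with hTdef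
  have hT0 : 0 < T := Real.sqrt_pos.2 hN0
  have hTsq : T ^ 2 = N := Real.sq_sqrt hN0.le
  have hT1 : 1 ≤ T := Real.one_le_sqrt.2 hN1
  set τ := N ^ (-(1 / 4) : ℝ) with hτ
  have hτ0 : 0 < τ := Real.rpow_pos_of_pos hN0 _
  have hTτ : T * τ ^ 2 = 1 := by
    rw [hTdef, hτ, Real.sqrt_eq_rpow, ← Real.rpow_natCast, ← Real.rpow_mul hN0.le,
      ← Real.rpow_add hN0]
    norm_num
  have hτ1 : τ ≤ 1 := Real.rpow_le_one_of_one_le_of_nonpos hN1 (by norm_num)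
  -- This is the condition `n h³ ≥ 1`, since `(h T)² = n h³`.
  have hhT : 1 ≤ h * T := by
    have : 1 ≤ (h * T) ^ 2 := by rw [mul_pow, hTsq, hN]; linarith
    exact (one_le_sq_iff₀ (mul_pos hh hT0).le).1 this
  -- With this smoothing `ε/√V` has order `τ + ρ`. So does `A/(s ε)`, because `T τ² = 1` and `h T ≥
  -- 1` give `h + ρ² ≤ h T (τ + ρ)²`.
  set ε := T * (τ + ρ) with hε
  have hε1 : 1 ≤ ε := by
    have h3 : T * τ ^ 2 ≤ T * τ :=
      mul_le_mul_of_nonneg_left (pow_le_of_le_one hτ0.le hτ1 two_ne_zero) hT0.le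
    have h4 := mul_pos hT0 hρ0
    rw [hε, mul_add]; linarith
  set s := h * w₀ / 2 with hs
  have hs0 : 0 < s := by positivity
  set A := CA * (h + ρ ^ 2) with hA
  have hv : ∀ k, |varIncr P (centredKernel P X K x₀ h) k - h * w₀| ≤ D * (h * ρ) :=
    hvar h hh h1
  have hDh : D * (h * ρ) ≤ s := by
    have := mul_le_mul_of_nonneg_left hDρ hh.le
    rw [hs]; linarith
  have hhw : 0 < h * w₀ := mul_pos hh hw₀
  have hlow : ∀ k, s ≤ varIncr P (centredKernel P X K x₀ h) k := fun k => by
    have := (abs_le.1 (hv k)).1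
    linarith
  have hup : ∀ k, varIncr P (centredKernel P X K x₀ h) k ≤ 2 * (h * w₀) := fun k => by
    have := (abs_le.1 (hv k)).2
    linarith
  have hAs : 2 * (h * w₀) ≤ A := by
    have h4 : 0 ≤ (2 * B ^ 2 * Cf + (4 * B + 4 * Cf) * (Q * c₁)) * (h + ρ ^ 2) := by positivity
    have h5 : 0 ≤ w₀ * ρ ^ 2 := by positivity
    have e : A = (2 * B ^ 2 * Cf + (4 * B + 4 * Cf) * (Q * c₁)) * (h + ρ ^ 2)
        + 2 * (h * w₀) + 2 * (w₀ * ρ ^ 2) := by rw [hA, hCA]; ring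
    linarith
  have hwA : ∀ k, B ^ 2 * (2 * Cf * h) + (4 * B + 2 * (2 * Cf * h)) *
      weightedSum (fun r => Q * min (h ^ 2) ((r : ℝ) ^ (-β))) k ≤ A := by
    intro k
    have h3 := sum_pow_mul_min_le 1 (β := β) (by norm_num; linarith) hh h1 k
    rw [← hρ2] at h3
    have h4 : weightedSum (fun r => Q * min (h ^ 2) ((r : ℝ) ^ (-β))) k ≤ Q * c₁ * ρ ^ 2 := by
      have : weightedSum (fun r => Q * min (h ^ 2) ((r : ℝ) ^ (-β))) k
          = Q * ∑ m ∈ Finset.range (k + 1), (m : ℝ) ^ 1 * min (h ^ 2) ((m : ℝ) ^ (-β)) := by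
        rw [weightedSum, Finset.mul_sum]
        exact Finset.sum_congr rfl fun m _ => by ring
      rw [this, mul_assoc]
      exact mul_le_mul_of_nonneg_left h3 hQ
    have h5 : 4 * B + 2 * (2 * Cf * h) ≤ 4 * B + 4 * Cf := by
      linarith [mul_le_mul_of_nonneg_left h1 hCf]
    have h6 := mul_le_mul h5 h4 (Finset.sum_nonneg fun m _ => by positivity) (by positivity)
    have h7 : 0 ≤ (2 * B ^ 2 * Cf) * ρ ^ 2 := by positivity
    have h8 : 0 ≤ (4 * B + 4 * Cf) * (Q * c₁) * h := by positivity
    have h9 : 0 ≤ 2 * w₀ * (h + ρ ^ 2) := by positivity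
    have e : A = B ^ 2 * (2 * Cf * h) + (4 * B + 4 * Cf) * (Q * c₁ * ρ ^ 2)
        + 2 * B ^ 2 * Cf * ρ ^ 2 + (4 * B + 4 * Cf) * (Q * c₁) * h + 2 * w₀ * (h + ρ ^ 2) := by
      rw [hA, hCA]; ring
    linarith
  have key := (hZ h hh).berryEsseen hn0 hs0 hε1 (fun k _ => hlow k)
    (fun k _ => (hup k).trans (by linarith)) (fun k _ => (hup k).trans hAs) (fun k _ => hwA k)
    (T * y)
  set V := ∑ k ∈ Finset.range n, varIncr P (centredKernel P X K x₀ h) k with hV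
  have hVw : |V - N * w₀| ≤ N * (D * ρ) := by
    have e1 : V - N * w₀
        = ∑ k ∈ Finset.range n, (varIncr P (centredKernel P X K x₀ h) k - h * w₀) := by
      rw [Finset.sum_sub_distrib, Finset.sum_const, Finset.card_range, nsmul_eq_mul, hN]; ring
    have e2 : N * (D * ρ) = ∑ _k ∈ Finset.range n, D * (h * ρ) := by
      rw [Finset.sum_const, Finset.card_range, nsmul_eq_mul, hN]; ring
    rw [e1, e2]
    exact (Finset.abs_sum_le_sum_abs _ _).trans (Finset.sum_le_sum fun k _ => hv k)
  set w := V / N with hw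
  have hwd : |w - w₀| ≤ D * ρ := by
    have : w - w₀ = (V - N * w₀) / N := by rw [hw]; field_simp
    rw [this, abs_div, abs_of_pos hN0, div_le_iff₀ hN0]
    exact hVw.trans_eq (mul_comm _ _)
  have hwlow : w₀ / 2 ≤ w := by have := (abs_le.1 hwd).1; linarith
  have hw0 : 0 < w := by linarith
  have hsV : √V = T * √w := by
    rw [hTdef, ← Real.sqrt_mul hN0.le, hw, mul_div_cancel₀ _ hN0.ne']
  have hsq : √(w₀ / 2) ≤ √w := Real.sqrt_le_sqrt hwlow
  have hswp : 0 < √w := hsw.trans_le hsq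
  rw [hsV, mul_div_mul_left _ _ hT0.ne'] at key
  have b1 : A / (s * ε) ≤ 2 * CA / w₀ * (τ + ρ) := by
    have h3 : h + ρ ^ 2 ≤ h * T * (τ + ρ) ^ 2 := by
      have h4 : h * T * (τ + ρ) ^ 2 = h * (T * τ ^ 2) + h * T * ρ ^ 2 + 2 * (h * T * τ * ρ) := by
        ring
      have h5 : 0 ≤ 2 * (h * T * τ * ρ) := by positivity
      have h6 := mul_le_mul_of_nonneg_right hhT (sq_nonneg ρ)
      rw [h4, hTτ]; linarith
    rw [div_le_iff₀ (by positivity), hA, hs, hε]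
    have e : 2 * CA / w₀ * (τ + ρ) * (h * w₀ / 2 * (T * (τ + ρ)))
        = CA * (h * T * (τ + ρ) ^ 2) := by field_simp
    rw [e]
    exact mul_le_mul_of_nonneg_left h3 hCA0
  have b2 : ε / (T * √w) ≤ 1 / √(w₀ / 2) * (τ + ρ) := by
    rw [hε, mul_div_mul_left _ _ hT0.ne', one_div, inv_mul_eq_div]
    exact div_le_div_of_nonneg_left (by positivity) hsw hsq
  have b3 := abs_stdNormalCDF_div_sqrt_sub_le_of_le y (s := w₀ / 2) (by linarith) hwlow
    (by linarith : w₀ / 2 ≤ w₀)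
  have b4 : |w - w₀| / (w₀ / 2) ≤ 2 * D / w₀ * (τ + ρ) := by
    have : 2 * D / w₀ * (τ + ρ) = D * (τ + ρ) / (w₀ / 2) := by field_simp
    rw [this]
    refine div_le_div_of_nonneg_right (hwd.trans ?_) (by positivity)
    exact mul_le_mul_of_nonneg_left (by linarith) hD
  refine (abs_sub_le _ _ _).trans ((add_le_add key (b3.trans b4)).trans ?_)
  have e : (36 * (2 * CA / w₀) + 14 / √(w₀ / 2) + 2 * D / w₀) * (τ + ρ)
      = 36 * (2 * CA / w₀ * (τ + ρ)) + 14 * (1 / √(w₀ / 2) * (τ + ρ)) + 2 * D / w₀ * (τ + ρ) := by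
    ring
  rw [e]
  linarith

/-- The error of the normal approximation for the kernel density estimator. -/
theorem exists_normalApproxError_bound [IsProbabilityMeasure P] (hX : ∀ i, Measurable (X i))
    (hstat : StrictlyStationary P X) {β : ℝ} (hβ : 2 < β)
    (hmix : (fun t : ℕ => alphaMixing P X t) =O[atTop] (fun t : ℕ => (t : ℝ) ^ (-β)))
    {f : ℝ → ℝ} (hf : IsDensity P (X 1) f) (hfb : BddAbove (Set.range f))
    (hjoint : BoundedJointDensities P X) {x₀ : ℝ} (hf₀ : 0 < f x₀) (hf₄ : ContDiffAt ℝ 4 f x₀)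
    {K : ℝ → ℝ} (hK : IsKernel K) (M : ℝ) :
    ∃ C : ℝ, ∃ h₀ : ℝ, 0 < h₀ ∧ ∀ (n : ℕ) (h : ℝ), 0 < h → h ≤ h₀ → 1 ≤ n * h ^ 3 →
      n * h ^ 5 ≤ M → ∀ y, |normalApproxError P X f K x₀ y n h| ≤
        C * ((n * h) ^ (-(1 / 4) : ℝ) + h ^ ((β - 2) / β)) := by
  obtain ⟨Cf, hCf'⟩ := hfb
  have hCf : ∀ x, |f x| ≤ Cf := fun x => by
    rw [abs_of_nonneg (hf.2.1 x)]; exact hCf' ⟨x, rfl⟩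
  have hCf0 : 0 ≤ Cf := (abs_nonneg _).trans (hCf 0)
  obtain ⟨B, hB0, hB⟩ := hK.exists_bound
  obtain ⟨Q, hQ, hZ⟩ := weaklyDependent_centredKernel hX hstat hmix hf hCf hjoint x₀ hK hB
  obtain ⟨CT, hCT, d, hT1, hT3⟩ := exists_taylor_bound hCf hf₄
  obtain ⟨D, hD, hvar⟩ := exists_varIncr_bound hX hstat hβ hf hCf hK hQ hZ hCT hT1
  set w₀ := f x₀ * kernelNu2 K with hw₀
  have hw0 : 0 < w₀ := mul_pos hf₀ hK.kernelNu2_pos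
  obtain ⟨C, hC, h₀, hh₀, hh₁, hmain⟩ :=
    exists_partialSum_bound hβ hCf0 hB0.le hQ hZ hw0 hD hvar
  set I := ∫ u, |u| ^ 3 * K u with hI
  have hI0 : 0 ≤ I := integral_nonneg fun u => mul_nonneg (by positivity) (hK.nonneg u)
  have hsw : 0 < √w₀ := Real.sqrt_pos.2 hw0
  refine ⟨C + CT * I * √M / √w₀, h₀, hh₀, fun n h hh hhh hn hM y => ?_⟩
  have h1 : h ≤ 1 := hhh.trans hh₁
  have hnR : (0 : ℝ) < n := by
    rcases Nat.eq_zero_or_pos n with rfl | h3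
    · norm_num at hn
    · exact_mod_cast h3
  have hN0 : 0 < (n : ℝ) * h := mul_pos hnR hh
  set T := √((n : ℝ) * h) with hT
  have hT0 : 0 < T := Real.sqrt_pos.2 hN0
  have hTsq : T ^ 2 = n * h := Real.sq_sqrt hN0.le
  set J := ∫ u, K u * f (x₀ + h * u) with hJ
  have hmean : ∫ ω, K ((X 1 ω - x₀) / h) ∂P = h * J :=
    hf.integral_comp_affine (hX 1) hK.measurable x₀ hh
  set b := T * (J - f x₀) with hb
  set b' := T * (h ^ 2 * iteratedDeriv 2 f x₀ * kernelMu2 K / 2) with hb'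
  -- The remainder `T h³` equals `√(n h⁵) h`, hence is at most `√M h`. It is later absorbed by `h ≤
  -- h^((β-2)/β)`.
  have hbb : |b - b'| ≤ CT * I * √M * h := by
    have e1 := kernel_mean_expansion hK hf.1 hCf hT3 hh
    have e2 : T * h ^ 2 ≤ √M := by
      have : T * h ^ 2 = √(n * h ^ 5) := by
        rw [show (n : ℝ) * h ^ 5 = (T * h ^ 2) ^ 2 by rw [mul_pow, hTsq]; ring,
          Real.sqrt_sq (by positivity)]
      rw [this]
      exact Real.sqrt_le_sqrt hM
    have e3 : b - b' = T * (J - f x₀ - h ^ 2 * iteratedDeriv 2 f x₀ * kernelMu2 K / 2) := by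
      rw [hb, hb']; ring
    rw [e3, abs_mul, abs_of_pos hT0]
    calc _ ≤ T * (CT * I * h ^ 3) := mul_le_mul_of_nonneg_left e1 hT0.le
      _ = CT * I * h * (T * h ^ 2) := by ring
      _ ≤ CT * I * h * √M := mul_le_mul_of_nonneg_left e2 (by positivity)
      _ = _ := by ring
  have hset : {ω | ((n : ℝ) * h) ^ (1 / 2 : ℝ) * (kde X K x₀ n h ω - f x₀) ≤ y}
      = {ω | partialSum (centredKernel P X K x₀ h) n ω ≤ T * (y - b)} := by
    ext ω
    simp only [Set.mem_ofPred_eq]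
    rw [← Real.sqrt_eq_rpow, ← hT, kde, sum_kernel_eq P, hmean]
    set S := partialSum (centredKernel P X K x₀ h) n ω
    have e : T * (((n : ℝ) * h)⁻¹ * (S + n * (h * J)) - f x₀) = S / T + b := by
      rw [hb, ← hTsq]
      have : (n : ℝ) * (h * J) = T ^ 2 * J := by rw [hTsq]; ring
      rw [this]
      field_simp
      ring
    rw [e, ← le_sub_iff_add_le, div_le_iff₀ hT0, mul_comm]
  have hb'' : (n : ℝ) ^ (1 / 2 : ℝ) * h ^ (5 / 2 : ℝ) * iteratedDeriv 2 f x₀ * kernelMu2 K / 2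
      = b' := by
    have e : h ^ (5 / 2 : ℝ) = √h * h ^ 2 := by
      rw [Real.sqrt_eq_rpow, ← Real.rpow_natCast, ← Real.rpow_add hh]; norm_num
    rw [hb', hT, Real.sqrt_mul hnR.le, e, ← Real.sqrt_eq_rpow]; ring
  rw [normalApproxError, hset, hb'', ← hw₀]
  have k1 := hmain n h hh hhh hn (y - b)
  have k2 : |stdNormalCDF ((y - b) / √w₀) - stdNormalCDF ((y - b') / √w₀)| ≤
      CT * I * √M / √w₀ * h := by
    refine (abs_stdNormalCDF_sub_le _ _).trans ?_
    rw [← sub_div, abs_div, abs_of_pos hsw, div_mul_eq_mul_div]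
    refine div_le_div_of_nonneg_right (le_trans (le_of_eq ?_) hbb) hsw.le
    rw [← abs_neg]; congr 1; ring
  have hρh : h ≤ h ^ ((β - 2) / β) := by
    have := Real.rpow_le_rpow_of_exponent_ge hh h1
      (show (β - 2) / β ≤ 1 by rw [div_le_one (by linarith)]; linarith)
    rwa [Real.rpow_one] at this
  have hτ0 : 0 < ((n : ℝ) * h) ^ (-(1 / 4) : ℝ) := Real.rpow_pos_of_pos hN0 _
  have k3 : CT * I * √M / √w₀ * h ≤ CT * I * √M / √w₀ *
      (((n : ℝ) * h) ^ (-(1 / 4) : ℝ) + h ^ ((β - 2) / β)) :=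
    mul_le_mul_of_nonneg_left (by linarith) (by positivity)
  refine (abs_sub_le _ _ _).trans ((add_le_add k1 (k2.trans k3)).trans (le_of_eq ?_))
  ring

end NormalApproximation

/-! ### Exponents of the error order -/

section Rates

variable {β : ℝ}

lemma optRate_denom_pos (hβ : 2 < β) : 0 < 5 * β ^ 2 - 5 * β - 4 := by nlinarith

/-- Together with `optRate_eq_sub`, this says that the first two terms of the order coincide at `h =
n^(-optBandwidth β)`. -/
lemma optRate_eq_mul_optBandwidth (hβ : 2 < β) :
    optRate β = optBandwidth β * ((β - 2) / β) := by
  have hD := optRate_denom_pos hβ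
  have hβ0 : β ≠ 0 := by positivity
  rw [optRate, optBandwidth]; field_simp

lemma optRate_eq_sub (hβ : 2 < β) :
    -optRate β = -(β - 1) / (4 * β + 2) + -optBandwidth β * (-(β + 1) / (4 * β + 2)) := by
  have hD := (optRate_denom_pos hβ).ne'
  have h2 : 4 * β + 2 ≠ 0 := by positivity
  rw [optRate, optBandwidth]
  generalize hDe : 5 * β ^ 2 - 5 * β - 4 = D at hD ⊢
  field_simp
  rw [← hDe]; ring

lemma optBandwidth_pos (hβ : 2 < β) : 0 < optBandwidth β :=
  div_pos (mul_pos (by linarith) (by linarith)) (optRate_denom_pos hβ)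

lemma one_fifth_lt_optBandwidth (hβ : 2 < β) : 1 / 5 < optBandwidth β := by
  rw [optBandwidth, div_lt_div_iff₀ (by norm_num) (optRate_denom_pos hβ)]; nlinarith

lemma optBandwidth_lt_one_third (hβ : 2 < β) : optBandwidth β < 1 / 3 := by
  rw [optBandwidth, div_lt_div_iff₀ (optRate_denom_pos hβ) (by norm_num)]; nlinarith

lemma gamma0_le_one (hβ : 2 < β) {d : ℕ} (hd : 3 ≤ d) : gamma0 β d ≤ 1 := by
  have hd' : (3 : ℝ) ≤ d := by exact_mod_cast hd
  rw [gamma0]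
  have h1 : 0 ≤ (β - 1) / (β + d - 2) := div_nonneg (by linarith) (by linarith)
  have h2 : 0 ≤ (((β - 1) * (β + d - 2)) / (β ^ 2 + ((d : ℝ) - 3) * β + ((d : ℝ) - 2) ^ 2)) ^
      ((β - 1) / (β - d + 1)) := by
    refine Real.rpow_nonneg (div_nonneg (mul_nonneg (by linarith) (by linarith)) ?_) _
    have : 0 ≤ ((d : ℝ) - 3) * β := mul_nonneg (by linarith) (by linarith)
    positivity
  have h3 : (0 : ℝ) ≤ if β > (d : ℝ) - 1 then 1 else 0 := by split_ifs <;> norm_num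
  have := mul_nonneg (mul_nonneg h3 h1) h2
  linarith

/-- Since `γ₀ ≤ 1`, each `d ≥ 3` contributes at least `d/(β-1)`. The exponent of `h` in the third
term is therefore at least `-3/2`. -/
lemma three_div_le_g0 (hβ : 2 < β) : 3 / (β - 1) ≤ g0 β := by
  refine le_csInf ⟨_, 3, le_rfl, rfl⟩ ?_
  rintro _ ⟨d, hd, rfl⟩
  have hd' : (3 : ℝ) ≤ d := by exact_mod_cast hd
  have h1 := gamma0_le_one hβ hd
  have h2 : 0 < β - 1 := by linarith
  have h3 : 1 / (β - 1) ≤ β / (β - 1) - gamma0 β d := by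
    have : β / (β - 1) = 1 / (β - 1) + 1 := by field_simp; ring
    linarith
  have h4 : 0 ≤ 1 / (β - 1) := by positivity
  calc 3 / (β - 1) = 3 * (1 / (β - 1)) := by ring
    _ ≤ d * (β / (β - 1) - gamma0 β d) := mul_le_mul hd' h3 h4 (by linarith)

/-- The moment term of the error order is negligible at the optimal bandwidth. -/
lemma moment_term_exponent_lt (hβ : 2 < β) :
    -(1 / 2) + -optBandwidth β * (-(3 * β + 3) / (2 * β - 2) + g0 β) < -optRate β := by
  have hD := optRate_denom_pos hβ
  have h1 : 0 < β - 1 := by linarith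
  have h2 := mul_le_mul_of_nonneg_left (three_div_le_g0 hβ) (optBandwidth_pos hβ).le
  have h3 : -(1 / 2) + -optBandwidth β * (-(3 * β + 3) / (2 * β - 2) + 3 / (β - 1))
      < -optRate β := by
    have e1 : -(3 * β + 3) / (2 * β - 2) + 3 / (β - 1) = -(3 / 2) := by
      have : 2 * β - 2 = 2 * (β - 1) := by ring
      rw [this]; field_simp; ring
    rw [e1, optRate, optBandwidth]
    have e2 : -(1 / 2) + -(β * (β - 1) / (5 * β ^ 2 - 5 * β - 4)) * -(3 / 2)
        = -((2 * β ^ 2 - 2 * β - 4) / 2 / (5 * β ^ 2 - 5 * β - 4)) := by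
      generalize hDe : 5 * β ^ 2 - 5 * β - 4 = D at hD ⊢
      field_simp
      rw [← hDe]; ring
    rw [e2, neg_lt_neg_iff, div_lt_div_iff_of_pos_right hD]
    -- The comparison is `(β-2)(β+1) > (β-1)(β-2)`.
    nlinarith
  linarith

/-- The exponents satisfy `(β-1)/(4β+2) ≤ 1/4 ≤ (β+1)/(4β+2)`, while `n ≥ 1` and `h ≤ 1`. -/
lemma quarter_rate_le {n h : ℝ} (hβ : 2 < β) (hn : 1 ≤ n) (hh : 0 < h) (h1 : h ≤ 1) :
    (n * h) ^ (-(1 / 4) : ℝ) ≤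
      n ^ (-(β - 1) / (4 * β + 2)) * h ^ (-(β + 1) / (4 * β + 2)) := by
  have hd : 0 < 4 * β + 2 := by linarith
  rw [Real.mul_rpow (by linarith) hh.le]
  refine mul_le_mul (Real.rpow_le_rpow_of_exponent_le hn ?_)
    (Real.rpow_le_rpow_of_exponent_ge hh h1 ?_) (Real.rpow_nonneg hh.le _)
    (Real.rpow_nonneg (by linarith) _)
  · rw [neg_div, neg_le_neg_iff, div_le_div_iff₀ hd (by norm_num)]; linarith
  · rw [neg_div, neg_le_neg_iff, div_le_div_iff₀ (by norm_num) hd]; linarith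

lemma le_errorOrder (β δ : ℝ) (n : ℕ) {h : ℝ} (hh : 0 < h) :
    (n : ℝ) ^ (-(β - 1) / (4 * β + 2)) * h ^ (-(β + 1) / (4 * β + 2)) + h ^ ((β - 2) / β) ≤
      errorOrder β δ n h := by
  rw [errorOrder, le_add_iff_nonneg_right]
  exact mul_nonneg (Real.rpow_nonneg (Nat.cast_nonneg _) _) (Real.rpow_nonneg hh.le _)

/-- The first term decreases in `h` and the second increases, so on either side of the balancing
bandwidth one of them is at least the common value. -/
lemma optRate_le_errorOrder (hβ : 2 < β) (δ : ℝ) {n : ℕ} (hn : 1 ≤ n) {h : ℝ} (hh : 0 < h) :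
    (n : ℝ) ^ (-optRate β) ≤ errorOrder β δ n h := by
  refine le_trans ?_ (le_errorOrder β δ n hh)
  have hn' : (1 : ℝ) ≤ n := by exact_mod_cast hn
  have hn0 : (0 : ℝ) < n := by linarith
  have hp : 0 ≤ (β - 2) / β := div_nonneg (by linarith) (by linarith)
  rcases le_total ((n : ℝ) ^ (-optBandwidth β)) h with hle | hle
  · have h1 := Real.rpow_le_rpow (Real.rpow_nonneg hn0.le _) hle hp
    rw [← Real.rpow_mul hn0.le, neg_mul, ← optRate_eq_mul_optBandwidth hβ] at h1
    have : 0 ≤ (n : ℝ) ^ (-(β - 1) / (4 * β + 2)) * h ^ (-(β + 1) / (4 * β + 2)) :=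
      mul_nonneg (Real.rpow_nonneg hn0.le _) (Real.rpow_nonneg hh.le _)
    linarith
  · have h1 := Real.rpow_le_rpow_of_nonpos hh hle
      (show -(β + 1) / (4 * β + 2) ≤ 0 from
        div_nonpos_of_nonpos_of_nonneg (by linarith) (by linarith))
    rw [← Real.rpow_mul hn0.le] at h1
    have h2 := mul_le_mul_of_nonneg_left h1 (Real.rpow_nonneg hn0.le (-(β - 1) / (4 * β + 2)))
    rw [← Real.rpow_add hn0, ← optRate_eq_sub hβ] at h2
    have := Real.rpow_nonneg hh.le ((β - 2) / β)
    linarith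

end Rates

/-! ### Passage to sequences of bandwidths -/

section Asymptotics

/-- Real powers, of either sign, preserve exact orders of positive functions. -/
lemma isBigO_rpow_of_isTheta {ι : Type*} {l : Filter ι} {u v : ι → ℝ} (hu : ∀ᶠ n in l, 0 < u n)
    (hv : ∀ᶠ n in l, 0 < v n) (huv : u =Θ[l] v) (e : ℝ) :
    (fun n => u n ^ e) =O[l] fun n => v n ^ e := by
  rcases le_total 0 e with he | he
  · exact huv.1.rpow he (hv.mono fun _ h => h.le)
  · have := ((huv.2.rpow (neg_nonneg.2 he) (hu.mono fun _ h => h.le)).inv_rev ?_)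
    · refine (this.congr' ?_ ?_)
      · filter_upwards [hu] with n hn
        rw [Real.rpow_neg hn.le, inv_inv]
      · filter_upwards [hv] with n hn
        rw [Real.rpow_neg hn.le, inv_inv]
    · filter_upwards [hv] with n hn h0
      exact absurd h0 (Real.rpow_pos_of_pos hn _).ne'

lemma eventually_natCast_rpow_pos (a : ℝ) : ∀ᶠ n : ℕ in atTop, 0 < (n : ℝ) ^ a := by
  filter_upwards [eventually_gt_atTop 0] with n hn
  exact Real.rpow_pos_of_pos (by exact_mod_cast hn) _

lemma isBigO_natCast_rpow_of_le {a b : ℝ} (hab : a ≤ b) :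
    (fun n : ℕ => (n : ℝ) ^ a) =O[atTop] fun n : ℕ => (n : ℝ) ^ b := by
  refine IsBigO.of_bound 1 ?_
  filter_upwards [eventually_ge_atTop 1] with n hn
  have hn' : (1 : ℝ) ≤ n := by exact_mod_cast hn
  rw [one_mul, Real.norm_of_nonneg (by positivity), Real.norm_of_nonneg (by positivity)]
  exact Real.rpow_le_rpow_of_exponent_le hn' hab

lemma isBigO_mul_rpow_of_isTheta {h : ℕ → ℝ} (hh : ∀ n, 0 < h n) {b : ℝ}
    (hb : h =Θ[atTop] fun n : ℕ => (n : ℝ) ^ (-b)) (a e : ℝ) {r : ℝ} (hr : a + -b * e ≤ r) :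
    (fun n : ℕ => (n : ℝ) ^ a * h n ^ e) =O[atTop] fun n : ℕ => (n : ℝ) ^ r := by
  have h1 := isBigO_rpow_of_isTheta (Eventually.of_forall hh) (eventually_natCast_rpow_pos _) hb e
  refine ((isBigO_refl (fun n : ℕ => (n : ℝ) ^ a) atTop).mul h1).trans ?_
  refine IsBigO.trans (EventuallyEq.isBigO ?_) (isBigO_natCast_rpow_of_le hr)
  filter_upwards [eventually_gt_atTop 0] with n hn
  have hn' : (0 : ℝ) < n := by exact_mod_cast hn
  rw [← Real.rpow_mul hn'.le, Real.rpow_add hn']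

lemma IsBandwidth.tendsto_zero {h : ℕ → ℝ} (hb : IsBandwidth h) : Tendsto h atTop (𝓝 0) :=
  hb.2.2.trans_tendsto
    ((tendsto_rpow_neg_atTop (by norm_num : (0 : ℝ) < 1 / 5)).comp tendsto_natCast_atTop_atTop)

lemma IsBandwidth.exists_mul_pow_five_le {h : ℕ → ℝ} (hb : IsBandwidth h) :
    ∃ M : ℝ, ∀ᶠ n : ℕ in atTop, n * h n ^ 5 ≤ M := by
  obtain ⟨c, hc⟩ := hb.2.2.bound
  refine ⟨c ^ 5, ?_⟩
  filter_upwards [hc, eventually_gt_atTop 0] with n hn hn0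
  have hn' : (0 : ℝ) < n := by exact_mod_cast hn0
  rw [Real.norm_of_nonneg (hb.1 n).le, Real.norm_of_nonneg (by positivity)] at hn
  have h5 : ((n : ℝ) ^ (-(1 / 5) : ℝ)) ^ 5 = (n : ℝ)⁻¹ := by
    rw [← Real.rpow_natCast, ← Real.rpow_mul hn'.le, ← Real.rpow_neg_one]; norm_num
  calc (n : ℝ) * h n ^ 5 ≤ n * (c * (n : ℝ) ^ (-(1 / 5) : ℝ)) ^ 5 :=
        mul_le_mul_of_nonneg_left (pow_le_pow_left₀ (hb.1 n).le hn 5) hn'.le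
    _ = c ^ 5 := by rw [mul_pow, h5]; field_simp

/-- The optimal exponent lies strictly between `1/5` and `1/3`: the lower bound gives `h =
O(n^(-1/5))`, the upper one `n h³ → ∞`. -/
lemma isBandwidth_of_isTheta {β : ℝ} (hβ : 2 < β) {h : ℕ → ℝ} (hh : ∀ n, 0 < h n)
    (hb : h =Θ[atTop] fun n : ℕ => (n : ℝ) ^ (-optBandwidth β)) : IsBandwidth h := by
  refine ⟨hh, ?_, hb.1.trans (isBigO_natCast_rpow_of_le (by
    linarith [one_fifth_lt_optBandwidth hβ]))⟩
  have h1 : (fun n : ℕ => ((n : ℝ) * h n ^ 3)⁻¹) =O[atTop]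
      fun n : ℕ => (n : ℝ) ^ (-(1 - 3 * optBandwidth β)) := by
    refine (isBigO_mul_rpow_of_isTheta hh hb (-1) (-3)
      (r := -(1 - 3 * optBandwidth β)) (by linarith)).congr' ?_ EventuallyEq.rfl
    filter_upwards with n
    rw [mul_inv, Real.rpow_neg_one, Real.rpow_neg (hh n).le]
    norm_cast
  have h2 := h1.trans_tendsto ((tendsto_rpow_neg_atTop
    (by linarith [optBandwidth_lt_one_third hβ] : 0 < 1 - 3 * optBandwidth β)).comp
      tendsto_natCast_atTop_atTop)
  have h3 : Tendsto (fun n : ℕ => ((n : ℝ) * h n ^ 3)⁻¹) atTop (𝓝[>] 0) := by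
    refine tendsto_nhdsWithin_iff.2 ⟨h2, ?_⟩
    filter_upwards [eventually_gt_atTop 0] with n hn
    have hn' : (0 : ℝ) < n := by exact_mod_cast hn
    have := hh n
    simp only [Set.mem_Ioi]; positivity
  exact h3.inv_tendsto_nhdsGT_zero.congr fun n => inv_inv _

lemma isBigO_optRate_errorOrder {β : ℝ} (hβ : 2 < β) {h : ℕ → ℝ} (hh : ∀ n, 0 < h n) (δ : ℝ) :
    (fun n : ℕ => (n : ℝ) ^ (-optRate β)) =O[atTop] fun n : ℕ => errorOrder β δ n (h n) := by
  refine IsBigO.of_bound 1 ?_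
  filter_upwards [eventually_ge_atTop 1] with n hn
  rw [one_mul, Real.norm_of_nonneg (by positivity)]
  exact (optRate_le_errorOrder hβ δ hn (hh n)).trans (le_abs_self _)

lemma exists_isTheta_errorOrder {β : ℝ} (hβ : 2 < β) {h : ℕ → ℝ} (hh : ∀ n, 0 < h n)
    (hb : h =Θ[atTop] fun n : ℕ => (n : ℝ) ^ (-optBandwidth β)) :
    ∃ δ₀ : ℝ, 0 < δ₀ ∧ ∀ δ : ℝ, 0 < δ → δ < δ₀ →
      (fun n : ℕ => errorOrder β δ n (h n)) =Θ[atTop] fun n : ℕ => (n : ℝ) ^ (-optRate β) := by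
  -- `δ₀` is the gap in `moment_term_exponent_lt`: a smaller `δ` keeps the third term below the
  -- optimal rate.
  refine ⟨_, sub_pos.2 (moment_term_exponent_lt hβ), fun δ _ hδ =>
    ⟨?_, isBigO_optRate_errorOrder hβ hh δ⟩⟩
  refine ((isBigO_mul_rpow_of_isTheta hh hb _ _ (optRate_eq_sub hβ).ge).add ?_).add
    (isBigO_mul_rpow_of_isTheta hh hb _ _ (by linarith))
  have := isBigO_mul_rpow_of_isTheta hh hb 0 ((β - 2) / β) (r := -optRate β)
    (by rw [optRate_eq_mul_optBandwidth hβ]; linarith)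
  simpa using this

lemma normalApproxError_isBigO_errorOrder {Ω : Type*} [MeasurableSpace Ω] {P : Measure Ω}
    [IsProbabilityMeasure P]
    {X : ℤ → Ω → ℝ} (hX : ∀ i, Measurable (X i)) (hstat : StrictlyStationary P X)
    {β : ℝ} (hβ : 2 < β)
    (hmix : (fun t : ℕ => alphaMixing P X t) =O[atTop] (fun t : ℕ => (t : ℝ) ^ (-β)))
    {f : ℝ → ℝ} (hf : IsDensity P (X 1) f) (hfb : BddAbove (Set.range f))
    (hjoint : BoundedJointDensities P X)
    {x₀ : ℝ} (hf₀ : 0 < f x₀) (hf₄ : ContDiffAt ℝ 4 f x₀)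
    {K : ℝ → ℝ} (hK : IsKernel K) {h : ℕ → ℝ} (hb : IsBandwidth h) (y δ : ℝ) :
    (fun n : ℕ => normalApproxError P X f K x₀ y n (h n)) =O[atTop]
      fun n : ℕ => errorOrder β δ n (h n) := by
  obtain ⟨M, hM⟩ := hb.exists_mul_pow_five_le
  obtain ⟨C, h₀, h₀pos, hC⟩ :=
    exists_normalApproxError_bound hX hstat hβ hmix hf hfb hjoint hf₀ hf₄ hK M
  refine IsBigO.of_bound |C| ?_
  filter_upwards [hM, hb.2.1.eventually_ge_atTop 1, eventually_ge_atTop 1,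
    hb.tendsto_zero.eventually_le_const h₀pos, hb.tendsto_zero.eventually_le_const one_pos]
    with n hnM hn3 hn hnh₀ hn1
  have hh := hb.1 n
  have hn' : (1 : ℝ) ≤ n := by exact_mod_cast hn
  have h2 : ((n : ℝ) * h n) ^ (-(1 / 4) : ℝ) + h n ^ ((β - 2) / β) ≤ errorOrder β δ n (h n) :=
    (add_le_add_left (quarter_rate_le hβ hn' hh hn1) _).trans (le_errorOrder β δ n hh)
  have h0 : 0 ≤ ((n : ℝ) * h n) ^ (-(1 / 4) : ℝ) + h n ^ ((β - 2) / β) := by positivity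
  rw [Real.norm_eq_abs]
  calc |normalApproxError P X f K x₀ y n (h n)|
      ≤ C * (((n : ℝ) * h n) ^ (-(1 / 4) : ℝ) + h n ^ ((β - 2) / β)) :=
        hC n (h n) hh hnh₀ hn3 hnM y
    _ ≤ |C| * (((n : ℝ) * h n) ^ (-(1 / 4) : ℝ) + h n ^ ((β - 2) / β)) :=
        mul_le_mul_of_nonneg_right (le_abs_self C) h0
    _ ≤ |C| * ‖errorOrder β δ n (h n)‖ :=
        mul_le_mul_of_nonneg_left (h2.trans (le_abs_self _)) (abs_nonneg C)

end Asymptotics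

theorem theorem1 {Ω : Type*} [MeasurableSpace Ω] (P : Measure Ω) [IsProbabilityMeasure P]
    (X : ℤ → Ω → ℝ) (hX : ∀ i, Measurable (X i)) (hstat : StrictlyStationary P X)
    (β : ℝ) (hβ : 2 < β)
    (hmix : (fun t : ℕ => alphaMixing P X t) =O[atTop] (fun t : ℕ => (t : ℝ) ^ (-β)))
    (f : ℝ → ℝ) (hf : IsDensity P (X 1) f) (hfb : BddAbove (Set.range f))
    (hjoint : BoundedJointDensities P X)
    (x₀ : ℝ) (hf₀ : 0 < f x₀) (hf₄ : ContDiffAt ℝ 4 f x₀)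
    (K : ℝ → ℝ) (hK : IsKernel K) :
    -- the normal approximation with its error order
    (∀ h : ℕ → ℝ, IsBandwidth h → ∀ y δ : ℝ, 0 < δ →
      (fun n : ℕ => normalApproxError P X f K x₀ y n (h n)) =O[atTop]
        (fun n : ℕ => errorOrder β δ n (h n))) ∧
    -- no bandwidth makes the error order smaller than the optimal rate
    (∀ h : ℕ → ℝ, IsBandwidth h → ∀ δ : ℝ, 0 < δ →
      (fun n : ℕ => (n : ℝ) ^ (-optRate β)) =O[atTop] (fun n : ℕ => errorOrder β δ n (h n))) ∧
    -- the optimal rate is attained at bandwidths proportional to the optimal power of `n`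
    (∀ h : ℕ → ℝ, (∀ n, 0 < h n) →
      h =Θ[atTop] (fun n : ℕ => (n : ℝ) ^ (-optBandwidth β)) →
        IsBandwidth h ∧
        (∃ δ₀ : ℝ, 0 < δ₀ ∧ ∀ δ : ℝ, 0 < δ → δ < δ₀ →
          (fun n : ℕ => errorOrder β δ n (h n)) =Θ[atTop]
            (fun n : ℕ => (n : ℝ) ^ (-optRate β))) ∧
        ∀ y : ℝ, (fun n : ℕ => normalApproxError P X f K x₀ y n (h n)) =O[atTop]
          (fun n : ℕ => (n : ℝ) ^ (-optRate β))) := by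
  have normalApprox {h : ℕ → ℝ} (hb : IsBandwidth h) :=
    normalApproxError_isBigO_errorOrder hX hstat hβ hmix hf hfb hjoint hf₀ hf₄ hK hb
  refine ⟨fun h hb y δ _ => normalApprox hb y δ,
    fun h hb δ _ => isBigO_optRate_errorOrder hβ hb.1 δ, fun h hh hb => ?_⟩
  have hbw := isBandwidth_of_isTheta hβ hh hb
  obtain ⟨δ₀, hδ₀, hθ⟩ := exists_isTheta_errorOrder hβ hh hb
  -- The last bound does not involve `δ`, so any admissible value will do, here `δ₀ / 2`.
  exact ⟨hbw, ⟨δ₀, hδ₀, hθ⟩, fun y =>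
    (normalApprox hbw y (δ₀ / 2)).trans (hθ _ (half_pos hδ₀) (half_lt_self hδ₀)).1⟩
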